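/- Let $\mathbb D$ be the space of càdlàg paths $[0,\infty)\to\mathbb R\cup\{\Delta\}$ ($\Delta$ an isolated cemetery) that stay in $\Delta$ from the lifetime $\zeta=\inf\{t:\ X_t=\Delta\}$ on, with coordinate process $X$ and natural filtration $(\mathcal F_t)$. Let $\alpha\in(0,1)$, $a>0$, and let $\mathbb P$ be the law on $\mathbb D$ of the $\alpha$-stable subordinator issued from $0$ with $\mathbb E[e^{-\lambda X_1}]=e^{-\lambda^\alpha}$, $\lambda\ge 0$. Put $Y_t=a-X_t$ if $X_t<a$ and $Y_t=0$ otherwise, $\varsigma=\inf\{s>0: Y_s=0\}$, and let $\xi$ be the process underlying $Y$ in the Lamperti transform: $\xi_s=\log (Y_{\theta(s)}/a)$ with $\theta(s)=\inf\{r:\int_0^r Y_u^{-\alpha}\,du>s\}$, and $\xi$ is sent to $\Delta$ when $Y$ reaches $0$. Put $e^{\beta\Delta}=0$ for every real $\beta$, write $\zeta_\xi$ for the lifetime of $\xi$, and for a law $\mathbb Q$ call $\lambda\mapsto-\log\mathbb E_{\mathbb Q}[e^{\lambda\xi_1}]$, $\lambda\ge0$, the Laplace exponent of $\xi$ under $\mathbb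 Q$; that it equals $\Psi$ includes here that $\mathbb E_{\mathbb Q}[e^{\lambda\xi_t}]=e^{-t\Psi(\lambda)}$ for all $t\ge0$. Let $U(x)=\int_0^\infty\mathbb P(X_t\le x)\,dt$. Then: 1. Under $\mathbb P$, $\xi$ is the negative of a subordinator killed at an independent exponential time of rate $1/\Gamma(1-\alpha)$, and its Laplace exponent is $$\Phi(\lambda)=\frac{\Gamma(1+\lambda)}{\Gamma(1+\lambda-\alpha)},\qquad\lambda\ge 0.$$ 2. (Conditioned process.) Under $\mathbb P$ and in the natural filtration of $\xi$, $(e^{\alpha\xi_t})_{t\ge0}$ is a supermartingale but not a martingale. There is exactly one probability measure $\mathbb P^{\downarrow}$ on $\mathbb D$ with $$\mathbb P^{\downarrow}(A,\ t<\zeta)=\mathbb E\Big[\tfrac{U(a-X_t)}{U(a)}\mathbf 1_{A\cap\{X_t<a\}}\Big],\qquad t\ge 0,\ A\in\mathcal F_t .$$ The law of $\xi$ under $\mathbb P^{\downarrow}$ is the Esscher transform $\mathbb P^{\downarrow}(A,\ t<\zeta_\xi)=\mathbb E[\mathbf 1_A e^{\alpha\xi_t}]$, $t\ge0$, $A\in\sigma(\xi_s:s\le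 t)$; under $\mathbb P^{\downarrow}$, $\xi$ is the negative of a subordinator killed at an independent exponential time of rate $\Gamma(1+\alpha)$, with Laplace exponent $$\Phi^{\downarrow}(\lambda)=\frac{\Gamma(1+\lambda+\alpha)}{\Gamma(1+\lambda)},\qquad\lambda\ge 0.$$ 3. (Continuously absorbed process.) Under $\mathbb P$ and in the natural filtration of $\xi$, $(e^{(\alpha-1)\xi_t})_{t\ge0}$ is a martingale. $U(dx)$ has a continuous density $u$ on $(0,\infty)$, and there is exactly one probability measure $\mathbb P^{\circ}$ on $\mathbb D$ with $$\mathbb P^{\circ}(A,\ t<\zeta)=\mathbb E\Big[\tfrac{u(a-X_t)}{u(a)}\mathbf 1_{A\cap\{X_t<a\}}\Big],\qquad t\ge 0,\ A\in\mathcal F_t .$$ The law of $\xi$ under $\mathbb P^{\circ}$ is the Esscher transform $\mathbb P^{\circ}(A,\ t<\zeta_\xi)=\mathbb E[\mathbf 1_A e^{(\alpha-1)\xi_t}]$, $t\ge0$, $A\in\sigma(\xi_s:s\le t)$; under $\mathbb P^{\circ}$, $\xi$ is the negative of an unkilled subordinator, with Laplace exponent $$\Phi^{\circ}(\lambda)=\frac{\Gamma(\alpha+\lambda)}{\Gamma(\lambda)}\quad(\lambda>0),\qquad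 \Phi^{\circ}(0)=0.$$ Moreover, almost surely under each of $\mathbb P$, $\mathbb P^\downarrow$, $\mathbb P^\circ$, the Lamperti representation holds: $Y_t=a\,e^{\xi_{\varphi(a^{-\alpha}t)}}$ for all $t<\varsigma$, where $\varphi(s)=\inf\{t>0:\int_0^t e^{\alpha\xi_u}\,du>s\}$. -/

import Mathlib

open MeasureTheory ProbabilityTheory Filter Topology
open scoped NNReal ENNReal

noncomputable section

/-- The state space `ℝ ∪ {Δ}` with an isolated cemetery state `Δ = Sum.inr ()`. -/
abbrev KilledReal : Type := ℝ ⊕ Unit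

/-- The cemetery state `Δ`. -/
def cemetery : KilledReal := Sum.inr ()

/-- The function `x ↦ exp (β x)` on `ℝ ∪ {Δ}`, with the convention `exp (β Δ) = 0`. -/
def killedExp (β : ℝ) : KilledReal → ℝ := Sum.elim (fun x => Real.exp (β * x)) (fun _ => 0)

/-- Càdlàg functions `[0,∞) → ℝ ∪ {Δ}` which stay in `Δ` once they have reached it. -/
structure IsKilledPath (w : ℝ≥0 → KilledReal) : Prop where
  right_continuous : ∀ t, ContinuousWithinAt w (Set.Ici t) t
  left_limit : ∀ t, ∃ l, Tendsto w (𝓝[<] t) (𝓝 l)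
  absorbed : ∀ s t, s ≤ t → w s = cemetery → w t = cemetery

/-- The path space `𝔻`, with the σ-algebra generated by the coordinates. -/
abbrev PathSpace : Type := {w : ℝ≥0 → KilledReal // IsKilledPath w}

/-- The coordinate process on `𝔻`. -/
def coord (t : ℝ≥0) (w : PathSpace) : KilledReal := w.1 t

/-- The coordinate process as a real process (with the dummy value `0` at `Δ`). -/
def realCoord (t : ℝ≥0) (w : PathSpace) : ℝ := Sum.elim id (fun _ => 0) (coord t w)

/-- The lifetime `ζ = inf {t ≥ 0 : X_t = Δ}` of a path in `ℝ ∪ {Δ}`. -/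
def lifetime (w : ℝ≥0 → KilledReal) : ℝ≥0∞ := ⨅ (t : ℝ≥0) (_ : w t = cemetery), (t : ℝ≥0∞)

/-- The σ-algebra generated by `Z_s`, `s ≤ t`. -/
abbrev pastSigma {Ω : Type*} (Z : ℝ≥0 → Ω → KilledReal) (t : ℝ≥0) : MeasurableSpace Ω :=
  ⨆ (s : ℝ≥0) (_ : s ≤ t), MeasurableSpace.comap (Z s) inferInstance

/-- The natural filtration of `Z`. The infimum with the ambient σ-algebra `m` changes nothing
when every `Z s` is `m`-measurable. -/
def pastFiltration {Ω : Type*} [m : MeasurableSpace Ω] (Z : ℝ≥0 → Ω → KilledReal) :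
    Filtration ℝ≥0 m where
  seq t := pastSigma Z t ⊓ m
  mono' := fun _ _ hst => inf_le_inf_right m
    (iSup₂_le fun r hr => le_iSup₂_of_le r (hr.trans hst) le_rfl)
  le' := fun _ => inf_le_right

/-- A (strict, i.e. not killed) subordinator issued from the origin: a real Lévy process with
non-decreasing right-continuous paths. -/
structure IsSubordinator {Ω : Type*} [MeasurableSpace Ω] (σ : ℝ≥0 → Ω → ℝ) (P : Measure Ω) :
    Prop where
  measurable : ∀ t, Measurable (σ t)
  zero : ∀ᵐ ω ∂P, σ 0 ω = 0
  indep : HasIndepIncrements σ P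
  stationary : ∀ s t, P.map (fun ω => σ (s + t) ω - σ s ω) = P.map (σ t)
  monotone : ∀ᵐ ω ∂P, Monotone fun t => σ t ω
  right_continuous : ∀ᵐ ω ∂P, ∀ t, ContinuousWithinAt (fun r => σ r ω) (Set.Ici t) t

/-- `P` is the law on `𝔻` of an `α`-stable subordinator issued from the origin, normalised so that
`E[exp (-lam * X_1)] = exp (-lam ^ α)`. -/
structure IsUnitStableSubordinator (α : ℝ) (P : Measure PathSpace) : Prop where
  not_killed : ∀ᵐ w ∂P, lifetime w.1 = ⊤
  subordinator : IsSubordinator realCoord P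
  scaling : ∀ c : ℝ≥0, 0 < c →
    P.map (fun w (t : ℝ≥0) => (c : ℝ) * realCoord (c ^ (-α) * t) w) =
      P.map (fun w (t : ℝ≥0) => realCoord t w)
  laplace : ∀ lam : ℝ, 0 ≤ lam →
    ∫ w, Real.exp (-lam * realCoord 1 w) ∂P = Real.exp (-lam ^ α)

/-- `ξ` is the negative of a subordinator killed at rate `q`, i.e. at an independent exponential
time `e` of parameter `q` (`e = ∞` almost surely if `q = 0`): `ξ` has almost surely killed càdlàg
paths and it has the same law as `-σ` killed at `e`. -/
def IsNegKilledSubordinator (q : ℝ) {Ω : Type*} [MeasurableSpace Ω]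
    (ξ : ℝ≥0 → Ω → KilledReal) (P : Measure Ω) : Prop :=
  (∀ᵐ ω ∂P, IsKilledPath fun t => ξ t ω) ∧
  ∃ (Ω' : Type) (_ : MeasurableSpace Ω') (P' : Measure Ω') (σ : ℝ≥0 → Ω' → ℝ) (e : Ω' → ℝ≥0∞),
    IsProbabilityMeasure P' ∧ IsSubordinator σ P' ∧ Measurable e ∧
    (∀ t : ℝ≥0, P' {ω | (t : ℝ≥0∞) < e ω} = ENNReal.ofReal (Real.exp (-(q * t)))) ∧
    IndepFun e (fun ω t => σ t ω) P' ∧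
    P.map (fun ω t => ξ t ω) =
      P'.map (fun ω (t : ℝ≥0) => if (t : ℝ≥0∞) < e ω then Sum.inl (-(σ t ω)) else cemetery)

/-- The Laplace exponent `Φ(lam) = -log E[exp (lam * ξ_1)]`, where `exp (lam * Δ) = 0`. -/
def laplaceExponent {Ω : Type*} [MeasurableSpace Ω] (ξ : ℝ≥0 → Ω → KilledReal) (P : Measure Ω)
    (lam : ℝ) : ℝ :=
  -Real.log (∫ ω, killedExp lam (ξ 1 ω) ∂P)

/-- The Laplace exponent of `ξ` at `lam` is `φ`, and `E[exp (lam * ξ_t)] = exp (-t φ)` for all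
`t` (so that no logarithm of zero is hidden in the exponent). -/
def HasLaplaceExponentAt {Ω : Type*} [MeasurableSpace Ω] (ξ : ℝ≥0 → Ω → KilledReal)
    (P : Measure Ω) (lam φ : ℝ) : Prop :=
  laplaceExponent ξ P lam = φ ∧
    ∀ t : ℝ≥0, ∫ ω, killedExp lam (ξ t ω) ∂P = Real.exp (-(t * φ))

/-! ### The conditioned processes -/

/-- The renewal function `U(x) = ∫_0^∞ P(X_t ≤ x) dt`. -/
def renewal (P : Measure PathSpace) (x : ℝ) : ℝ≥0∞ :=
  ∫⁻ t in Set.Ici (0 : ℝ), P {w | ∃ y ≤ x, coord t.toNNReal w = Sum.inl y}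

/-- `u` is a continuous density of the measure `U(dx)` on `(0,∞)`. -/
def IsRenewalDensity (P : Measure PathSpace) (u : ℝ → ℝ≥0) : Prop :=
  ContinuousOn u (Set.Ioi 0) ∧
    ∀ x y : ℝ, 0 < x → x ≤ y → renewal P y = renewal P x + ∫⁻ z in Set.Ioc x y, (u z : ℝ≥0∞)

/-- `Q` is the Doob `h`-transform of `P` (issued from the origin): it is the probability measure on
`𝔻` with `Q(A, t < ζ) = E[1_A h(X_t) / h(0)]` for `A ∈ 𝓕_t`, where `h(Δ) = 0`. -/
def IsDoobTransform (P : Measure PathSpace) (h : ℝ → ℝ≥0∞) (Q : Measure PathSpace) : Prop :=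
  IsProbabilityMeasure Q ∧
    ∀ (t : ℝ≥0) (A : Set PathSpace), MeasurableSet[pastSigma coord t] A →
      Q (A ∩ {w | (t : ℝ≥0∞) < lifetime w.1}) =
        ∫⁻ w in A, Sum.elim h (fun _ => 0) (coord t w) / h 0 ∂P

/-- `Q` is the law `P^↓` of the subordinator conditioned to stay below `a`, i.e.
`dQ/dP = U(a - X_t) / U(a) 1_{X_t < a}` on `𝓕_t`. -/
def IsConditionedBelow (a : ℝ) (P Q : Measure PathSpace) : Prop :=
  IsDoobTransform P (fun x => if x < a then renewal P (a - x) else 0) Q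

/-- `Q` is the law `P^∘` of the subordinator conditioned to be continuously absorbed at `a`, i.e.
`dQ/dP = u(a - X_t) / u(a) 1_{X_t < a}` on `𝓕_t`, where `u` is the continuous renewal density. -/
def IsContinuouslyAbsorbed (a : ℝ) (P Q : Measure PathSpace) : Prop :=
  ∃ u : ℝ → ℝ≥0, IsRenewalDensity P u ∧
    IsDoobTransform P (fun x => if x < a then (u (a - x) : ℝ≥0∞) else 0) Q

/-! ### The Lamperti transform -/

/-- `Y_t = a - X_t` if `X_t < a`, and `Y_t = 0` otherwise (also when `X_t = Δ`). -/
def pssMp (a : ℝ) (t : ℝ≥0) (w : PathSpace) : ℝ :=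
  Sum.elim (fun x => if x < a then a - x else 0) (fun _ => 0) (coord t w)

/-- `inf {s > 0 : Y_s = 0}`. -/
def absorptionTime (a : ℝ) (w : PathSpace) : ℝ≥0∞ :=
  ⨅ (s : ℝ≥0) (_ : 0 < s ∧ pssMp a s w = 0), (s : ℝ≥0∞)

/-- The Lamperti clock `r ↦ ∫_0^r Y_u^(-α) du`, which is infinite once `Y` has been at `0` for a
positive time. -/
def lampertiClock (α a : ℝ) (r : ℝ≥0) (w : PathSpace) : ℝ≥0∞ :=
  ∫⁻ u in Set.Icc (0 : ℝ) r, ENNReal.ofReal (pssMp a u.toNNReal w) ^ (-α)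

/-- The inverse `s ↦ inf {r : ∫_0^r Y_u^(-α) du > s}` of the Lamperti clock. -/
def lampertiTime (α a : ℝ) (s : ℝ≥0) (w : PathSpace) : ℝ≥0∞ :=
  ⨅ (r : ℝ≥0) (_ : (s : ℝ≥0∞) < lampertiClock α a r w), (r : ℝ≥0∞)

open scoped Classical in
/-- The process `ξ` underlying `Y` in the Lamperti transform: `ξ_s = log (Y_r / a)`, where `r` is
the value at `s` of the inverse clock, killed when `Y` reaches `0`. -/
def lamperti (α a : ℝ) (s : ℝ≥0) (w : PathSpace) : KilledReal :=
  if lampertiTime α a s w ≠ ⊤ ∧ 0 < pssMp a (lampertiTime α a s w).toNNReal w then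
    Sum.inl (Real.log (pssMp a (lampertiTime α a s w).toNNReal w / a))
  else cemetery

/-- `φ(s) = inf {t > 0 : ∫_0^t exp (α ξ_u) du > s}` for a path `x` of `ξ`. -/
def lampertiPhi (α : ℝ) (x : ℝ≥0 → KilledReal) (s : ℝ≥0∞) : ℝ≥0∞ :=
  ⨅ (t : ℝ≥0) (_ : 0 < t ∧
    s < ∫⁻ u in Set.Icc (0 : ℝ) t, ENNReal.ofReal (killedExp α (x u.toNNReal))), (t : ℝ≥0∞)

/-- The Lamperti representation along the path `w`: if `Y` is absorbed at `0` at time `T`, then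
`Y_t = a exp (ξ_r)` with `r = φ(a^(-α) t)` finite, for all `t < T`. -/
def LampertiRepresentation (α a : ℝ) (w : PathSpace) : Prop :=
  ∀ t : ℝ≥0, (t : ℝ≥0∞) < absorptionTime a w →
    ∀ r : ℝ≥0∞, r = lampertiPhi α (fun s => lamperti α a s w) (ENNReal.ofReal (a ^ (-α) * t)) →
      r ≠ ⊤ ∧ pssMp a t w = a * killedExp 1 (lamperti α a r.toNNReal w)

/-- The law of `ξ` under `Q` is the exponential change of measure of its law under `P` with density
`exp (β ξ_t)`: `Q(A, t < ζ) = E_P[1_A exp (β ξ_t)]` for `A ∈ σ(ξ_s : s ≤ t)`, where `ζ` is the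
lifetime of `ξ`. -/
def IsEsscherTransform {Ω : Type*} [MeasurableSpace Ω] (β : ℝ) (ξ : ℝ≥0 → Ω → KilledReal)
    (P Q : Measure Ω) : Prop :=
  ∀ (t : ℝ≥0) (A : Set Ω), MeasurableSet[pastSigma ξ t] A →
    Q (A ∩ {ω | (t : ℝ≥0∞) < lifetime fun s => ξ s ω}) =
      ∫⁻ ω in A, ENNReal.ofReal (killedExp β (ξ t ω)) ∂P

end

/-!
Let `Y` be the distance of the stable subordinator `X` to the level `a`, and `ξ` its Lamperti transform.

*Lévy property.* By the Markov property and the scaling of `X`, the path of `Y` after a fixed time `u`,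
rescaled so as to start again from `a`, is independent of the past and has the law of `Y`
(`lintegral_restartPath`). The Lamperti transform turns the rescaling into a translation. Integrating over
`u` against the clock `Y_u^(-α) du` (`lintegral_time_change`) converts statements at fixed times of `Y` into
statements at almost every time of `ξ`, and right-continuity of `ξ` gives all times: on survival, the
increments of `ξ` after time `s` are independent of the past and distributed as `ξ`
(`map_past_increments`). No stopping times are needed.

*Exponent.* Hence `t ↦ E[exp (lam * ξ_t)]` is multiplicative, so it is an exponential, whose rate is the
inverse of its integral over time. The same time change writes this integral as
`∫ ((a - x) / a)^lam (a - x)^(-α) U(dx)` over `(0, a)`. The potential measure `U(dx)` has density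
`x^(α-1) / Γ(α)`: after an exponential tilt both are Gamma laws (`lintegral_potential`). What remains is a
Beta integral, and the rate is `φ(lam) = Γ(1 + lam) / Γ(1 + lam - α)` for `lam > α - 1`; it vanishes in the
limit `lam = α - 1` (`expMoment_eq`). The three exponents of the theorem are `φ(lam)`, `φ(lam + α)` and
`φ(lam + α - 1)`, and the (super)martingale properties of `exp (α ξ)` and `exp ((α - 1) ξ)` follow from
`φ(α) > 0` and `φ(α - 1) = 0`.

*Doob transforms.* As `U(x)` and its density `u(x)` are multiples of `x^α` and `x^(α-1)`, both `P↓` and `P°`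
have density `(Y_t / a)^β = exp (β ξ)`, taken at the clock time of `t`, for `β = α` and `β = α - 1`
(`IsPowerTransform`). The time change argument, now with the change of measure at fixed times of `Y`, shows
that `ξ` undergoes the Esscher transform of parameter `β` (`IsPowerTransform.isEsscherTransform`).

*Killed subordinators.* All laws of `ξ` are thus Esscher transforms of its law under `P`, with `β = 0` for
`P` itself. Changing the measure by `exp (T φ(β) + β ξ_T)` yields a law under which `ξ` survives until `T`
and has stationary independent increments. Gluing independent segments of length one gives a strict
subordinator `σ` on the whole half-line (`exists_tilted_subordinator`), and the law of `ξ` under the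
Esscher transform is that of `-σ` killed at an independent exponential time of rate `φ(β)`
(`isNegKilledSubordinator_of_isEsscherTransform`). Two laws of killed paths agree once they agree on the
events of survival (`ext_of_alive`), which is also why the Doob transforms are unique.

*Existence.* Doob transforms are constructed without a projective limit. For `P↓`, the subordinator is killed
at a time which is uniform before the passage above `a`, under the law biased by the passage time
(`exists_isPowerTransform_self`). For `P°`, the exponent at `β = α - 1` vanishes and `σ` is not killed: the law
is that of the inverse Lamperti transform of `-σ` (`exists_isPowerTransform_of_stableExponent_eq_zero`).
-/

/-! ### The state space and measurability of right-continuous processes -/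

/-- The real value of a point of `ℝ ∪ {Δ}`, with the dummy value `0` at `Δ`. -/
noncomputable def valK : KilledReal → ℝ := Sum.elim id fun _ => 0

@[simp] lemma valK_inl (x : ℝ) : valK (Sum.inl x) = x := rfl

lemma eq_inl_valK {x : KilledReal} (hx : x ≠ cemetery) : x = Sum.inl (valK x) := by
  rcases x with x | ⟨⟩
  · rfl
  · exact absurd rfl hx

@[simp] lemma inl_ne_cemetery (x : ℝ) : (Sum.inl x : KilledReal) ≠ cemetery := Sum.inl_ne_inr

@[simp] lemma killedExp_inl (β x : ℝ) : killedExp β (Sum.inl x) = Real.exp (β * x) := rfl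

@[simp] lemma killedExp_cemetery (β : ℝ) : killedExp β cemetery = 0 := rfl

instance borelSpace_killedReal : BorelSpace KilledReal where
  measurable_eq := by
    apply le_antisymm
    · intro s hs
      have h1 : MeasurableSet (Sum.inl ⁻¹' s : Set ℝ) := hs.preimage measurable_inl
      have h2 : IsOpen (Sum.inr ⁻¹' s : Set Unit) := isOpen_discrete _
      have hs' : s = Sum.inl '' (Sum.inl ⁻¹' s) ∪ Sum.inr '' (Sum.inr ⁻¹' s) := by
        ext x
        rcases x with x | x
        · simp
        · simpa using ⟨fun h => ⟨x, h⟩, fun ⟨_, h⟩ => h⟩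
      borelize KilledReal
      rw [hs']
      refine MeasurableSet.union ?_ (isOpenMap_inr _ h2).measurableSet
      exact (Topology.IsOpenEmbedding.inl (X := ℝ) (Y := Unit)).measurableEmbedding.measurableSet_image.2 h1
    · apply MeasurableSpace.generateFrom_le
      intro s hs
      exact ⟨(isOpen_sum_iff.1 hs).1.measurableSet,
        (MeasurableSet.of_discrete : MeasurableSet (Sum.inr ⁻¹' s : Set Unit))⟩

lemma measurable_valK : Measurable valK :=
  measurable_fun_sum measurable_id measurable_const

lemma measurableSet_cemetery : MeasurableSet ({cemetery} : Set KilledReal) :=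
  measurableSet_singleton _

lemma isOpen_ne_cemetery : IsOpen {x : KilledReal | x ≠ cemetery} := by
  have := isClosed_singleton (x := cemetery)
  exact this.isOpen_compl

lemma continuous_killedExp (β : ℝ) : Continuous (killedExp β) :=
  Continuous.sumElim (by fun_prop) continuous_const

lemma measurable_killedExp (β : ℝ) : Measurable (killedExp β) := (continuous_killedExp β).measurable

lemma killedExp_nonneg (β : ℝ) (x : KilledReal) : 0 ≤ killedExp β x := by
  rcases x with x | x
  · exact (Real.exp_pos _).le
  · exact le_rfl

lemma continuous_valK : Continuous valK := Continuous.sumElim continuous_id continuous_const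

/-- Jointly measurable maps into `ℝ ∪ {Δ}` that act on the real part and fix `Δ`. -/
lemma measurable_ite_cemetery {Ω : Type*} [MeasurableSpace Ω] {f : Ω → KilledReal} {g : Ω → ℝ}
    (hf : Measurable f) (hg : Measurable g) :
    Measurable fun ω => if f ω = cemetery then cemetery else (Sum.inl (g ω) : KilledReal) :=
  Measurable.ite (hf measurableSet_cemetery) measurable_const (measurable_inl.comp hg)

lemma sumMap_eq_ite (g : ℝ → ℝ) (x : KilledReal) :
    (Sum.map g id x : KilledReal) = if x = cemetery then cemetery else Sum.inl (g (valK x)) := by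
  rcases x with x | ⟨⟩
  · simp
  · simp [cemetery]

/-- A process with right-continuous paths and measurable marginals is jointly measurable. -/
lemma measurable_uncurry_of_right_continuous {Ω E : Type*} [MeasurableSpace Ω]
    [TopologicalSpace E] [TopologicalSpace.PseudoMetrizableSpace E] [MeasurableSpace E]
    [BorelSpace E] {Z : ℝ≥0 → Ω → E} (hZ : ∀ t, Measurable (Z t))
    (hc : ∀ ω t, ContinuousWithinAt (fun s => Z s ω) (Set.Ici t) t) :
    Measurable fun p : ℝ≥0 × Ω => Z p.1 p.2 := by
  let d : ℕ → ℝ≥0 → ℝ≥0 := fun n t => ((⌊(n + 1) * t⌋₊ : ℝ≥0) + 1) / (n + 1)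
  refine measurable_of_tendsto_metrizable (f := fun n (p : ℝ≥0 × Ω) => Z (d n p.1) p.2) ?_ ?_
  · intro n
    have h1 : Measurable fun q : ℕ × Ω => Z (((q.1 : ℝ≥0) + 1) / (n + 1)) q.2 :=
      measurable_from_prod_countable_right fun k => hZ (((k : ℝ≥0) + 1) / (n + 1))
    have h2 : Measurable fun p : ℝ≥0 × Ω => (⌊(n + 1) * p.1⌋₊, p.2) :=
      ((Nat.measurable_floor.comp (measurable_const.mul measurable_fst))).prodMk measurable_snd
    have h3 := h1.comp h2
    simp only [Function.comp_def] at h3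
    simpa only [d] using h3
  · rw [tendsto_pi_nhds]
    rintro ⟨t, ω⟩
    have hd : ∀ n, t ≤ d n t := fun n => by
      have hn : (0 : ℝ≥0) < n + 1 := by positivity
      rw [le_div_iff₀ hn, mul_comm]
      exact (Nat.lt_floor_add_one _).le
    have hd' : ∀ n, d n t ≤ t + 1 / ((n : ℝ≥0) + 1) := fun n => by
      have hn : (0 : ℝ≥0) < n + 1 := by positivity
      have : (⌊(n + 1) * t⌋₊ : ℝ≥0) ≤ (n + 1) * t := Nat.floor_le (by positivity)
      calc d n t ≤ ((n + 1) * t + 1) / (n + 1) := by simp only [d]; gcongr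
        _ = t + 1 / ((n : ℝ≥0) + 1) := by field_simp
    have hlim : Tendsto (fun n => d n t) atTop (𝓝[≥] t) := by
      refine tendsto_nhdsWithin_iff.2 ⟨?_, Eventually.of_forall hd⟩
      refine tendsto_of_tendsto_of_tendsto_of_le_of_le tendsto_const_nhds ?_ hd hd'
      simpa using (tendsto_const_nhds (x := t)).add
        (tendsto_one_div_add_atTop_nhds_zero_nat (𝕜 := ℝ≥0))
    exact (hc ω t).tendsto.comp hlim

/-- Two measurable maps into the path space have the same law once they have the same law as
processes. -/
lemma map_pathSpace_eq {Ω Ω' : Type*} [MeasurableSpace Ω] [MeasurableSpace Ω']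
    {μ : Measure Ω} {ν : Measure Ω'} {f : Ω → PathSpace} {g : Ω' → PathSpace}
    (hf : Measurable f) (hg : Measurable g)
    (h : μ.map (fun ω => (f ω).1) = ν.map fun ω => (g ω).1) : μ.map f = ν.map g := by
  ext s hs
  obtain ⟨u, hu, rfl⟩ := hs
  have hs : MeasurableSet (Subtype.val ⁻¹' u : Set PathSpace) := ⟨u, hu, rfl⟩
  rw [Measure.map_apply hf hs, Measure.map_apply hg hs]
  have hf' : Measurable fun ω => (f ω).1 := measurable_subtype_coe.comp hf
  have hg' : Measurable fun ω => (g ω).1 := measurable_subtype_coe.comp hg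
  have := congrArg (fun m => m u) h
  rwa [Measure.map_apply hf' hu, Measure.map_apply hg' hu] at this

lemma measurable_coord (t : ℝ≥0) : Measurable (coord t) :=
  (measurable_pi_apply t).comp measurable_subtype_coe

lemma measurable_pathSpace {Ω : Type*} [MeasurableSpace Ω] {f : Ω → PathSpace}
    (h : ∀ t, Measurable fun ω => coord t (f ω)) : Measurable f :=
  (measurable_pi_lambda _ h).subtype_mk

lemma measurable_coord_uncurry : Measurable fun p : ℝ≥0 × PathSpace => coord p.1 p.2 :=
  measurable_uncurry_of_right_continuous measurable_coord fun w t => w.2.right_continuous t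

lemma realCoord_eq (t : ℝ≥0) (w : PathSpace) : realCoord t w = valK (coord t w) := rfl

lemma measurable_realCoord (t : ℝ≥0) : Measurable (realCoord t) :=
  measurable_valK.comp (measurable_coord t)

lemma pastSigma_eq_comap {Ω : Type*} (Z : ℝ≥0 → Ω → KilledReal) (t : ℝ≥0) :
    pastSigma Z t = MeasurableSpace.comap (fun ω u => Z (min u t) ω) MeasurableSpace.pi := by
  apply le_antisymm
  · refine iSup₂_le fun s hs => ?_
    rintro _ ⟨B, hB, rfl⟩
    refine ⟨(fun x => x s) ⁻¹' B, measurable_pi_apply s hB, ?_⟩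
    ext ω; simp [min_eq_left hs]
  · rw [MeasurableSpace.pi, MeasurableSpace.comap_iSup]
    refine iSup_le fun s => ?_
    rw [MeasurableSpace.comap_comp]
    exact le_iSup₂_of_le (min s t) (min_le_right _ _) le_rfl

/-- A set in the past of `Z` at `t` is described by the path of `Z` stopped at `t`. -/
lemma exists_of_measurableSet_pastSigma {Ω : Type*} {Z : ℝ≥0 → Ω → KilledReal} {t : ℝ≥0}
    {A : Set Ω} (hA : MeasurableSet[pastSigma Z t] A) :
    ∃ B : Set (ℝ≥0 → KilledReal), MeasurableSet B ∧ A = (fun ω u => Z (min u t) ω) ⁻¹' B := by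
  rw [pastSigma_eq_comap] at hA
  obtain ⟨B, hB, rfl⟩ := hA
  exact ⟨B, hB, rfl⟩

/-! ### Lebesgue measure on the half-line -/

/-- Lebesgue measure on `[0,∞)`. -/
noncomputable def halfLebesgue : Measure ℝ≥0 := (volume.restrict (Set.Ici (0 : ℝ))).map Real.toNNReal

lemma lintegral_halfLebesgue {f : ℝ≥0 → ℝ≥0∞} (hf : Measurable f) :
    ∫⁻ u, f u ∂halfLebesgue = ∫⁻ u in Set.Ici (0 : ℝ), f u.toNNReal :=
  lintegral_map hf measurable_real_toNNReal

lemma setLIntegral_halfLebesgue_Iic {f : ℝ≥0 → ℝ≥0∞} (hf : Measurable f) (r : ℝ≥0) :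
    ∫⁻ u in Set.Iic r, f u ∂halfLebesgue = ∫⁻ u in Set.Icc (0 : ℝ) r, f u.toNNReal := by
  rw [halfLebesgue, setLIntegral_map measurableSet_Iic hf measurable_real_toNNReal,
    Measure.restrict_restrict (measurable_real_toNNReal measurableSet_Iic)]
  congr 2
  ext x
  simp only [Set.mem_inter_iff, Set.mem_preimage, Set.mem_Iic, Set.mem_Ici, Set.mem_Icc,
    Real.toNNReal_le_iff_le_coe]
  tauto

lemma halfLebesgue_Iic (r : ℝ≥0) : halfLebesgue (Set.Iic r) = r := by
  have := setLIntegral_halfLebesgue_Iic (f := fun _ => 1) measurable_const r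
  simpa using this

instance nullSingletonClass_halfLebesgue : NullSingletonClass halfLebesgue where
  measure_singleton r := by
    rw [halfLebesgue, Measure.map_apply measurable_real_toNNReal (measurableSet_singleton r),
      Measure.restrict_apply (measurable_real_toNNReal (measurableSet_singleton r))]
    refine measure_mono_null (t := {(r : ℝ)}) ?_ (by simp)
    rintro x ⟨hx, hx0⟩
    simp only [Set.mem_preimage, Set.mem_singleton_iff] at hx ⊢
    rw [← hx, Real.coe_toNNReal _ hx0]

instance sigmaFinite_halfLebesgue : SigmaFinite halfLebesgue := by
  refine ⟨⟨⟨fun n => Set.Iic (n : ℝ≥0), fun _ => trivial, fun n => ?_, ?_⟩⟩⟩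
  · rw [halfLebesgue_Iic]; exact ENNReal.coe_lt_top
  · ext x; simpa using exists_nat_ge x

/-- Affine change of variables on the half-line. -/
lemma setLIntegral_halfLebesgue_Ici {f : ℝ≥0 → ℝ≥0∞} (hf : Measurable f) (t c : ℝ≥0) (hc : c ≠ 0) :
    ∫⁻ u in Set.Ici t, f u ∂halfLebesgue = c * ∫⁻ u, f (t + c * u) ∂halfLebesgue := by
  have hc0 : (0 : ℝ) < c := by positivity
  let F : ℝ → ℝ≥0∞ := (Set.Ici (t : ℝ)).indicator fun x => f x.toNNReal
  have hF : Measurable F :=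
    (hf.comp measurable_real_toNNReal).indicator measurableSet_Ici
  have h1 : ∫⁻ u in Set.Ici t, f u ∂halfLebesgue = ∫⁻ x, F x := by
    rw [halfLebesgue, setLIntegral_map measurableSet_Ici hf measurable_real_toNNReal,
      Measure.restrict_restrict (measurable_real_toNNReal measurableSet_Ici)]
    rw [lintegral_indicator measurableSet_Ici]
    by_cases ht : t = 0
    · subst ht
      congr 2
      ext x; simp
    · congr 2
      ext x
      simp only [Set.mem_inter_iff, Set.mem_preimage, Set.mem_Ici]
      rw [Real.le_toNNReal_iff_coe_le' (pos_iff_ne_zero.2 ht)]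
      exact ⟨fun h => h.1, fun h => ⟨h, t.2.trans h⟩⟩
  have h2 : ∫⁻ x, F x = ENNReal.ofReal c * ∫⁻ x, F (t + c * x) := by
    rw [← lintegral_add_left_eq_self F (t : ℝ)]
    have := Real.smul_map_volume_mul_left hc0.ne'
    have h3 : ∫⁻ x, F (t + x) = ∫⁻ x, F (t + x) ∂(ENNReal.ofReal |(c : ℝ)| •
        Measure.map ((c : ℝ) * ·) volume) := by rw [this]
    rw [h3, lintegral_smul_measure, lintegral_map (by fun_prop) (by fun_prop), abs_of_pos hc0]
    rfl
  rw [h1, h2, lintegral_halfLebesgue (by fun_prop), ← lintegral_indicator measurableSet_Ici]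
  congr 1
  · simp
  · refine lintegral_congr fun x => ?_
    by_cases hx : 0 ≤ x
    · have : (t : ℝ) + c * x ∈ Set.Ici (t : ℝ) := by simp; positivity
      simp only [F]
      rw [Set.indicator_of_mem (show x ∈ Set.Ici (0 : ℝ) from hx), Set.indicator_of_mem this]
      congr 1
      apply NNReal.eq
      rw [Real.coe_toNNReal _ (by positivity)]
      simp [Real.coe_toNNReal _ hx]
    · have : (t : ℝ) + c * x ∉ Set.Ici (t : ℝ) := by
        simp only [Set.mem_Ici, not_le] at hx ⊢; nlinarith
      simp only [F]
      rw [Set.indicator_of_notMem (show x ∉ Set.Ici (0 : ℝ) from hx), Set.indicator_of_notMem this]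

/-! ### The Lamperti transform of a single path -/

lemma halfLebesgue_Ioc {r s : ℝ≥0} (h : r ≤ s) : halfLebesgue (Set.Ioc r s) = ((s - r : ℝ≥0) : ℝ≥0∞) := by
  rw [← Set.Iic_sdiff_Iic, measure_sdiff (Set.Iic_subset_Iic.2 h) measurableSet_Iic.nullMeasurableSet
    (by rw [halfLebesgue_Iic]; exact ENNReal.coe_ne_top), halfLebesgue_Iic, halfLebesgue_Iic,
    ENNReal.coe_sub]

/-- The clock `r ↦ ∫_0^r y_u^(-α) du` of a path `y`. -/
noncomputable def clockOf (α : ℝ) (y : ℝ≥0 → ℝ) (r : ℝ≥0) : ℝ≥0∞ :=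
  ∫⁻ u in Set.Icc (0 : ℝ) r, ENNReal.ofReal (y u.toNNReal) ^ (-α)

/-- The right-continuous inverse of the clock of `y`. -/
noncomputable def invClockOf (α : ℝ) (y : ℝ≥0 → ℝ) (s : ℝ≥0) : ℝ≥0∞ :=
  ⨅ (r : ℝ≥0) (_ : (s : ℝ≥0∞) < clockOf α y r), (r : ℝ≥0∞)

open scoped Classical in
/-- The Lamperti transform of a single path `y` issued from `a`. -/
noncomputable def lampertiOf (α a : ℝ) (y : ℝ≥0 → ℝ) (s : ℝ≥0) : KilledReal :=
  if invClockOf α y s ≠ ⊤ ∧ 0 < y (invClockOf α y s).toNNReal then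
    Sum.inl (Real.log (y (invClockOf α y s).toNNReal / a))
  else cemetery

lemma lamperti_eq_lampertiOf (α a : ℝ) (s : ℝ≥0) (w : PathSpace) :
    lamperti α a s w = lampertiOf α a (fun t => pssMp a t w) s := by
  unfold lamperti lampertiOf
  rfl

/-- Non-increasing, non-negative right-continuous paths issued from `a`. -/
structure IsDecreasingPath (a : ℝ) (y : ℝ≥0 → ℝ) : Prop where
  antitone : Antitone y
  nonneg : ∀ t, 0 ≤ y t
  right_continuous : ∀ t, ContinuousWithinAt y (Set.Ici t) t
  zero : y 0 = a

namespace IsDecreasingPath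

variable {α a : ℝ} {y : ℝ≥0 → ℝ}

lemma measurable_weight (hy : IsDecreasingPath a y) :
    Measurable fun u => ENNReal.ofReal (y u) ^ (-α) :=
  (hy.antitone.measurable.ennreal_ofReal).pow_const _

lemma clockOf_eq (hy : IsDecreasingPath a y) (r : ℝ≥0) :
    clockOf α y r = ∫⁻ u in Set.Iic r, ENNReal.ofReal (y u) ^ (-α) ∂halfLebesgue :=
  (setLIntegral_halfLebesgue_Iic hy.measurable_weight r).symm

lemma clockOf_add (hy : IsDecreasingPath a y) {r s : ℝ≥0} (h : r ≤ s) :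
    clockOf α y s = clockOf α y r + ∫⁻ u in Set.Ioc r s, ENNReal.ofReal (y u) ^ (-α) ∂halfLebesgue := by
  rw [hy.clockOf_eq, hy.clockOf_eq, ← lintegral_union measurableSet_Ioc, Set.Iic_union_Ioc_eq_Iic h]
  exact Set.disjoint_left.2 fun x hx hx' => absurd hx'.1 (not_lt.2 hx)

lemma clockOf_mono (hy : IsDecreasingPath a y) : Monotone (clockOf α y) := fun r s h => by
  rw [hy.clockOf_add h]; exact le_self_add

lemma weight_le (hα : 0 < α) (hy : IsDecreasingPath a y) {u v : ℝ≥0} (h : u ≤ v) :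
    ENNReal.ofReal (y u) ^ (-α) ≤ ENNReal.ofReal (y v) ^ (-α) := by
  rw [ENNReal.rpow_neg, ENNReal.rpow_neg]
  exact ENNReal.inv_le_inv.2 (ENNReal.rpow_le_rpow (ENNReal.ofReal_le_ofReal (hy.antitone h)) hα.le)

lemma weight_ne_top {r : ℝ≥0} (hr : 0 < y r) : ENNReal.ofReal (y r) ^ (-α) ≠ ⊤ :=
  ENNReal.rpow_ne_top_of_ne_zero (by simpa using hr) ENNReal.ofReal_ne_top

lemma weight_ne_zero (hα : 0 < α) (r : ℝ≥0) : ENNReal.ofReal (y r) ^ (-α) ≠ 0 := by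
  rw [ENNReal.rpow_neg, ENNReal.inv_ne_zero]
  exact ENNReal.rpow_ne_top_of_nonneg hα.le ENNReal.ofReal_ne_top

lemma clockOf_le (hα : 0 < α) (hy : IsDecreasingPath a y) {r s v : ℝ≥0} (h : r ≤ s) (hs : s ≤ v) :
    clockOf α y s ≤ clockOf α y r + ((s - r : ℝ≥0) : ℝ≥0∞) * ENNReal.ofReal (y v) ^ (-α) := by
  rw [hy.clockOf_add h]
  gcongr
  calc _ ≤ ∫⁻ _ in Set.Ioc r s, ENNReal.ofReal (y v) ^ (-α) ∂halfLebesgue :=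
        setLIntegral_mono measurable_const fun u hu => hy.weight_le hα (hu.2.trans hs)
    _ = _ := by rw [setLIntegral_const, halfLebesgue_Ioc h, mul_comm]

lemma clockOf_zero (hy : IsDecreasingPath a y) : clockOf α y 0 = 0 := by
  rw [hy.clockOf_eq, setLIntegral_measure_zero]
  simpa using halfLebesgue_Iic 0

lemma clockOf_ne_top (hα : 0 < α) (hy : IsDecreasingPath a y) {r : ℝ≥0} (hr : 0 < y r) :
    clockOf α y r ≠ ⊤ := by
  have := hy.clockOf_le hα (zero_le (a := r)) le_rfl
  rw [hy.clockOf_zero, zero_add] at this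
  exact ne_top_of_le_ne_top (ENNReal.mul_ne_top ENNReal.coe_ne_top (weight_ne_top hr)) this

lemma clockOf_lt (hα : 0 < α) (hy : IsDecreasingPath a y) {r s : ℝ≥0} (h : r < s)
    (hr : clockOf α y r ≠ ⊤) : clockOf α y r < clockOf α y s := by
  rw [hy.clockOf_add h.le]
  refine ENNReal.lt_add_right hr fun h0 => ?_
  have h1 : ((s - r : ℝ≥0) : ℝ≥0∞) * ENNReal.ofReal (y 0) ^ (-α) ≤ 0 := by
    rw [← h0]
    calc _ = ∫⁻ _ in Set.Ioc r s, ENNReal.ofReal (y 0) ^ (-α) ∂halfLebesgue := by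
          rw [setLIntegral_const, halfLebesgue_Ioc h.le, mul_comm]
      _ ≤ _ := setLIntegral_mono hy.measurable_weight fun u _ => hy.weight_le hα zero_le
  rcases mul_eq_zero.1 (le_antisymm h1 zero_le) with h2 | h2
  · have : s - r = 0 := by exact_mod_cast h2
    exact absurd (tsub_eq_zero_iff_le.1 this) (not_le.2 h)
  · exact weight_ne_zero hα 0 h2

lemma clockOf_lt_iff (hα : 0 < α) (hy : IsDecreasingPath a y) {r s : ℝ≥0} (hr : 0 < y r) :
    clockOf α y r < clockOf α y s ↔ r < s :=
  ⟨fun h => lt_of_not_ge fun h' => absurd h (not_lt.2 (hy.clockOf_mono h')),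
    fun h => hy.clockOf_lt hα h (hy.clockOf_ne_top hα hr)⟩

lemma invClockOf_le {r s : ℝ≥0} (h : (s : ℝ≥0∞) < clockOf α y r) : invClockOf α y s ≤ r :=
  iInf₂_le (f := fun (r : ℝ≥0) (_ : (s : ℝ≥0∞) < clockOf α y r) => (r : ℝ≥0∞)) r h

lemma invClockOf_clockOf (hα : 0 < α) (hy : IsDecreasingPath a y) {r : ℝ≥0} (hr : 0 < y r) {s : ℝ≥0}
    (hs : clockOf α y r = s) : invClockOf α y s = r := by
  apply le_antisymm
  · refine le_of_forall_gt fun b hb => ?_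
    obtain ⟨c, hc1, hc2⟩ := ENNReal.lt_iff_exists_nnreal_btwn.1 hb
    refine lt_of_le_of_lt (invClockOf_le (r := c) ?_) hc2
    rw [← hs]
    exact hy.clockOf_lt hα (by exact_mod_cast hc1) (by rw [hs]; exact ENNReal.coe_ne_top)
  · refine le_iInf₂ fun c hc => ?_
    rw [← hs, hy.clockOf_lt_iff hα hr] at hc
    exact_mod_cast hc.le

lemma lampertiOf_clockOf (hα : 0 < α) (hy : IsDecreasingPath a y) {r : ℝ≥0} (hr : 0 < y r)
    {s : ℝ≥0} (hs : clockOf α y r = s) : lampertiOf α a y s = Sum.inl (Real.log (y r / a)) := by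
  have := hy.invClockOf_clockOf hα hr hs
  rw [lampertiOf, this, ENNReal.toNNReal_coe, if_pos ⟨ENNReal.coe_ne_top, hr⟩]

/-- Slightly later, a positive right-continuous path is still positive. -/
lemma exists_pos_gt (hy : IsDecreasingPath a y) {r : ℝ≥0} (hr : 0 < y r) : ∃ v, r < v ∧ 0 < y v := by
  have h1 : ∀ᶠ v in 𝓝[>] r, 0 < y v :=
    ((hy.right_continuous r).mono Set.Ioi_subset_Ici_self).eventually (lt_mem_nhds hr)
  have h2 : ∀ᶠ v in 𝓝[>] r, r < v := self_mem_nhdsWithin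
  exact (h2.and h1).exists

/-- At an instant of finite inverse clock at which the path is positive, the clock is continuous. -/
lemma clockOf_invClockOf (hα : 0 < α) (hy : IsDecreasingPath a y) {r s : ℝ≥0} (hr : 0 < y r)
    (hs : invClockOf α y s = r) : clockOf α y r = s := by
  obtain ⟨v, hrv, hv⟩ := hy.exists_pos_gt hr
  set K : ℝ≥0 := (ENNReal.ofReal (y v) ^ (-α)).toNNReal with hK
  have hK' : (K : ℝ≥0∞) = ENNReal.ofReal (y v) ^ (-α) := ENNReal.coe_toNNReal (weight_ne_top hv)
  apply le_antisymm
  · -- the clock is at most `s` strictly before `r`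
    refine ENNReal.le_of_forall_pos_le_add fun ε hε _ => ?_
    rcases eq_or_ne r 0 with rfl | hr0
    · rw [hy.clockOf_zero]; exact zero_le
    set d : ℝ≥0 := min r (ε / (K + 1))
    have hd : 0 < d := lt_min (pos_iff_ne_zero.2 hr0) (by positivity)
    have h1 : clockOf α y (r - d) ≤ s := by
      by_contra hcon
      have : (r : ℝ≥0∞) ≤ ((r - d : ℝ≥0) : ℝ≥0∞) := by
        rw [← hs]; exact invClockOf_le (not_le.1 hcon)
      have h3 : r ≤ r - d := by exact_mod_cast this
      exact absurd h3 (not_le.2 (tsub_lt_self (pos_iff_ne_zero.2 hr0) hd))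
    refine (hy.clockOf_le hα (tsub_le_self (a := r) (b := d)) hrv.le).trans ?_
    refine add_le_add h1 ?_
    rw [tsub_tsub_cancel_of_le (min_le_left _ _), ← hK']
    norm_cast
    calc d * K ≤ ε / (K + 1) * (K + 1) := by
          gcongr
          · exact min_le_right _ _
          · exact le_self_add
      _ = ε := by field_simp
  · refine ENNReal.le_of_forall_pos_le_add fun ε hε _ => ?_
    set d : ℝ≥0 := min (v - r) (ε / (K + 1))
    have hd : 0 < d := lt_min (tsub_pos_of_lt hrv) (by positivity)
    have h1 : (s : ℝ≥0∞) < clockOf α y (r + d) := by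
      by_contra hcon
      have : ((r + d : ℝ≥0) : ℝ≥0∞) ≤ r := by
        rw [← hs]
        refine le_iInf₂ fun c hc => ?_
        by_contra h2
        have : c ≤ r + d := by exact_mod_cast (not_le.1 h2).le
        exact hcon (hc.trans_le (hy.clockOf_mono this))
      have h3 : r + d ≤ r := by exact_mod_cast this
      exact absurd h3 (not_le.2 (lt_add_of_pos_right _ hd))
    have h2 : r + d ≤ v := by
      calc r + d ≤ r + (v - r) := by gcongr; exact min_le_left _ _
        _ = v := add_tsub_cancel_of_le hrv.le
    refine h1.le.trans ((hy.clockOf_le hα (le_self_add (a := r) (b := d)) h2).trans ?_)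
    gcongr
    rw [add_tsub_cancel_left, ← hK']
    norm_cast
    calc d * K ≤ ε / (K + 1) * (K + 1) := by
          gcongr
          · exact min_le_right _ _
          · exact le_self_add
      _ = ε := by field_simp

/-- The transform is alive at `s` only if `s` is the value of the clock at an instant at which the
path is positive. -/
lemma exists_of_lampertiOf_ne (hα : 0 < α) (hy : IsDecreasingPath a y) {s : ℝ≥0}
    (hs : lampertiOf α a y s ≠ cemetery) : ∃ r, 0 < y r ∧ clockOf α y r = s := by
  rw [lampertiOf] at hs
  split_ifs at hs with h
  · exact ⟨_, h.2, hy.clockOf_invClockOf hα h.2 (ENNReal.coe_toNNReal h.1).symm⟩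
  · exact absurd rfl hs

/-- Below a finite value of the clock, the transform is alive. -/
lemma exists_of_le_clockOf (hα : 0 < α) (hy : IsDecreasingPath a y) {r s : ℝ≥0} (hr : 0 < y r)
    (hs : (s : ℝ≥0∞) ≤ clockOf α y r) : ∃ v ≤ r, 0 < y v ∧ clockOf α y v = s := by
  rcases hs.eq_or_lt with h | h
  · exact ⟨r, le_rfl, hr, h.symm⟩
  · have h1 : invClockOf α y s ≤ r := invClockOf_le h
    have h2 : invClockOf α y s ≠ ⊤ := ne_top_of_le_ne_top ENNReal.coe_ne_top h1
    have h3 : (invClockOf α y s).toNNReal ≤ r := by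
      rw [← ENNReal.toNNReal_coe r]; exact ENNReal.toNNReal_mono ENNReal.coe_ne_top h1
    have h4 : 0 < y (invClockOf α y s).toNNReal := hr.trans_le (hy.antitone h3)
    exact ⟨_, h3, h4, hy.clockOf_invClockOf hα h4 (ENNReal.coe_toNNReal h2).symm⟩

lemma lampertiOf_ne_of_le (hα : 0 < α) (hy : IsDecreasingPath a y) {s t : ℝ≥0} (hst : s ≤ t)
    (ht : lampertiOf α a y t ≠ cemetery) : lampertiOf α a y s ≠ cemetery := by
  obtain ⟨r, hr, hrt⟩ := hy.exists_of_lampertiOf_ne hα ht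
  obtain ⟨v, -, hv, hvs⟩ := hy.exists_of_le_clockOf (s := s) hα hr (by rw [hrt]; exact_mod_cast hst)
  rw [hy.lampertiOf_clockOf hα hv hvs]
  exact inl_ne_cemetery _

lemma pos_of_start (ha : 0 < a) (hy : IsDecreasingPath a y) : 0 < y 0 := by rw [hy.zero]; exact ha

lemma lampertiOf_zero (hα : 0 < α) (ha : 0 < a) (hy : IsDecreasingPath a y) :
    lampertiOf α a y 0 = Sum.inl 0 := by
  rw [hy.lampertiOf_clockOf hα (hy.pos_of_start ha) (by rw [hy.clockOf_zero]; rfl), hy.zero,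
    div_self ha.ne', Real.log_one]

/-- Along its lifetime the transform is non-increasing. -/
lemma valK_lampertiOf_le (hα : 0 < α) (ha : 0 < a) (hy : IsDecreasingPath a y) {s t : ℝ≥0}
    (hst : s ≤ t) (ht : lampertiOf α a y t ≠ cemetery) :
    valK (lampertiOf α a y t) ≤ valK (lampertiOf α a y s) := by
  obtain ⟨r, hr, hrt⟩ := hy.exists_of_lampertiOf_ne hα ht
  obtain ⟨v, hvr, hv, hvs⟩ := hy.exists_of_le_clockOf (s := s) hα hr (by rw [hrt]; exact_mod_cast hst)
  rw [hy.lampertiOf_clockOf hα hv hvs, hy.lampertiOf_clockOf hα hr hrt]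
  simp only [valK_inl]
  have := hy.antitone hvr
  gcongr

lemma lampertiOf_right_continuous (hα : 0 < α) (ha : 0 < a) (hy : IsDecreasingPath a y) (s : ℝ≥0) :
    ContinuousWithinAt (lampertiOf α a y) (Set.Ici s) s := by
  by_cases hs : lampertiOf α a y s = cemetery
  · refine (continuousWithinAt_const (b := cemetery)).congr (fun t ht => ?_) hs
    by_contra h
    exact hy.lampertiOf_ne_of_le hα ht h hs
  · obtain ⟨r, hr, hrs⟩ := hy.exists_of_lampertiOf_ne hα hs
    rw [ContinuousWithinAt, hy.lampertiOf_clockOf hα hr hrs]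
    have hg : ContinuousWithinAt (fun v => (Sum.inl (Real.log (y v / a)) : KilledReal)) (Set.Ici r) r :=
      continuous_inl.continuousAt.comp_continuousWithinAt
        (((hy.right_continuous r).div_const a).log (by positivity))
    intro U hU
    have h1 := hg hU
    rw [mem_map, mem_nhdsWithin_iff_exists_mem_nhds_inter] at h1
    obtain ⟨N, hN, hNU⟩ := h1
    obtain ⟨v0, hrv0, hv0⟩ := hy.exists_pos_gt hr
    obtain ⟨v, hrv, hvN⟩ := exists_Ico_subset_of_mem_nhds hN ⟨v0, hrv0⟩
    have hvv : r < min v v0 := lt_min hrv hrv0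
    have hpos : 0 < y (min v v0) := hv0.trans_le (hy.antitone (min_le_right _ _))
    have hlt : (s : ℝ≥0∞) < clockOf α y (min v v0) := by
      rw [← hrs]; exact (hy.clockOf_lt_iff hα hr).2 hvv
    set A : ℝ≥0 := (clockOf α y (min v v0)).toNNReal with hA
    have hA' : (A : ℝ≥0∞) = clockOf α y (min v v0) :=
      ENNReal.coe_toNNReal (hy.clockOf_ne_top hα hpos)
    have hsA : s < A := by rw [← hA'] at hlt; exact_mod_cast hlt
    rw [mem_map]
    filter_upwards [Ico_mem_nhdsGE hsA] with t ht
    obtain ⟨q, hq, hq0, hqt⟩ := hy.exists_of_le_clockOf (s := t) hα hpos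
      (by rw [← hA']; exact_mod_cast ht.2.le)
    have hrq : r ≤ q := by
      by_contra hcon
      have := (hy.clockOf_lt_iff hα hq0).2 (not_le.1 hcon)
      rw [hqt, hrs] at this
      exact absurd ht.1 (not_le.2 (by exact_mod_cast this))
    have hqv : q < v := by
      refine lt_of_le_of_ne (hq.trans (min_le_left _ _)) fun h => ?_
      have h5 : min v v0 ≤ q := by rw [h]; exact min_le_left _ _
      have := hy.clockOf_mono (α := α) h5
      rw [hqt, ← hA'] at this
      exact absurd ht.2 (not_lt.2 (by exact_mod_cast this))
    rw [Set.mem_preimage, hy.lampertiOf_clockOf hα hq0 hqt]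
    exact hNU ⟨hvN ⟨hrq, hqv⟩, hrq⟩

/-- The transform has killed càdlàg paths as soon as it is bounded below on bounded parts of its
lifetime, which rules out an explosion to `-∞`. -/
lemma isKilledPath_lampertiOf (hα : 0 < α) (ha : 0 < a) (hy : IsDecreasingPath a y)
    (hb : ∀ t : ℝ≥0, ∃ c : ℝ, ∀ s < t, lampertiOf α a y s ≠ cemetery → c ≤ valK (lampertiOf α a y s)) :
    IsKilledPath (lampertiOf α a y) where
  right_continuous := hy.lampertiOf_right_continuous hα ha
  absorbed s t hst hs := by
    by_contra h
    exact hy.lampertiOf_ne_of_le hα hst h hs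
  left_limit t := by
    by_cases hall : ∀ s < t, lampertiOf α a y s ≠ cemetery
    · obtain ⟨c, hc⟩ := hb t
      have hm : AntitoneOn (fun s => valK (lampertiOf α a y s)) (Set.Iio t) := fun s _ s' hs' h =>
        hy.valK_lampertiOf_le hα ha h (hall s' hs')
      have hlim := AntitoneOn.tendsto_nhdsLT hm
        ⟨c, by rintro _ ⟨s, hs, rfl⟩; exact hc s hs (hall s hs)⟩
      refine ⟨Sum.inl _, ((continuous_inl.tendsto _).comp hlim).congr' ?_⟩
      filter_upwards [self_mem_nhdsWithin] with s hs
      exact (eq_inl_valK (hall s hs)).symm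
    · push Not at hall
      obtain ⟨s, hs, hsd⟩ := hall
      refine ⟨cemetery, tendsto_const_nhds.congr' ?_⟩
      filter_upwards [Ioo_mem_nhdsLT hs] with s' hs'
      by_contra h
      exact hy.lampertiOf_ne_of_le hα hs'.1.le (Ne.symm h) hsd

end IsDecreasingPath

lemma measurable_of_right_continuous {E : Type*}
    [TopologicalSpace E] [TopologicalSpace.PseudoMetrizableSpace E] [MeasurableSpace E]
    [BorelSpace E] {x : ℝ≥0 → E} (hc : ∀ t, ContinuousWithinAt x (Set.Ici t) t) : Measurable x :=
  (measurable_uncurry_of_right_continuous (Ω := Unit) (Z := fun t _ => x t)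
    (fun _ => measurable_const) (fun _ => hc)).comp (measurable_id.prodMk (measurable_const (a := ())))

/-- A path that stays in `Δ` and is right-continuous is alive at `t` exactly when `t` is smaller than
its lifetime: the lifetime is attained because `Δ` is isolated. -/
lemma lt_lifetime_iff {x : ℝ≥0 → KilledReal} (hc : ∀ t, ContinuousWithinAt x (Set.Ici t) t)
    (hx : ∀ s t, s ≤ t → x s = cemetery → x t = cemetery) (t : ℝ≥0) :
    (t : ℝ≥0∞) < lifetime x ↔ x t ≠ cemetery := by
  constructor
  · intro h ht
    exact absurd h (not_lt.2 (iInf₂_le (f := fun (t : ℝ≥0) (_ : x t = cemetery) => (t : ℝ≥0∞)) t ht))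
  · intro ht
    have h1 : ∀ᶠ s in 𝓝[≥] t, x s ≠ cemetery := (hc t).eventually (isOpen_ne_cemetery.mem_nhds ht)
    have h2 : ∀ᶠ s in 𝓝[>] t, x s ≠ cemetery := h1.filter_mono (nhdsWithin_mono _ Set.Ioi_subset_Ici_self)
    obtain ⟨s, hs, hst⟩ := (h2.and self_mem_nhdsWithin).exists
    refine lt_of_lt_of_le (ENNReal.coe_lt_coe.2 hst) (le_iInf₂ fun r hr => ?_)
    by_contra hcon
    exact hs (hx r s (by exact_mod_cast (not_le.1 hcon).le) hr)

lemma lt_lifetime_coord_iff (t : ℝ≥0) (w : PathSpace) :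
    (t : ℝ≥0∞) < lifetime w.1 ↔ coord t w ≠ cemetery :=
  lt_lifetime_iff w.2.right_continuous w.2.absorbed t

namespace IsDecreasingPath

variable {α a : ℝ} {y : ℝ≥0 → ℝ}

lemma measurable_clockOf (hy : IsDecreasingPath a y) : Measurable fun u => (clockOf α y u).toNNReal :=
  hy.clockOf_mono.measurable.ennreal_toNNReal

lemma lt_lifetime_lampertiOf_iff (hα : 0 < α) (ha : 0 < a) (hy : IsDecreasingPath a y) (t : ℝ≥0) :
    (t : ℝ≥0∞) < lifetime (lampertiOf α a y) ↔ lampertiOf α a y t ≠ cemetery :=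
  lt_lifetime_iff (hy.lampertiOf_right_continuous hα ha) (fun s t hst hs => by
    by_contra h
    exact hy.lampertiOf_ne_of_le hα hst h hs) t

lemma measurable_lampertiOf (hα : 0 < α) (ha : 0 < a) (hy : IsDecreasingPath a y) :
    Measurable (lampertiOf α a y) :=
  measurable_of_right_continuous (hy.lampertiOf_right_continuous hα ha)

/-- The substitution `s = clock (u)` up to an instant at which the path is positive. -/
lemma setLIntegral_clockOf (hα : 0 < α) (hy : IsDecreasingPath a y) {f : ℝ≥0 → ℝ≥0∞}
    (hf : Measurable f) {r s : ℝ≥0} (hr : 0 < y r) (hs : clockOf α y r = s) :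
    ∫⁻ v in Set.Iic s, f v ∂halfLebesgue =
      ∫⁻ u in Set.Iic r, f (clockOf α y u).toNNReal * ENNReal.ofReal (y u) ^ (-α) ∂halfLebesgue := by
  set A : ℝ≥0 → ℝ≥0 := fun u => (clockOf α y u).toNNReal with hA
  have hAm : Measurable A := hy.measurable_clockOf
  have hAeq : ∀ u ≤ r, (A u : ℝ≥0∞) = clockOf α y u := fun u hu =>
    ENNReal.coe_toNNReal (hy.clockOf_ne_top hα (hr.trans_le (hy.antitone hu)))
  have key : ((halfLebesgue.restrict (Set.Iic r)).withDensity
      fun u => ENNReal.ofReal (y u) ^ (-α)).map A = halfLebesgue.restrict (Set.Iic s) := by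
    have hfin : IsFiniteMeasure (((halfLebesgue.restrict (Set.Iic r)).withDensity
        fun u => ENNReal.ofReal (y u) ^ (-α)).map A) := by
      constructor
      rw [Measure.map_apply hAm MeasurableSet.univ, Set.preimage_univ,
        withDensity_apply _ MeasurableSet.univ, Measure.restrict_univ, ← hy.clockOf_eq, hs]
      exact ENNReal.coe_lt_top
    refine Measure.ext_of_Iic _ _ fun c => ?_
    rw [Measure.map_apply hAm measurableSet_Iic, withDensity_apply _ (hAm measurableSet_Iic),
      Measure.restrict_restrict (hAm measurableSet_Iic), Measure.restrict_apply measurableSet_Iic,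
      Set.Iic_inter_Iic, halfLebesgue_Iic]
    obtain ⟨v, hvr, hv, hvc⟩ := hy.exists_of_le_clockOf (s := min c s) hα hr
      (by rw [hs]; exact_mod_cast min_le_right _ _)
    rw [← hvc, hy.clockOf_eq v]
    congr 2
    ext u
    simp only [Set.mem_inter_iff, Set.mem_preimage, Set.mem_Iic]
    constructor
    · rintro ⟨h1, h2⟩
      by_contra h3
      have h4 := (hy.clockOf_lt_iff hα hv).2 (not_le.1 h3)
      have h5 := hy.clockOf_mono (α := α) h2
      rw [hvc, ← hAeq u h2] at h4
      rw [hs, ← hAeq u h2] at h5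
      have h4' : min c s < A u := by exact_mod_cast h4
      have h5' : A u ≤ s := by exact_mod_cast h5
      exact absurd (le_min h1 h5') (not_le.2 h4')
    · intro h
      refine ⟨?_, h.trans hvr⟩
      have h1 := hy.clockOf_mono (α := α) h
      rw [hvc, ← hAeq u (h.trans hvr)] at h1
      exact (ENNReal.coe_le_coe.1 h1).trans (min_le_left _ _)
  rw [← key, lintegral_map hf hAm, lintegral_withDensity_eq_lintegral_mul _ hy.measurable_weight
    (show Measurable fun u => f (A u) from hf.comp hAm)]
  simp only [Pi.mul_apply, mul_comm, hA]

lemma measurableSet_pos (hy : IsDecreasingPath a y) : MeasurableSet {u | 0 < y u} :=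
  measurableSet_lt measurable_const hy.antitone.measurable

/-- The substitution `s = clock (u)` over the whole lifetime. -/
lemma lintegral_clockOf (hα : 0 < α) (hy : IsDecreasingPath a y) {f : ℝ≥0 → ℝ≥0∞}
    (hf : Measurable f) :
    ∫⁻ s in {s | lampertiOf α a y s ≠ cemetery}, f s ∂halfLebesgue =
      ∫⁻ u in {u | 0 < y u}, f (clockOf α y u).toNNReal * ENNReal.ofReal (y u) ^ (-α)
        ∂halfLebesgue := by
  have hA : ∀ i : {q : ℚ // 0 < y (Real.toNNReal q)},
      clockOf α y (Real.toNNReal i.1) = ((clockOf α y (Real.toNNReal i.1)).toNNReal : ℝ≥0∞) := fun i =>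
    (ENNReal.coe_toNNReal (hy.clockOf_ne_top hα i.2)).symm
  have h1 : {u | 0 < y u} = ⋃ i : {q : ℚ // 0 < y (Real.toNNReal q)}, Set.Iic (Real.toNNReal i.1) := by
    ext u
    simp only [Set.mem_ofPred_eq, Set.mem_iUnion, Set.mem_Iic]
    constructor
    · intro hu
      obtain ⟨v, huv, hv⟩ := hy.exists_pos_gt hu
      obtain ⟨q, -, hq1, hq2⟩ := (NNReal.lt_iff_exists_rat_btwn _ _).1 huv
      exact ⟨⟨q, hv.trans_le (hy.antitone hq2.le)⟩, hq1.le⟩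
    · rintro ⟨i, hi⟩
      exact i.2.trans_le (hy.antitone hi)
  have h2 : {s | lampertiOf α a y s ≠ cemetery} =
      ⋃ i : {q : ℚ // 0 < y (Real.toNNReal q)}, Set.Iic (clockOf α y (Real.toNNReal i.1)).toNNReal := by
    ext s
    simp only [Set.mem_ofPred_eq, Set.mem_iUnion, Set.mem_Iic]
    constructor
    · intro hs
      obtain ⟨r, hr, hrs⟩ := hy.exists_of_lampertiOf_ne hα hs
      have : r ∈ {u | 0 < y u} := hr
      rw [h1, Set.mem_iUnion] at this
      obtain ⟨i, hi⟩ := this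
      refine ⟨i, ?_⟩
      rw [← ENNReal.coe_le_coe, ← hA i, ← hrs]
      exact hy.clockOf_mono hi
    · rintro ⟨i, hi⟩
      rw [← ENNReal.coe_le_coe, ← hA i] at hi
      obtain ⟨v, -, hv, hvs⟩ := hy.exists_of_le_clockOf hα i.2 hi
      rw [hy.lampertiOf_clockOf hα hv hvs]
      exact inl_ne_cemetery _
  rw [h1, h2, setLIntegral_iUnion_of_directed, setLIntegral_iUnion_of_directed]
  · exact iSup_congr fun i => hy.setLIntegral_clockOf hα hf i.2 (hA i)
  · refine Monotone.directed_le fun i j hij => Set.Iic_subset_Iic.2 ?_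
    exact Real.toNNReal_mono (by exact_mod_cast hij)
  · refine Monotone.directed_le fun i j hij => Set.Iic_subset_Iic.2 ?_
    rw [← ENNReal.coe_le_coe, ← hA i, ← hA j]
    exact hy.clockOf_mono (Real.toNNReal_mono (by exact_mod_cast hij))

lemma stopped (hy : IsDecreasingPath a y) (t : ℝ≥0) : IsDecreasingPath a fun u => y (min u t) where
  antitone _ _ h := hy.antitone (min_le_min_right t h)
  nonneg _ := hy.nonneg _
  right_continuous s := by
    refine (hy.right_continuous (min s t)).comp (t := Set.Ici (min s t))
      (continuous_id.min continuous_const).continuousWithinAt fun u hu => ?_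
    exact min_le_min_right t hu
  zero := by simp [hy.zero]

lemma clockOf_stopped (hy : IsDecreasingPath a y) {r t : ℝ≥0} (h : r ≤ t) :
    clockOf α (fun u => y (min u t)) r = clockOf α y r := by
  rw [(hy.stopped t).clockOf_eq, hy.clockOf_eq]
  refine setLIntegral_congr_fun measurableSet_Iic fun u hu => ?_
  simp only [min_eq_left (le_trans (Set.mem_Iic.1 hu) h)]

/-- Stopping a path does not change its transform up to the clock at the stopping time. -/
lemma lampertiOf_stopped (hα : 0 < α) (hy : IsDecreasingPath a y) {s t : ℝ≥0} (ht : 0 < y t)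
    (hs : (s : ℝ≥0∞) ≤ clockOf α y t) :
    lampertiOf α a (fun u => y (min u t)) s = lampertiOf α a y s := by
  obtain ⟨v, hvt, hv, hvs⟩ := hy.exists_of_le_clockOf hα ht hs
  rw [hy.lampertiOf_clockOf hα hv hvs]
  have h := (hy.stopped t).lampertiOf_clockOf (α := α) (r := v) hα (by simpa [min_eq_left hvt] using hv)
    (by rw [hy.clockOf_stopped hvt, hvs])
  simpa [min_eq_left hvt] using h

/-- The path after time `t`, rescaled so as to start again from `a`. -/
lemma rescaled (ha : 0 < a) (hy : IsDecreasingPath a y) {t k : ℝ≥0} (hk : (k : ℝ) = a / y t)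
    (ht : 0 < y t) : IsDecreasingPath a fun u => k * y (t + k ^ (-α) * u) where
  antitone _ _ h := mul_le_mul_of_nonneg_left (hy.antitone (by gcongr)) k.2
  nonneg _ := mul_nonneg k.2 (hy.nonneg _)
  right_continuous s := by
    refine ContinuousWithinAt.mul continuousWithinAt_const ?_
    refine (hy.right_continuous (t + k ^ (-α) * s)).comp (t := Set.Ici (t + k ^ (-α) * s))
      (by fun_prop) fun u hu => ?_
    simp only [Set.mem_Ici] at hu ⊢
    gcongr
  zero := by simp [hk]; field_simp

lemma clockOf_rescaled (ha : 0 < a) (hy : IsDecreasingPath a y) {t k : ℝ≥0}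
    (hk : (k : ℝ) = a / y t) (ht : 0 < y t) (u : ℝ≥0) :
    clockOf α y (t + k ^ (-α) * u) =
      clockOf α y t + clockOf α (fun u => k * y (t + k ^ (-α) * u)) u := by
  have hk0 : k ≠ 0 := by
    rintro rfl
    have : 0 < a / y t := by positivity
    rw [← hk] at this
    simp at this
  have hc0 : k ^ (-α) ≠ 0 := by simp [NNReal.rpow_eq_zero_iff, hk0]
  rw [hy.clockOf_add (le_self_add (a := t)), (hy.rescaled ha hk ht).clockOf_eq]
  congr 1
  have h1 : ∫⁻ v in Set.Ioc t (t + k ^ (-α) * u), ENNReal.ofReal (y v) ^ (-α) ∂halfLebesgue =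
      ∫⁻ v in Set.Ici t, (Set.Iic (t + k ^ (-α) * u)).indicator
        (fun v => ENNReal.ofReal (y v) ^ (-α)) v ∂halfLebesgue := by
    rw [setLIntegral_indicator measurableSet_Iic, Set.inter_comm, Set.Ici_inter_Iic]
    exact setLIntegral_congr Ioc_ae_eq_Icc
  rw [h1, setLIntegral_halfLebesgue_Ici (hy.measurable_weight.indicator measurableSet_Iic) t _ hc0,
    ← lintegral_indicator measurableSet_Iic, ← lintegral_const_mul]
  · refine lintegral_congr fun v => ?_
    by_cases hv : v ≤ u
    · rw [Set.indicator_of_mem (by simp only [Set.mem_Iic]; gcongr), Set.indicator_of_mem (Set.mem_Iic.2 hv),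
        ENNReal.ofReal_mul k.coe_nonneg, ENNReal.mul_rpow_of_ne_top ENNReal.ofReal_ne_top ENNReal.ofReal_ne_top,
        ENNReal.ofReal_coe_nnreal, ENNReal.coe_rpow_of_ne_zero hk0]
    · rw [Set.indicator_of_notMem (s := Set.Iic u) hv, Set.indicator_of_notMem, mul_zero]
      simp only [Set.mem_Iic, not_le] at hv ⊢
      have : k ^ (-α) * u < k ^ (-α) * v := by
        exact mul_lt_mul_of_pos_left hv (pos_iff_ne_zero.2 hc0)
      gcongr
  · exact (hy.measurable_weight.indicator measurableSet_Iic).comp (by fun_prop)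

/-- Self-similarity: after the clock time of `t`, the transform moves on like the transform of the
rescaled path. -/
lemma lampertiOf_rescaled (hα : 0 < α) (ha : 0 < a) (hy : IsDecreasingPath a y) {t k A : ℝ≥0}
    (hk : (k : ℝ) = a / y t) (ht : 0 < y t) (hA : clockOf α y t = A) (s : ℝ≥0) :
    lampertiOf α a y (A + s) = Sum.map (Real.log (y t / a) + ·) id
      (lampertiOf α a (fun u => k * y (t + k ^ (-α) * u)) s) := by
  have hk0 : (0 : ℝ) < k := by rw [hk]; positivity
  have hr := hy.rescaled (α := α) ha hk ht
  have hpos : ∀ u, 0 < k * y (t + k ^ (-α) * u) ↔ 0 < y (t + k ^ (-α) * u) := fun u =>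
    mul_pos_iff_of_pos_left hk0
  by_cases hs : lampertiOf α a (fun u => k * y (t + k ^ (-α) * u)) s = cemetery
  · rw [hs]
    by_contra hcon
    obtain ⟨r, hr0, hrs⟩ := hy.exists_of_lampertiOf_ne hα (s := A + s) hcon
    have htr : t ≤ r := by
      by_contra h
      have := (hy.clockOf_lt_iff hα hr0).2 (not_le.1 h)
      rw [hA, hrs] at this
      have h2 : A + s < A := by exact_mod_cast this
      exact absurd h2 (not_lt.2 le_self_add)
    have hc0 : k ^ (-α) ≠ 0 := by
      have : k ≠ 0 := by intro h; simp [h] at hk0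
      simp [NNReal.rpow_eq_zero_iff, this]
    have hu : r = t + k ^ (-α) * ((r - t) / k ^ (-α)) := by
      rw [mul_div_cancel₀ _ hc0, add_tsub_cancel_of_le htr]
    have h3 := hy.clockOf_rescaled (α := α) ha hk ht ((r - t) / k ^ (-α))
    rw [← hu, hrs, hA, ENNReal.coe_add] at h3
    have h4 := (ENNReal.add_right_inj ENNReal.coe_ne_top).1 h3
    have h5 := hr.lampertiOf_clockOf hα ((hpos _).2 (by rw [← hu]; exact hr0)) h4.symm
    rw [h5] at hs
    exact inl_ne_cemetery _ hs
  · obtain ⟨u, hu, hus⟩ := hr.exists_of_lampertiOf_ne hα hs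
    rw [hr.lampertiOf_clockOf hα hu hus]
    have hu' := (hpos u).1 hu
    rw [hy.lampertiOf_clockOf hα hu' (s := A + s)]
    · simp only [Sum.map_inl]
      rw [← Real.log_mul (by positivity) (by positivity), hk]
      congr 2
      field_simp
    · rw [hy.clockOf_rescaled ha hk ht u, hus, hA, ENNReal.coe_add]

/-- The functional `a^α ∫ exp (α ξ_u) du` inverts the clock, because `exp (α ξ) = (y / a)^α` cancels the
density `y^(-α)` of the clock. -/
lemma lintegral_exp_lampertiOf (hα : 0 < α) (ha : 0 < a) (hy : IsDecreasingPath a y) {r s : ℝ≥0}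
    (hr : 0 < y r) (hs : clockOf α y r = s) :
    ∫⁻ u in Set.Iic s, ENNReal.ofReal (killedExp α (lampertiOf α a y u)) ∂halfLebesgue =
      ENNReal.ofReal (a ^ (-α) * r) := by
  rw [hy.setLIntegral_clockOf hα (f := fun u => ENNReal.ofReal (killedExp α (lampertiOf α a y u)))
    ((measurable_killedExp α).comp (hy.measurable_lampertiOf hα ha)).ennreal_ofReal hr hs]
  have : ∀ u ∈ Set.Iic r, ENNReal.ofReal (killedExp α (lampertiOf α a y (clockOf α y u).toNNReal)) *
      ENNReal.ofReal (y u) ^ (-α) = ENNReal.ofReal (a ^ (-α)) := fun u hu => by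
    have hu0 : 0 < y u := hr.trans_le (hy.antitone hu)
    rw [hy.lampertiOf_clockOf hα hu0 (ENNReal.coe_toNNReal (hy.clockOf_ne_top hα hu0)).symm,
      killedExp_inl, ENNReal.ofReal_rpow_of_pos hu0, ← ENNReal.ofReal_mul (Real.exp_pos _).le]
    congr 1
    rw [mul_comm α, ← Real.rpow_def_of_pos (by positivity), Real.div_rpow hu0.le ha.le, Real.rpow_neg hu0.le,
      Real.rpow_neg ha.le]
    have := (Real.rpow_pos_of_pos hu0 α).ne'
    field_simp
  rw [setLIntegral_congr_fun measurableSet_Iic this, setLIntegral_const, halfLebesgue_Iic,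
    ENNReal.ofReal_mul (by positivity), ENNReal.ofReal_coe_nnreal]

/-- The time change `φ` of the transform is the clock of the path. Only the part of the transform up
to the clock time of some later instant `v` matters. -/
lemma lampertiPhi_eq (hα : 0 < α) (ha : 0 < a) (hy : IsDecreasingPath a y) {x : ℝ≥0 → KilledReal}
    {t v : ℝ≥0} (htv : t < v) (hv : 0 < y v)
    (hx : ∀ s : ℝ≥0, (s : ℝ≥0∞) ≤ clockOf α y v → x s = lampertiOf α a y s) :
    lampertiPhi α x (ENNReal.ofReal (a ^ (-α) * t)) = clockOf α y t := by
  have ht : 0 < y t := hv.trans_le (hy.antitone htv.le)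
  have hm : Measurable fun u => ENNReal.ofReal (killedExp α (lampertiOf α a y u)) := (((measurable_killedExp α).comp (hy.measurable_lampertiOf hα ha)).ennreal_ofReal)
  have hB : ∀ r ≤ v, ∀ s : ℝ≥0, clockOf α y r = s →
      ∫⁻ u in Set.Icc (0 : ℝ) s, ENNReal.ofReal (killedExp α (x u.toNNReal)) =
        ENNReal.ofReal (a ^ (-α) * r) := fun r hrv s hrs => by
    rw [← hy.lintegral_exp_lampertiOf hα ha (hv.trans_le (hy.antitone hrv)) hrs]
    rw [setLIntegral_halfLebesgue_Iic hm]
    refine setLIntegral_congr_fun measurableSet_Icc fun u hu => ?_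
    rw [hx]
    · refine le_trans ?_ (hy.clockOf_mono hrv)
      rw [hrs]
      exact_mod_cast Real.toNNReal_le_iff_le_coe.2 hu.2
  have hAt := (ENNReal.coe_toNNReal (hy.clockOf_ne_top hα ht)).symm
  set A := (clockOf α y t).toNNReal
  have hfin := hy.clockOf_ne_top hα hv
  have hAlt : (A : ℝ≥0∞) < clockOf α y v := by rw [← hAt]; exact hy.clockOf_lt hα htv (by simp [hAt])
  have hmono : ∀ c d : ℝ≥0, c ≤ d →
      ∫⁻ u in Set.Icc (0 : ℝ) c, ENNReal.ofReal (killedExp α (x u.toNNReal)) ≤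
      ∫⁻ u in Set.Icc (0 : ℝ) d, ENNReal.ofReal (killedExp α (x u.toNNReal)) := fun c d h =>
    lintegral_mono_set (Set.Icc_subset_Icc_right (by exact_mod_cast h))
  rw [hAt]
  apply le_antisymm
  · refine le_of_forall_gt fun b hb => ?_
    obtain ⟨c, hc1, hc2⟩ := ENNReal.lt_iff_exists_nnreal_btwn.1 hb
    refine lt_of_le_of_lt (iInf₂_le c ⟨?_, ?_⟩) hc2
    · exact lt_of_le_of_lt zero_le (ENNReal.coe_lt_coe.1 hc1)
    · obtain ⟨q, hqv, hq, hqs⟩ := hy.exists_of_le_clockOf (s := min c (clockOf α y v).toNNReal) hα hv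
        (by rw [ENNReal.coe_min, ENNReal.coe_toNNReal hfin]; exact min_le_right _ _)
      have htq : t < q := by
        rw [← hy.clockOf_lt_iff hα ht, hqs, ENNReal.coe_min, ENNReal.coe_toNNReal hfin, hAt]
        exact lt_min hc1 hAlt
      refine lt_of_lt_of_le ?_ (hmono _ _ (min_le_left c (clockOf α y v).toNNReal))
      rw [hB q hqv _ hqs]
      have : (t : ℝ) < q := by exact_mod_cast htq
      have h0 : (0 : ℝ) < q := lt_of_le_of_lt t.2 this
      exact (ENNReal.ofReal_lt_ofReal_iff (by positivity)).2 (by gcongr)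
  · refine le_iInf₂ fun c hc => ?_
    by_contra hcon
    have h1 := hmono c A (by exact_mod_cast (not_le.1 hcon).le)
    rw [hB t htv.le A hAt] at h1
    exact absurd hc.2 (not_lt.2 h1)

end IsDecreasingPath

/-- The Lamperti representation holds along every path with a decreasing trajectory. -/
lemma lampertiRepresentation_of_isDecreasingPath {α a : ℝ} (hα : 0 < α) (ha : 0 < a) {w : PathSpace}
    (hw : IsDecreasingPath a fun t => pssMp a t w) : LampertiRepresentation α a w := by
  intro t ht r hr
  have hpos : 0 < pssMp a t w := by
    rcases eq_or_ne t 0 with rfl | h0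
    · exact hw.pos_of_start ha
    · refine lt_of_le_of_ne (hw.nonneg t) fun h => absurd ht (not_lt.2 ?_)
      exact iInf₂_le (f := fun (s : ℝ≥0) (_ : 0 < s ∧ pssMp a s w = 0) => (s : ℝ≥0∞)) t
        ⟨pos_iff_ne_zero.2 h0, h.symm⟩
  obtain ⟨v, htv, hv⟩ := hw.exists_pos_gt hpos
  have h1 := hw.lampertiPhi_eq (x := fun s => lamperti α a s w) hα ha htv hv
    fun s _ => lamperti_eq_lampertiOf α a s w
  rw [h1] at hr
  have hne := hw.clockOf_ne_top hα hpos
  refine ⟨by rw [hr]; exact hne, ?_⟩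
  rw [lamperti_eq_lampertiOf, hw.lampertiOf_clockOf hα hpos (by rw [hr]; exact (ENNReal.coe_toNNReal hne).symm),
    killedExp_inl, one_mul, Real.exp_log (by positivity)]
  field_simp

/-! ### Measurability of the Lamperti transform -/

/-- The map `x ↦ (a - x)⁺` on `ℝ ∪ {Δ}`, sending `Δ` to `0`. -/
noncomputable def distBelow (a : ℝ) : KilledReal → ℝ := Sum.elim (fun x => max (a - x) 0) fun _ => 0

lemma continuous_distBelow (a : ℝ) : Continuous (distBelow a) :=
  Continuous.sumElim (by fun_prop) continuous_const

lemma pssMp_eq (a : ℝ) (t : ℝ≥0) (w : PathSpace) : pssMp a t w = distBelow a (coord t w) := by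
  unfold pssMp distBelow
  rcases coord t w with x | x
  · simp only [Sum.elim_inl]
    split_ifs with h
    · rw [max_eq_left (by linarith)]
    · rw [max_eq_right (by linarith)]
  · rfl

lemma measurable_pssMp_uncurry (a : ℝ) : Measurable fun p : ℝ≥0 × PathSpace => pssMp a p.1 p.2 := by
  simp only [pssMp_eq]
  exact (continuous_distBelow a).measurable.comp measurable_coord_uncurry

lemma measurable_pssMp (a : ℝ) (t : ℝ≥0) : Measurable (pssMp a t) :=
  (measurable_pssMp_uncurry a).comp measurable_prodMk_left

lemma lampertiClock_mono (α a : ℝ) (w : PathSpace) : Monotone fun r => lampertiClock α a r w :=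
  fun _ _ h => lintegral_mono_set (Set.Icc_subset_Icc_right (by exact_mod_cast h))

lemma measurable_lampertiClock (α a : ℝ) (r : ℝ≥0) : Measurable (lampertiClock α a r) := by
  refine Measurable.lintegral_prod_right (f := fun (w : PathSpace) (u : ℝ) =>
    ENNReal.ofReal (pssMp a u.toNNReal w) ^ (-α)) ?_
  have h : Measurable fun p : PathSpace × ℝ => (p.2.toNNReal, p.1) :=
    (measurable_real_toNNReal.comp measurable_snd).prodMk measurable_fst
  exact ((measurable_pssMp_uncurry a).comp h).ennreal_ofReal.pow_const _

/-- The infimum of an upward closed set of times can be taken over rational times, which makes it measurable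
in a parameter. -/
lemma iInf_rat_of_upward {S : Set ℝ≥0} (hS : ∀ r s, r ≤ s → r ∈ S → s ∈ S) :
    ⨅ (r : ℝ≥0) (_ : r ∈ S), (r : ℝ≥0∞) =
      ⨅ (q : ℚ) (_ : Real.toNNReal q ∈ S), (Real.toNNReal q : ℝ≥0∞) := by
  apply le_antisymm
  · exact le_iInf₂ fun q hq =>
      iInf₂_le (f := fun (r : ℝ≥0) (_ : r ∈ S) => (r : ℝ≥0∞)) (Real.toNNReal q) hq
  · refine le_iInf₂ fun r hr => le_of_forall_gt fun b hb => ?_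
    obtain ⟨c, hc1, hc2⟩ := ENNReal.lt_iff_exists_nnreal_btwn.1 hb
    obtain ⟨q, -, hq1, hq2⟩ := (NNReal.lt_iff_exists_rat_btwn _ _).1 (ENNReal.coe_lt_coe.1 hc1)
    refine lt_of_le_of_lt (iInf₂_le (f := fun (q : ℚ) (_ : Real.toNNReal q ∈ S) =>
      (Real.toNNReal q : ℝ≥0∞)) q (hS r _ hq1.le hr)) (lt_trans ?_ hc2)
    exact_mod_cast hq2

lemma measurable_lampertiTime (α a : ℝ) :
    Measurable fun p : ℝ≥0 × PathSpace => lampertiTime α a p.1 p.2 := by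
  have h : ∀ p : ℝ≥0 × PathSpace, lampertiTime α a p.1 p.2 =
      ⨅ (q : ℚ), if (p.1 : ℝ≥0∞) < lampertiClock α a (Real.toNNReal q) p.2 then
        (Real.toNNReal q : ℝ≥0∞) else ⊤ := fun p => by
    refine (iInf_rat_of_upward (S := {r | (p.1 : ℝ≥0∞) < lampertiClock α a r p.2})
      fun r s hrs hr => lt_of_lt_of_le hr (lampertiClock_mono α a p.2 hrs)).trans ?_
    refine iInf_congr fun q => ?_
    rw [iInf_eq_if]
    rfl
  simp only [h]
  refine Measurable.iInf fun q => Measurable.ite ?_ measurable_const measurable_const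
  exact measurableSet_lt (measurable_coe_nnreal_ennreal.comp measurable_fst)
    ((measurable_lampertiClock α a _).comp measurable_snd)

lemma measurable_section {S Ω E : Type*} [MeasurableSpace S] [MeasurableSpace Ω] [MeasurableSpace E]
    {Z : S → Ω → E} (hZ : Measurable fun p : S × Ω => Z p.1 p.2) (s : S) : Measurable (Z s) :=
  hZ.comp (measurable_prodMk_left (x := s))

lemma measurable_lamperti_uncurry (α a : ℝ) :
    Measurable fun p : ℝ≥0 × PathSpace => lamperti α a p.1 p.2 := by
  have h1 := measurable_lampertiTime α a
  have h2 : Measurable fun p : ℝ≥0 × PathSpace =>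
      pssMp a (lampertiTime α a p.1 p.2).toNNReal p.2 :=
    (measurable_pssMp_uncurry a).comp (h1.ennreal_toNNReal.prodMk measurable_snd)
  unfold lamperti
  refine Measurable.ite ?_ (measurable_inl.comp (h2.div_const a).log) measurable_const
  exact (h1 (measurableSet_singleton ⊤).compl).inter (measurableSet_lt measurable_const h2)

lemma measurable_lamperti (α a : ℝ) (s : ℝ≥0) : Measurable (lamperti α a s) :=
  measurable_section (measurable_lamperti_uncurry α a) s

/-- The whole transform of a path. -/
noncomputable def lampertiPath (α a : ℝ) (w : PathSpace) : ℝ≥0 → KilledReal := fun s => lamperti α a s w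

lemma lampertiPath_eq (α a : ℝ) (w : PathSpace) :
    lampertiPath α a w = lampertiOf α a fun t => pssMp a t w :=
  funext fun s => lamperti_eq_lampertiOf α a s w

lemma measurable_lampertiPath (α a : ℝ) : Measurable (lampertiPath α a) :=
  measurable_pi_lambda _ fun s => measurable_lamperti α a s

/-! ### Operations on paths -/

/-- Killed paths issued from `0` which are non-decreasing during their lifetime. -/
structure IsIncreasingPath (w : PathSpace) : Prop where
  zero : coord 0 w = Sum.inl 0
  monotone : ∀ s t, s ≤ t → coord t w ≠ cemetery → realCoord s w ≤ realCoord t w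

lemma coord_ne_of_le {w : PathSpace} {s t : ℝ≥0} (h : s ≤ t) (ht : coord t w ≠ cemetery) :
    coord s w ≠ cemetery := fun hs => ht (w.2.absorbed s t h hs)

lemma pssMp_right_continuous (a : ℝ) (w : PathSpace) (t : ℝ≥0) :
    ContinuousWithinAt (fun s => pssMp a s w) (Set.Ici t) t := by
  simp only [pssMp_eq]
  exact (continuous_distBelow a).continuousAt.comp_continuousWithinAt (w.2.right_continuous t)

lemma pssMp_of_ne {a : ℝ} {t : ℝ≥0} {w : PathSpace} (h : coord t w ≠ cemetery) :
    pssMp a t w = max (a - realCoord t w) 0 := by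
  rw [pssMp_eq, realCoord_eq]
  conv_lhs => rw [eq_inl_valK h]
  rfl

lemma pssMp_of_eq {a : ℝ} {t : ℝ≥0} {w : PathSpace} (h : coord t w = cemetery) : pssMp a t w = 0 := by
  rw [pssMp_eq, h]; rfl

lemma pssMp_nonneg (a : ℝ) (t : ℝ≥0) (w : PathSpace) : 0 ≤ pssMp a t w := by
  by_cases h : coord t w = cemetery
  · rw [pssMp_of_eq h]
  · rw [pssMp_of_ne h]; exact le_max_right _ _

lemma pssMp_pos_iff {a : ℝ} {t : ℝ≥0} {w : PathSpace} :
    0 < pssMp a t w ↔ coord t w ≠ cemetery ∧ realCoord t w < a := by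
  by_cases h : coord t w = cemetery
  · simp [pssMp_of_eq h, h]
  · simp [pssMp_of_ne h, h]

lemma pssMp_of_pos {a : ℝ} {t : ℝ≥0} {w : PathSpace} (h : 0 < pssMp a t w) :
    pssMp a t w = a - realCoord t w := by
  have h1 := pssMp_pos_iff.1 h
  rw [pssMp_of_ne h1.1, max_eq_left (by linarith [h1.2])]

lemma IsIncreasingPath.isDecreasingPath {a : ℝ} (ha : 0 < a) {w : PathSpace}
    (hw : IsIncreasingPath w) : IsDecreasingPath a fun t => pssMp a t w where
  antitone s t h := by
    by_cases ht : coord t w = cemetery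
    · simp only [pssMp_of_eq ht]; exact pssMp_nonneg a s w
    · simp only [pssMp_of_ne ht, pssMp_of_ne (coord_ne_of_le h ht)]
      have := hw.monotone s t h ht
      gcongr
  nonneg t := pssMp_nonneg a t w
  right_continuous := pssMp_right_continuous a w
  zero := by
    rw [pssMp_eq, hw.zero]
    simp [distBelow, ha.le]

/-- The path stopped at time `t`. -/
noncomputable def stopPath (t : ℝ≥0) (w : PathSpace) : PathSpace :=
  ⟨fun u => w.1 (min u t), by
    refine ⟨fun s => ?_, fun s => ?_, fun r s h => w.2.absorbed _ _ (min_le_min_right t h)⟩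
    · refine (w.2.right_continuous (min s t)).comp (t := Set.Ici (min s t))
        (continuous_id.min continuous_const).continuousWithinAt fun u hu => ?_
      exact min_le_min_right t hu
    · rcases le_or_gt s t with h | h
      · obtain ⟨l, hl⟩ := w.2.left_limit s
        refine ⟨l, hl.congr' ?_⟩
        filter_upwards [self_mem_nhdsWithin] with u hu
        rw [min_eq_left ((Set.mem_Iio.1 hu).le.trans h)]
      · refine ⟨w.1 t, tendsto_const_nhds.congr' ?_⟩
        filter_upwards [Ioo_mem_nhdsLT h] with u hu
        rw [min_eq_right hu.1.le]⟩

/-- The increments of the path after time `t`. -/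
noncomputable def shiftPath (t : ℝ≥0) (w : PathSpace) : PathSpace :=
  ⟨fun u => Sum.map (· - realCoord t w) id (w.1 (t + u)), by
    have hc : Continuous (Sum.map (· - realCoord t w) id : KilledReal → KilledReal) :=
      Continuous.sumMap (by fun_prop) continuous_id
    refine ⟨fun s => ?_, fun s => ?_, fun r s h hr => ?_⟩
    · refine hc.continuousAt.comp_continuousWithinAt ?_
      refine (w.2.right_continuous (t + s)).comp (t := Set.Ici (t + s))
        (by fun_prop) fun u hu => ?_
      simp only [Set.mem_Ici] at hu ⊢
      gcongr
    · obtain ⟨l, hl⟩ := w.2.left_limit (t + s)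
      refine ⟨_, (hc.tendsto l).comp (hl.comp ?_)⟩
      refine tendsto_nhdsWithin_iff.2 ⟨?_, ?_⟩
      · exact ((continuous_const_add t).tendsto s).mono_left nhdsWithin_le_nhds
      · filter_upwards [self_mem_nhdsWithin] with u hu
        simp only [Set.mem_Iio] at hu ⊢
        gcongr
    · have h1 : w.1 (t + r) = cemetery := by
        rcases h2 : w.1 (t + r) with x | ⟨⟩
        · rw [h2] at hr; exact absurd hr (inl_ne_cemetery _)
        · rfl
      rw [w.2.absorbed _ (t + s) (by gcongr) h1]
      rfl⟩

/-- The rescaled path `u ↦ k X_{k^(-α) u}`. -/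
noncomputable def scalePath (α : ℝ) (k : ℝ≥0) (w : PathSpace) : PathSpace :=
  ⟨fun u => Sum.map (fun x => (k : ℝ) * x) id (w.1 (k ^ (-α) * u)), by
    have hc : Continuous (Sum.map (fun x => (k : ℝ) * x) id : KilledReal → KilledReal) :=
      Continuous.sumMap (by fun_prop) continuous_id
    refine ⟨fun s => ?_, fun s => ?_, fun r s h hr => ?_⟩
    · refine hc.continuousAt.comp_continuousWithinAt ?_
      refine (w.2.right_continuous (k ^ (-α) * s)).comp (t := Set.Ici (k ^ (-α) * s))
        (by fun_prop) fun u hu => ?_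
      simp only [Set.mem_Ici] at hu ⊢
      gcongr
    · rcases eq_or_ne (k ^ (-α)) 0 with h0 | h0
      · simp only [h0, zero_mul]
        exact ⟨_, tendsto_const_nhds⟩
      · obtain ⟨l, hl⟩ := w.2.left_limit (k ^ (-α) * s)
        refine ⟨_, (hc.tendsto l).comp (hl.comp ?_)⟩
        refine tendsto_nhdsWithin_iff.2 ⟨?_, ?_⟩
        · exact ((continuous_const_mul (k ^ (-α))).tendsto s).mono_left nhdsWithin_le_nhds
        · filter_upwards [self_mem_nhdsWithin] with u hu
          simp only [Set.mem_Iio] at hu ⊢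
          exact mul_lt_mul_of_pos_left hu (pos_iff_ne_zero.2 h0)
    · have h1 : w.1 (k ^ (-α) * r) = cemetery := by
        rcases h2 : w.1 (k ^ (-α) * r) with x | ⟨⟩
        · rw [h2] at hr; exact absurd hr (inl_ne_cemetery _)
        · rfl
      rw [w.2.absorbed _ (k ^ (-α) * s) (by gcongr) h1]
      rfl⟩

lemma coord_stopPath (t u : ℝ≥0) (w : PathSpace) : coord u (stopPath t w) = coord (min u t) w := rfl

lemma coord_shiftPath (t u : ℝ≥0) (w : PathSpace) :
    coord u (shiftPath t w) = Sum.map (· - realCoord t w) id (coord (t + u) w) := rfl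

lemma coord_scalePath (α : ℝ) (k u : ℝ≥0) (w : PathSpace) :
    coord u (scalePath α k w) = Sum.map (fun x => (k : ℝ) * x) id (coord (k ^ (-α) * u) w) := rfl

lemma measurable_stopPath (t : ℝ≥0) : Measurable (stopPath t) :=
  measurable_pathSpace fun u => measurable_coord (min u t)

lemma measurable_shiftPath (t : ℝ≥0) : Measurable (shiftPath t) := by
  refine measurable_pathSpace fun u => ?_
  simp only [coord_shiftPath, sumMap_eq_ite]
  exact measurable_ite_cemetery (measurable_coord _)
    ((measurable_valK.comp (measurable_coord _)).sub (measurable_realCoord t))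

lemma measurable_scalePath (α : ℝ) : Measurable fun p : ℝ≥0 × PathSpace => scalePath α p.1 p.2 := by
  refine measurable_pathSpace fun u => ?_
  simp only [coord_scalePath, sumMap_eq_ite]
  have h : Measurable fun p : ℝ≥0 × PathSpace => coord (p.1 ^ (-α) * u) p.2 := by
    have h0 : Measurable fun p : ℝ≥0 × PathSpace => (p.1 ^ (-α) * u, p.2) :=
      ((measurable_fst.pow_const _).mul_const _).prodMk measurable_snd
    exact measurable_coord_uncurry.comp h0
  exact measurable_ite_cemetery h
    ((measurable_coe_nnreal_real.comp measurable_fst).mul (measurable_valK.comp h))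

/-- The path after time `t`, rescaled so that the distance to the level `a` is again `a`. -/
noncomputable def restartPath (α a : ℝ) (t : ℝ≥0) (w : PathSpace) : PathSpace :=
  scalePath α (a / pssMp a t w).toNNReal (shiftPath t w)

lemma pssMp_restartPath {α a : ℝ} (ha : 0 < a) {t : ℝ≥0} {w : PathSpace} (ht : 0 < pssMp a t w) (u : ℝ≥0) :
    pssMp a u (restartPath α a t w) = (a / pssMp a t w).toNNReal *
      pssMp a (t + (a / pssMp a t w).toNNReal ^ (-α) * u) w := by
  set k := (a / pssMp a t w).toNNReal with hk
  have hk' : (k : ℝ) = a / pssMp a t w := Real.coe_toNNReal _ (by positivity)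
  rw [pssMp_eq, pssMp_eq, restartPath, ← hk, coord_scalePath, coord_shiftPath]
  rcases coord (t + k ^ (-α) * u) w with x | x
  · simp only [Sum.map_inl, distBelow, Sum.elim_inl]
    rw [mul_max_of_nonneg _ _ k.coe_nonneg, mul_zero]
    congr 1
    have h := pssMp_of_pos ht
    rw [hk']
    have h2 := ht.ne'
    field_simp
    rw [h]; ring
  · simp [distBelow]

/-- Self-similarity of the Lamperti transform along a decreasing trajectory. -/
lemma lamperti_restartPath {α a : ℝ} (hα : 0 < α) (ha : 0 < a) {w : PathSpace}
    (hw : IsDecreasingPath a fun t => pssMp a t w) {t A : ℝ≥0} (ht : 0 < pssMp a t w)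
    (hA : clockOf α (fun t => pssMp a t w) t = A) (s : ℝ≥0) :
    lamperti α a (A + s) w = Sum.map (Real.log (pssMp a t w / a) + ·) id
      (lamperti α a s (restartPath α a t w)) := by
  rw [lamperti_eq_lampertiOf, lamperti_eq_lampertiOf]
  have hk : ((a / pssMp a t w).toNNReal : ℝ) = a / pssMp a t w := Real.coe_toNNReal _ (by positivity)
  rw [hw.lampertiOf_rescaled hα ha hk ht hA]
  simp only [pssMp_restartPath ha ht]

lemma pssMp_stopPath (a : ℝ) (t u : ℝ≥0) (w : PathSpace) :
    pssMp a u (stopPath t w) = pssMp a (min u t) w := rfl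

lemma lamperti_stopPath {α a : ℝ} (hα : 0 < α) {w : PathSpace}
    (hw : IsDecreasingPath a fun t => pssMp a t w) {s t : ℝ≥0} (ht : 0 < pssMp a t w)
    (hs : (s : ℝ≥0∞) ≤ clockOf α (fun t => pssMp a t w) t) :
    lamperti α a s (stopPath t w) = lamperti α a s w := by
  rw [lamperti_eq_lampertiOf, lamperti_eq_lampertiOf]
  exact hw.lampertiOf_stopped hα ht hs

/-! ### Processes with independent increments -/

/-- A finite set of times containing `0` is enumerated by a monotone sequence starting at `0`. -/
lemma exists_monotone_enum (F : Finset ℝ≥0) (h0 : 0 ∈ F) :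
    ∃ (τ : ℕ → ℝ≥0) (N : ℕ), Monotone τ ∧ τ 0 = 0 ∧ ∀ p ∈ F, ∃ j ≤ N, τ j = p := by
  have hcard : 0 < F.card := Finset.card_pos.2 ⟨0, h0⟩
  let e := F.orderEmbOfFin rfl
  have hlt : ∀ n, min n (F.card - 1) < F.card := fun n => by omega
  let τ : ℕ → ℝ≥0 := fun n => e ⟨min n (F.card - 1), hlt n⟩
  have hτ : Monotone τ := fun i j hij => e.monotone (by
    simp only [Fin.mk_le_mk]; exact min_le_min_right _ hij)
  have hmem : ∀ p ∈ F, ∃ j ≤ F.card - 1, τ j = p := fun p hp => by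
    have : p ∈ Set.range e := by rw [Finset.range_orderEmbOfFin]; exact hp
    obtain ⟨i, rfl⟩ := this
    have hi : (i : ℕ) ≤ F.card - 1 := by omega
    refine ⟨i, hi, ?_⟩
    simp only [τ, min_eq_left hi]
  refine ⟨τ, F.card - 1, hτ, ?_, hmem⟩
  obtain ⟨j, -, hj⟩ := hmem 0 h0
  exact le_antisymm ((hτ (Nat.zero_le j)).trans hj.le) zero_le

section Increments

variable {Ω : Type*} [MeasurableSpace Ω] {P : Measure Ω} {X : ℝ≥0 → Ω → ℝ}

lemma sum_coe_Ico_ite (k N j : ℕ) (hj : j ≤ N) (f : ℕ → ℝ) :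
    ∑ i : Finset.Ico k N, (if (i : ℕ) < j then f i else 0) = ∑ i ∈ Finset.Ico k j, f i := by
  rw [Finset.sum_coe_sort (Finset.Ico k N) (fun i => if i < j then f i else 0), ← Finset.sum_filter]
  congr 1
  ext i
  simp only [Finset.mem_filter, Finset.mem_Ico]
  omega

/-- The past and the future increments of a process with independent increments are independent. -/
lemma indepFun_past_future (hX : HasIndepIncrements X P) (hm : ∀ t, Measurable (X t))
    (h0 : ∀ᵐ ω ∂P, X 0 ω = 0) [IsProbabilityMeasure P] (t : ℝ≥0) :
    IndepFun (fun ω u => X (min u t) ω) (fun ω u => X (t + u) ω - X t ω) P := by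
  classical
  refine IndepFun.process_indepFun_process (X := fun u ω => X (min u t) ω)
    (Y := fun u ω => X (t + u) ω - X t ω) (fun _ => hm _) (fun _ => (hm _).sub (hm _)) fun I J => ?_
  let F : Finset ℝ≥0 := insert 0 (insert t (I.image (min · t) ∪ J.image (t + ·)))
  obtain ⟨τ, N, hτ, hτ0, hF⟩ := exists_monotone_enum F (by simp [F])
  obtain ⟨k, hkN, hk⟩ := hF t (by simp [F])
  have hI : ∀ u : I, ∃ j ≤ k, τ j = min (u : ℝ≥0) t := fun u => by
    obtain ⟨j, -, hj⟩ := hF (min (u : ℝ≥0) t) (by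
      simp only [F, Finset.mem_insert, Finset.mem_union, Finset.mem_image]
      exact Or.inr (Or.inr (Or.inl ⟨u, u.2, rfl⟩)))
    rcases le_total j k with h | h
    · exact ⟨j, h, hj⟩
    · exact ⟨k, le_rfl, le_antisymm ((hτ h).trans hj.le) (by rw [hk]; exact min_le_right _ _)⟩
  have hJ : ∀ v : J, ∃ j, k ≤ j ∧ j ≤ N ∧ τ j = t + v := fun v => by
    obtain ⟨j, hjN, hj⟩ := hF (t + v) (by
      simp only [F, Finset.mem_insert, Finset.mem_union, Finset.mem_image]
      exact Or.inr (Or.inr (Or.inr ⟨v, v.2, rfl⟩)))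
    rcases le_total k j with h | h
    · exact ⟨j, h, hjN, hj⟩
    · exact ⟨k, le_rfl, hkN, le_antisymm (by rw [hk]; exact le_self_add) ((hj.symm.le).trans (hτ h))⟩
  choose p hpk hp using hI
  choose q hkq hqN hq using hJ
  have hind := (hX.nat hτ).indepFun_finset (Finset.Ico 0 k) (Finset.Ico k N)
    (Finset.Ico_disjoint_Ico_consecutive 0 k N) (fun i => (hm _).sub (hm _))
  let f : (Finset.Ico 0 k → ℝ) → I → ℝ := fun x u =>
    ∑ i : Finset.Ico 0 k, if (i : ℕ) < p u then x i else 0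
  let g : (Finset.Ico k N → ℝ) → J → ℝ := fun x v =>
    ∑ i : Finset.Ico k N, if (i : ℕ) < q v then x i else 0
  have hf : Measurable f := measurable_pi_lambda _ fun u => Finset.measurable_sum _ fun i _ => by
    split_ifs
    · exact measurable_pi_apply i
    · exact measurable_const
  have hg : Measurable g := measurable_pi_lambda _ fun u => Finset.measurable_sum _ fun i _ => by
    split_ifs
    · exact measurable_pi_apply i
    · exact measurable_const
  refine (hind.comp hf hg).congr ?_ ?_
  · filter_upwards [h0] with ω hω
    funext u
    simp only [Function.comp, f]
    rw [sum_coe_Ico_ite 0 k (p u) (hpk u) (fun i => X (τ (i + 1)) ω - X (τ i) ω),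
      Finset.sum_Ico_eq_sum_range]
    simp only [Nat.sub_zero, Nat.zero_add]
    rw [Finset.sum_range_sub (fun i => X (τ i) ω), hτ0, hω, sub_zero, hp]
  · refine Eventually.of_forall fun ω => ?_
    funext v
    simp only [Function.comp, g]
    rw [sum_coe_Ico_ite k N (q v) (hqN v) (fun i => X (τ (i + 1)) ω - X (τ i) ω),
      Finset.sum_Ico_sub (fun i => X (τ i) ω) (hkq v), hq, hk]

/-- Stationarity of the increments at the level of the process. -/
lemma map_future_eq (hX : HasIndepIncrements X P) (hm : ∀ t, Measurable (X t))
    (h0 : ∀ᵐ ω ∂P, X 0 ω = 0) [IsProbabilityMeasure P]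
    (hs : ∀ s t, P.map (fun ω => X (s + t) ω - X s ω) = P.map (X t)) (t : ℝ≥0) :
    P.map (fun ω u => X (t + u) ω - X t ω) = P.map (fun ω u => X u ω) := by
  classical
  have hm' : Measurable fun ω u => X u ω := measurable_pi_lambda _ hm
  have hmt : Measurable fun ω u => X (t + u) ω - X t ω :=
    measurable_pi_lambda _ fun u => (hm _).sub (hm _)
  rw [map_eq_iff_forall_finset_map_restrict_eq (X := fun u ω => X (t + u) ω - X t ω)
    (Y := fun u ω => X u ω) hmt.aemeasurable hm'.aemeasurable]
  intro J
  obtain ⟨τ, N, hτ, hτ0, hF⟩ := exists_monotone_enum (insert 0 J) (by simp)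
  have hJ : ∀ v : J, ∃ j ≤ N, τ j = v := fun v => hF v (by simp)
  choose q hqN hq using hJ
  have hi1 := (hX.nat hτ).precomp (g := fun i : Fin N => (i : ℕ)) Fin.val_injective
  have hi2 := (hX.nat (t := fun i => t + τ i) fun i j h => by
    simpa using hτ h).precomp (g := fun i : Fin N => (i : ℕ)) Fin.val_injective
  rw [iIndepFun_iff_map_fun_eq_pi_map (f := fun (i : Fin N) ω => X (τ (i + 1)) ω - X (τ i) ω)
    fun i => ((hm _).sub (hm _)).aemeasurable] at hi1
  rw [iIndepFun_iff_map_fun_eq_pi_map (f := fun (i : Fin N) ω => X (t + τ (i + 1)) ω - X (t + τ i) ω)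
    fun i => ((hm _).sub (hm _)).aemeasurable] at hi2
  have hlaw : P.map (fun ω (i : Fin N) => X (t + τ (i + 1)) ω - X (t + τ i) ω) =
      P.map (fun ω (i : Fin N) => X (τ (i + 1)) ω - X (τ i) ω) := by
    rw [hi1, hi2]
    congr 1
    funext i
    have h1 : t + τ (i + 1) = t + τ i + (τ (i + 1) - τ i) := by
      rw [add_assoc, add_tsub_cancel_of_le (hτ (Nat.le_succ _))]
    have h2 : τ (i + 1) = τ i + (τ (i + 1) - τ i) := by
      rw [add_tsub_cancel_of_le (hτ (Nat.le_succ _))]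
    rw [h1, hs, h2, hs]
    simp
  let g : (Fin N → ℝ) → J → ℝ := fun x v => ∑ i : Fin N, if (i : ℕ) < q v then x i else 0
  have hg : Measurable g := measurable_pi_lambda _ fun u => Finset.measurable_sum _ fun i _ => by
    split_ifs
    · exact measurable_pi_apply i
    · exact measurable_const
  have hsum : ∀ (f : ℕ → ℝ) (v : J), ∑ i : Fin N, (if (i : ℕ) < q v then f i else 0) =
      ∑ i ∈ Finset.range (q v), f i := fun f v => by
    rw [Fin.sum_univ_eq_sum_range (fun i => if i < q v then f i else 0), ← Finset.sum_filter]
    congr 1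
    ext i
    have := hqN v
    simp only [Finset.mem_filter, Finset.mem_range]
    omega
  have e1 : (fun ω => J.restrict fun u => X (t + u) ω - X t ω) =
      g ∘ fun ω (i : Fin N) => X (t + τ (i + 1)) ω - X (t + τ i) ω := by
    funext ω v
    simp only [Function.comp, g, Finset.restrict]
    rw [hsum (fun i => X (t + τ (i + 1)) ω - X (t + τ i) ω),
      Finset.sum_range_sub (fun i => X (t + τ i) ω), hτ0, add_zero, hq]
  have e2 : (fun ω => J.restrict fun u => X u ω) =ᵐ[P]
      g ∘ fun ω (i : Fin N) => X (τ (i + 1)) ω - X (τ i) ω := by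
    filter_upwards [h0] with ω hω
    funext v
    simp only [Function.comp, g, Finset.restrict]
    rw [hsum (fun i => X (τ (i + 1)) ω - X (τ i) ω),
      Finset.sum_range_sub (fun i => X (τ i) ω), hτ0, hω, sub_zero, hq]
  rw [Measure.map_congr e2, e1, ← Measure.map_map hg, ← Measure.map_map hg, hlaw]
  · exact measurable_pi_lambda _ fun i => (hm _).sub (hm _)
  · exact measurable_pi_lambda _ fun i => (hm _).sub (hm _)

end Increments

/-! ### The Markov property of the stable subordinator -/

/-- Independence of path-valued maps is independence of the processes. -/
lemma indepFun_pathSpace {Ω : Type*} [MeasurableSpace Ω] {P : Measure Ω} {f g : Ω → PathSpace}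
    (h : IndepFun (fun ω => (f ω).1) (fun ω => (g ω).1) P) : IndepFun f g P := by
  rw [IndepFun_iff_Indep] at h ⊢
  have key : ∀ f : Ω → PathSpace, MeasurableSpace.comap (fun ω => (f ω).1) MeasurableSpace.pi =
      MeasurableSpace.comap f Subtype.instMeasurableSpace := fun f => by
    rw [Subtype.instMeasurableSpace, MeasurableSpace.comap_comp]; rfl
  rwa [key, key] at h

namespace IsUnitStableSubordinator

variable {α : ℝ} {P : Measure PathSpace}

lemma ae_coord_ne (hP : IsUnitStableSubordinator α P) : ∀ᵐ w ∂P, ∀ t, coord t w ≠ cemetery := by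
  filter_upwards [hP.not_killed] with w hw t
  rw [← lt_lifetime_coord_iff, hw]
  exact ENNReal.coe_lt_top

lemma ae_isIncreasingPath (hP : IsUnitStableSubordinator α P) : ∀ᵐ w ∂P, IsIncreasingPath w := by
  filter_upwards [hP.ae_coord_ne, hP.subordinator.monotone, hP.subordinator.zero] with w h1 h2 h3
  exact ⟨by rw [eq_inl_valK (h1 0), ← realCoord_eq, h3], fun s t h _ => h2 h⟩

/-- Two families of path operations that never kill have the same law once the real-valued
processes do. -/
lemma map_eq_of_real {Ω : Type*} [MeasurableSpace Ω] {μ : Measure Ω} {f g : Ω → PathSpace}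
    (hf : Measurable f) (hg : Measurable g) (hf' : ∀ᵐ w ∂μ, ∀ t, coord t (f w) ≠ cemetery)
    (hg' : ∀ᵐ w ∂μ, ∀ t, coord t (g w) ≠ cemetery)
    (h : μ.map (fun w t => realCoord t (f w)) = μ.map fun w t => realCoord t (g w)) :
    μ.map f = μ.map g := by
  apply map_pathSpace_eq hf hg
  have hi : Measurable fun (x : ℝ≥0 → ℝ) (t : ℝ≥0) => (Sum.inl (x t) : KilledReal) :=
    measurable_pi_lambda _ fun t => measurable_inl.comp (measurable_pi_apply t)
  have key : ∀ f : Ω → PathSpace, Measurable f → (∀ᵐ w ∂μ, ∀ t, coord t (f w) ≠ cemetery) →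
      μ.map (fun w => (f w).1) = (μ.map (fun w t => realCoord t (f w))).map
        fun x t => (Sum.inl (x t) : KilledReal) := fun f hf hf' => by
    have hr : Measurable fun w t => realCoord t (f w) :=
      measurable_pi_lambda _ fun t => (measurable_realCoord t).comp hf
    rw [Measure.map_map hi hr]
    refine Measure.map_congr ?_
    filter_upwards [hf'] with w hw
    funext t
    exact eq_inl_valK (hw t)
  rw [key f hf hf', key g hg hg', h]

lemma realCoord_shiftPath {t u : ℝ≥0} {w : PathSpace} (h : coord (t + u) w ≠ cemetery) :
    realCoord u (shiftPath t w) = realCoord (t + u) w - realCoord t w := by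
  rw [realCoord_eq, coord_shiftPath, eq_inl_valK h]
  rfl

lemma coord_shiftPath_ne {t u : ℝ≥0} {w : PathSpace} (h : coord (t + u) w ≠ cemetery) :
    coord u (shiftPath t w) ≠ cemetery := by
  rw [coord_shiftPath, eq_inl_valK h]
  exact inl_ne_cemetery _

lemma map_shiftPath [IsProbabilityMeasure P] (hP : IsUnitStableSubordinator α P) (t : ℝ≥0) : P.map (shiftPath t) = P := by
  have h := hP.subordinator
  conv_rhs => rw [← Measure.map_id (μ := P)]
  refine map_eq_of_real (measurable_shiftPath t) measurable_id ?_ ?_ ?_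
  · filter_upwards [hP.ae_coord_ne] with w hw u
    exact coord_shiftPath_ne (hw _)
  · exact hP.ae_coord_ne
  · refine Eq.trans ?_ (map_future_eq h.indep h.measurable h.zero h.stationary t)
    refine Measure.map_congr ?_
    filter_upwards [hP.ae_coord_ne] with w hw
    funext u
    exact realCoord_shiftPath (hw _)

/-- The Markov property at a fixed time. -/
lemma map_stopPath_shiftPath [IsProbabilityMeasure P] (hP : IsUnitStableSubordinator α P) (t : ℝ≥0) :
    P.map (fun w => (stopPath t w, shiftPath t w)) = (P.map (stopPath t)).prod P := by
  have h := hP.subordinator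
  have hi : Measurable fun (x : ℝ≥0 → ℝ) (t : ℝ≥0) => (Sum.inl (x t) : KilledReal) :=
    measurable_pi_lambda _ fun t => measurable_inl.comp (measurable_pi_apply t)
  have hind : IndepFun (stopPath t) (shiftPath t) P := by
    apply indepFun_pathSpace
    refine ((indepFun_past_future h.indep h.measurable h.zero t).comp hi hi).congr ?_ ?_
    · filter_upwards [hP.ae_coord_ne] with w hw
      funext u
      exact (eq_inl_valK (hw _)).symm
    · filter_upwards [hP.ae_coord_ne] with w hw
      funext u
      simp only [Function.comp]
      rw [← realCoord_shiftPath (hw _)]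
      exact (eq_inl_valK (coord_shiftPath_ne (hw _))).symm
  rw [(indepFun_iff_map_prod_eq_prod_map_map (measurable_stopPath t).aemeasurable
    (measurable_shiftPath t).aemeasurable).1 hind, hP.map_shiftPath t]

lemma map_scalePath (hP : IsUnitStableSubordinator α P) {k : ℝ≥0} (hk : 0 < k) :
    P.map (scalePath α k) = P := by
  have hne : ∀ᵐ w ∂P, ∀ t, coord t (scalePath α k w) ≠ cemetery := by
    filter_upwards [hP.ae_coord_ne] with w hw u
    rw [coord_scalePath, eq_inl_valK (hw _)]
    exact inl_ne_cemetery _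
  conv_rhs => rw [← Measure.map_id (μ := P)]
  refine map_eq_of_real (measurable_section (measurable_scalePath α) k) measurable_id hne
    hP.ae_coord_ne ?_
  refine Eq.trans ?_ (hP.scaling k hk)
  refine Measure.map_congr ?_
  filter_upwards [hP.ae_coord_ne] with w hw
  funext u
  rw [realCoord_eq, coord_scalePath, eq_inl_valK (hw _)]
  rfl

/-- The Markov property at a fixed time, combined with scaling: given the past, the path restarted
from distance `a` is again a stable subordinator. -/
lemma lintegral_restartPath [IsProbabilityMeasure P] (hP : IsUnitStableSubordinator α P) {a : ℝ} (ha : 0 < a) (t : ℝ≥0)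
    {F : PathSpace × PathSpace → ℝ≥0∞} (hF : Measurable F) :
    ∫⁻ w in {w | 0 < pssMp a t w}, F (stopPath t w, restartPath α a t w) ∂P =
      ∫⁻ w in {w | 0 < pssMp a t w}, ∫⁻ w', F (stopPath t w, w') ∂P ∂P := by
  have hS : MeasurableSet {w | 0 < pssMp a t w} := measurableSet_lt measurable_const (measurable_pssMp a t)
  have hk : Measurable fun w => (a / pssMp a t w).toNNReal :=
    (measurable_const.div (measurable_pssMp a t)).real_toNNReal
  let G : PathSpace × PathSpace → ℝ≥0∞ := fun p =>
    {w | 0 < pssMp a t w}.indicator (fun w => F (w, scalePath α (a / pssMp a t w).toNNReal p.2)) p.1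
  have hG : Measurable G := by
    have h1 : Measurable fun p : PathSpace × PathSpace =>
        F (p.1, scalePath α (a / pssMp a t p.1).toNNReal p.2) :=
      hF.comp (measurable_fst.prodMk ((measurable_scalePath α).comp
        ((hk.comp measurable_fst).prodMk measurable_snd)))
    have h2 : G = (Prod.fst ⁻¹' {w | 0 < pssMp a t w}).indicator fun p : PathSpace × PathSpace =>
        F (p.1, scalePath α (a / pssMp a t p.1).toNNReal p.2) := by
      funext p; rfl
    rw [h2]
    exact h1.indicator (measurable_fst hS)
  have hst : ∀ w, pssMp a t (stopPath t w) = pssMp a t w := fun w => by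
    rw [pssMp_stopPath, min_self]
  have hinner : Measurable fun w => ∫⁻ w', G (w, w') ∂P := hG.lintegral_prod_right'
  calc ∫⁻ w in {w | 0 < pssMp a t w}, F (stopPath t w, restartPath α a t w) ∂P
      = ∫⁻ w, G (stopPath t w, shiftPath t w) ∂P := by
        rw [← lintegral_indicator hS]
        refine lintegral_congr fun w => ?_
        simp only [G, Set.indicator, Set.mem_ofPred_eq, hst]
        rfl
    _ = ∫⁻ p, G p ∂((P.map (stopPath t)).prod P) := by
        rw [← hP.map_stopPath_shiftPath t,
          lintegral_map hG ((measurable_stopPath t).prodMk (measurable_shiftPath t))]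
    _ = ∫⁻ w, ∫⁻ w', G (stopPath t w, w') ∂P ∂P := by
        rw [lintegral_prod _ hG.aemeasurable, lintegral_map hinner (measurable_stopPath t)]
    _ = _ := by
        rw [← lintegral_indicator hS]
        refine lintegral_congr fun w => ?_
        by_cases hw : 0 < pssMp a t w
        · rw [Set.indicator_of_mem (show w ∈ {w | 0 < pssMp a t w} from hw)]
          have hF' : Measurable fun w' => F (stopPath t w, w') := hF.comp measurable_prodMk_left
          conv_rhs => rw [← hP.map_scalePath (k := (a / pssMp a t w).toNNReal)
            (Real.toNNReal_pos.2 (by positivity)),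
            lintegral_map hF' (measurable_section (measurable_scalePath α) _)]
          refine lintegral_congr fun w' => ?_
          simp only [G, Set.indicator, Set.mem_ofPred_eq, hst, if_pos hw]
        · rw [Set.indicator_of_notMem (show w ∉ {w | 0 < pssMp a t w} from hw)]
          simp only [G, Set.indicator, Set.mem_ofPred_eq, hst, if_neg hw, lintegral_zero]

end IsUnitStableSubordinator

/-! ### The time change -/

lemma lampertiClock_eq_clockOf (α a : ℝ) (r : ℝ≥0) (w : PathSpace) :
    lampertiClock α a r w = clockOf α (fun t => pssMp a t w) r := rfl

lemma measurable_lampertiClock_uncurry (α a : ℝ) :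
    Measurable fun p : ℝ≥0 × PathSpace => lampertiClock α a p.1 p.2 := by
  have h0 : ∀ p : ℝ≥0 × PathSpace, lampertiClock α a p.1 p.2 = ∫⁻ u : ℝ,
      {q : (ℝ≥0 × PathSpace) × ℝ | 0 ≤ q.2 ∧ q.2 ≤ q.1.1}.indicator
        (fun q => ENNReal.ofReal (pssMp a q.2.toNNReal q.1.2) ^ (-α)) (p, u) := fun p => by
    rw [lampertiClock, ← lintegral_indicator measurableSet_Icc]
    rfl
  simp only [h0]
  refine Measurable.lintegral_prod_right' (f := {q : (ℝ≥0 × PathSpace) × ℝ | 0 ≤ q.2 ∧ q.2 ≤ q.1.1}.indicator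
        (fun q => ENNReal.ofReal (pssMp a q.2.toNNReal q.1.2) ^ (-α))) (Measurable.indicator ?_ ?_)
  · have h : Measurable fun q : (ℝ≥0 × PathSpace) × ℝ => (q.2.toNNReal, q.1.2) :=
      (measurable_real_toNNReal.comp measurable_snd).prodMk (measurable_snd.comp measurable_fst)
    exact ((measurable_pssMp_uncurry a).comp h).ennreal_ofReal.pow_const _
  · exact (measurableSet_le measurable_const measurable_snd).inter
      (measurableSet_le measurable_snd
        (measurable_coe_nnreal_real.comp (measurable_fst.comp measurable_fst)))

/-- The real-valued clock `∫_0^u Y_v^(-α) dv` before absorption (and `0` where it is infinite). -/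
noncomputable def clockNN (α a : ℝ) (u : ℝ≥0) (w : PathSpace) : ℝ≥0 := (lampertiClock α a u w).toNNReal

lemma measurable_clockNN_uncurry (α a : ℝ) :
    Measurable fun p : ℝ≥0 × PathSpace => clockNN α a p.1 p.2 :=
  (measurable_lampertiClock_uncurry α a).ennreal_toNNReal

/-- The density `Y_u^(-α)` of the clock. -/
noncomputable def clockRate (α a : ℝ) (u : ℝ≥0) (w : PathSpace) : ℝ≥0∞ :=
  ENNReal.ofReal (pssMp a u w) ^ (-α)

lemma measurable_clockRate_uncurry (α a : ℝ) :
    Measurable fun p : ℝ≥0 × PathSpace => clockRate α a p.1 p.2 :=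
  (measurable_pssMp_uncurry a).ennreal_ofReal.pow_const _

lemma measurableSet_alive (α a : ℝ) (s : ℝ≥0) : MeasurableSet {w | lamperti α a s w ≠ cemetery} :=
  (measurable_lamperti α a s measurableSet_cemetery).compl

lemma measurableSet_pssMp_pos (a : ℝ) (t : ℝ≥0) : MeasurableSet {w | 0 < pssMp a t w} :=
  measurableSet_lt measurable_const (measurable_pssMp a t)

/-- Exchanging expectation with the Lamperti time change: integrals over the time of `ξ` become
integrals over the time of `Y`. -/
lemma lintegral_time_change {α a : ℝ} (hα : 0 < α) {Q : Measure PathSpace} [SFinite Q]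
    (hQ : ∀ᵐ w ∂Q, IsDecreasingPath a fun t => pssMp a t w) {H : ℝ≥0 × PathSpace → ℝ≥0∞}
    (hH : Measurable H) :
    ∫⁻ s, ∫⁻ w in {w | lamperti α a s w ≠ cemetery}, H (s, w) ∂Q ∂halfLebesgue =
      ∫⁻ u, ∫⁻ w in {w | 0 < pssMp a u w}, H (clockNN α a u w, w) * clockRate α a u w ∂Q
        ∂halfLebesgue := by
  have hS1 : MeasurableSet {p : ℝ≥0 × PathSpace | lamperti α a p.1 p.2 ≠ cemetery} :=
    (measurable_lamperti_uncurry α a measurableSet_cemetery).compl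
  have hS2 : MeasurableSet {p : ℝ≥0 × PathSpace | 0 < pssMp a p.1 p.2} :=
    measurableSet_lt measurable_const (measurable_pssMp_uncurry a)
  have hH2 : Measurable fun p : ℝ≥0 × PathSpace => H (clockNN α a p.1 p.2, p.2) * clockRate α a p.1 p.2 :=
    (hH.comp ((measurable_clockNN_uncurry α a).prodMk measurable_snd)).mul
      (measurable_clockRate_uncurry α a)
  have e1 : ∀ s, ∫⁻ w in {w | lamperti α a s w ≠ cemetery}, H (s, w) ∂Q =
      ∫⁻ w, {p : ℝ≥0 × PathSpace | lamperti α a p.1 p.2 ≠ cemetery}.indicator H (s, w) ∂Q := fun s => by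
    rw [← lintegral_indicator (measurableSet_alive α a s)]
    rfl
  have e2 : ∀ u, ∫⁻ w in {w | 0 < pssMp a u w}, H (clockNN α a u w, w) * clockRate α a u w ∂Q =
      ∫⁻ w, {p : ℝ≥0 × PathSpace | 0 < pssMp a p.1 p.2}.indicator
        (fun p => H (clockNN α a p.1 p.2, p.2) * clockRate α a p.1 p.2) (u, w) ∂Q := fun u => by
    rw [← lintegral_indicator (measurableSet_pssMp_pos a u)]
    rfl
  simp only [e1, e2]
  rw [lintegral_lintegral_swap (f := fun s w => {p : ℝ≥0 × PathSpace |
      lamperti α a p.1 p.2 ≠ cemetery}.indicator H (s, w)) (hH.indicator hS1).aemeasurable,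
    lintegral_lintegral_swap (f := fun u w => {p : ℝ≥0 × PathSpace | 0 < pssMp a p.1 p.2}.indicator
      (fun p => H (clockNN α a p.1 p.2, p.2) * clockRate α a p.1 p.2) (u, w))
      (hH2.indicator hS2).aemeasurable]
  refine lintegral_congr_ae ?_
  filter_upwards [hQ] with w hw
  have h1 := hw.lintegral_clockOf hα (f := fun s => H (s, w)) (hH.comp measurable_prodMk_right)
  have m1 : MeasurableSet {s | lampertiOf α a (fun t => pssMp a t w) s ≠ cemetery} := by
    have := (measurable_prodMk_right (y := w)) hS1
    simpa only [Set.preimage_ofPred_eq, lamperti_eq_lampertiOf] using this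
  rw [← lintegral_indicator m1, ← lintegral_indicator hw.measurableSet_pos] at h1
  refine (lintegral_congr fun s => ?_).trans (h1.trans (lintegral_congr fun u => ?_))
  · simp only [Set.indicator, Set.mem_ofPred_eq, lamperti_eq_lampertiOf]
  · rfl

/-! ### The Lévy property of the Lamperti transform -/

/-- A path of the state space stopped at `s`. -/
def stopProc (s : ℝ≥0) (x : ℝ≥0 → KilledReal) : ℝ≥0 → KilledReal := fun u => x (min u s)

/-- The increments of a path of the state space after `s`. -/
noncomputable def incProc (s : ℝ≥0) (x : ℝ≥0 → KilledReal) : ℝ≥0 → KilledReal :=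
  fun u => Sum.map (· - valK (x s)) id (x (s + u))

lemma measurable_stopProc (s : ℝ≥0) : Measurable (stopProc s) :=
  measurable_pi_lambda _ fun _ => measurable_pi_apply _

lemma continuous_sumMap_sub : Continuous fun p : KilledReal × ℝ =>
    (Sum.map (· - p.2) id p.1 : KilledReal) := by
  have h : (fun p : KilledReal × ℝ => (Sum.map (· - p.2) id p.1 : KilledReal)) =
      (Sum.elim (fun q : ℝ × ℝ => (Sum.inl (q.1 - q.2) : KilledReal)) fun _ => cemetery) ∘
        (Homeomorph.sumProdDistrib : (ℝ ⊕ Unit) × ℝ ≃ₜ (ℝ × ℝ) ⊕ (Unit × ℝ)) := by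
    funext p
    rcases p with ⟨x | x, c⟩ <;> rfl
  rw [h]
  exact (Continuous.sumElim (continuous_inl.comp (by fun_prop)) continuous_const).comp
    (Homeomorph.continuous _)

lemma measurable_sumMap_sub {Ω : Type*} [MeasurableSpace Ω] {f : Ω → KilledReal} {g : Ω → ℝ}
    (hf : Measurable f) (hg : Measurable g) :
    Measurable fun ω => (Sum.map (· - g ω) id (f ω) : KilledReal) :=
  continuous_sumMap_sub.measurable.comp (hf.prodMk hg)

lemma measurable_comp_uncurry {S Ω E X : Type*} [MeasurableSpace S] [MeasurableSpace Ω]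
    [MeasurableSpace E] [MeasurableSpace X] {Z : S → Ω → E}
    (hZ : Measurable fun p : S × Ω => Z p.1 p.2) {f : X → S} {g : X → Ω} (hf : Measurable f)
    (hg : Measurable g) : Measurable fun x => Z (f x) (g x) :=
  hZ.comp (hf.prodMk hg)

lemma measurable_incProc_uncurry (α a : ℝ) : Measurable fun p : ℝ≥0 × PathSpace =>
    incProc p.1 (lampertiPath α a p.2) := by
  refine measurable_pi_lambda _ fun u => ?_
  have h2 := measurable_comp_uncurry (measurable_lamperti_uncurry α a) (measurable_fst.add_const u)
    (measurable_snd (α := ℝ≥0))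
  exact measurable_sumMap_sub h2 (measurable_valK.comp (measurable_lamperti_uncurry α a))

lemma measurable_incProc (α a : ℝ) (s : ℝ≥0) : Measurable fun w => incProc s (lampertiPath α a w) :=
  measurable_section (Z := fun s w => incProc s (lampertiPath α a w)) (measurable_incProc_uncurry α a) s

section PathFacts

variable {α a : ℝ} {w : PathSpace}

lemma coe_clockNN (hα : 0 < α) (hw : IsDecreasingPath a fun t => pssMp a t w) {u : ℝ≥0}
    (hu : 0 < pssMp a u w) : (clockNN α a u w : ℝ≥0∞) = clockOf α (fun t => pssMp a t w) u :=
  ENNReal.coe_toNNReal (hw.clockOf_ne_top hα hu)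

lemma lamperti_clockNN (hα : 0 < α) (hw : IsDecreasingPath a fun t => pssMp a t w) {u : ℝ≥0}
    (hu : 0 < pssMp a u w) :
    lamperti α a (clockNN α a u w) w = Sum.inl (Real.log (pssMp a u w / a)) := by
  rw [lamperti_eq_lampertiOf]
  exact hw.lampertiOf_clockOf hα hu (coe_clockNN hα hw hu).symm

lemma lamperti_add_clockNN (hα : 0 < α) (ha : 0 < a) (hw : IsDecreasingPath a fun t => pssMp a t w)
    {u : ℝ≥0} (hu : 0 < pssMp a u w) (s : ℝ≥0) :
    lamperti α a (clockNN α a u w + s) w = Sum.map (Real.log (pssMp a u w / a) + ·) id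
      (lamperti α a s (restartPath α a u w)) :=
  lamperti_restartPath hα ha hw hu (coe_clockNN hα hw hu).symm s

lemma incProc_clockNN (hα : 0 < α) (ha : 0 < a) (hw : IsDecreasingPath a fun t => pssMp a t w)
    {u : ℝ≥0} (hu : 0 < pssMp a u w) :
    incProc (clockNN α a u w) (lampertiPath α a w) = lampertiPath α a (restartPath α a u w) := by
  funext s
  simp only [incProc, lampertiPath]
  rw [lamperti_add_clockNN hα ha hw hu, lamperti_clockNN hα hw hu]
  rcases lamperti α a s (restartPath α a u w) with x | x <;> simp

lemma clockNN_stopPath (u : ℝ≥0) (hw : IsDecreasingPath a fun t => pssMp a t w) :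
    clockNN α a u (stopPath u w) = clockNN α a u w := by
  simp only [clockNN, lampertiClock_eq_clockOf, pssMp_stopPath]
  rw [hw.clockOf_stopped le_rfl]

lemma clockRate_stopPath (u : ℝ≥0) : clockRate α a u (stopPath u w) = clockRate α a u w := by
  simp only [clockRate, pssMp_stopPath, min_self]

lemma stopProc_stopPath (hα : 0 < α) (hw : IsDecreasingPath a fun t => pssMp a t w) {u s : ℝ≥0}
    (hu : 0 < pssMp a u w) (hs : s ≤ clockNN α a u w) :
    stopProc s (lampertiPath α a (stopPath u w)) = stopProc s (lampertiPath α a w) := by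
  funext v
  refine lamperti_stopPath hα hw hu ?_
  rw [← coe_clockNN hα hw hu]
  exact_mod_cast (min_le_right v s).trans hs

lemma lamperti_ne_of_le (hα : 0 < α) (hw : IsDecreasingPath a fun t => pssMp a t w) {s t : ℝ≥0}
    (h : s ≤ t) (ht : lamperti α a t w ≠ cemetery) : lamperti α a s w ≠ cemetery := by
  rw [lamperti_eq_lampertiOf] at ht ⊢
  exact hw.lampertiOf_ne_of_le hα h ht

lemma lamperti_right_continuous (hα : 0 < α) (ha : 0 < a)
    (hw : IsDecreasingPath a fun t => pssMp a t w) (t : ℝ≥0) :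
    ContinuousWithinAt (fun s => lamperti α a s w) (Set.Ici t) t := by
  simp only [lamperti_eq_lampertiOf]
  exact hw.lampertiOf_right_continuous hα ha t

end PathFacts

/-- A property that holds at almost all times after `s` holds along a sequence decreasing to `s`. -/
lemma exists_seq_of_ae_ge {s : ℝ≥0} {p : ℝ≥0 → Prop}
    (h : ∀ᵐ t ∂halfLebesgue, s ≤ t → p t) :
    ∃ v : ℕ → ℝ≥0, (∀ n, s ≤ v n ∧ p (v n)) ∧ Tendsto v atTop (𝓝[≥] s) := by
  have : ∀ n : ℕ, ∃ t, s ≤ t ∧ t ≤ s + 1 / ((n : ℝ≥0) + 1) ∧ p t := fun n => by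
    by_contra hcon
    push Not at hcon
    have h1 : Set.Ioc s (s + 1 / ((n : ℝ≥0) + 1)) ⊆ {t | ¬ (s ≤ t → p t)} := fun t ht hp =>
      hcon t ht.1.le ht.2 (hp ht.1.le)
    have h2 := measure_mono_null h1 h
    rw [halfLebesgue_Ioc le_self_add, add_tsub_cancel_left] at h2
    have : (0 : ℝ≥0) < 1 / ((n : ℝ≥0) + 1) := by positivity
    exact this.ne' (by exact_mod_cast h2)
  choose v h1 h2 h3 using this
  refine ⟨v, fun n => ⟨h1 n, h3 n⟩, tendsto_nhdsWithin_iff.2 ⟨?_, Eventually.of_forall h1⟩⟩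
  refine tendsto_of_tendsto_of_tendsto_of_le_of_le tendsto_const_nhds ?_ h1 h2
  simpa using (tendsto_const_nhds (x := s)).add (tendsto_one_div_add_atTop_nhds_zero_nat (𝕜 := ℝ≥0))

namespace IsUnitStableSubordinator

variable {α a : ℝ} {P : Measure PathSpace}

lemma ae_isDecreasingPath (hP : IsUnitStableSubordinator α P) (ha : 0 < a) :
    ∀ᵐ w ∂P, IsDecreasingPath a fun t => pssMp a t w := by
  filter_upwards [hP.ae_isIncreasingPath] with w hw
  exact hw.isDecreasingPath ha

/-- The Lévy property at almost every time: it is the Markov property of the stable subordinator at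
fixed times, read in the time scale of `ξ`. -/
lemma ae_levy [IsProbabilityMeasure P] (hP : IsUnitStableSubordinator α P) (hα : 0 < α) (ha : 0 < a) (s : ℝ≥0)
    {B : Set (ℝ≥0 → KilledReal)} (hB : MeasurableSet B) {F : (ℝ≥0 → KilledReal) → ℝ≥0∞}
    (hF : Measurable F) :
    ∀ᵐ t ∂halfLebesgue, s ≤ t →
      ∫⁻ w in {w | lamperti α a t w ≠ cemetery}, B.indicator 1 (stopProc s (lampertiPath α a w)) *
          F (incProc t (lampertiPath α a w)) ∂P =
        ∫⁻ w in {w | lamperti α a t w ≠ cemetery}, B.indicator 1 (stopProc s (lampertiPath α a w)) *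
          ∫⁻ w', F (lampertiPath α a w') ∂P ∂P := by
  have hind : Measurable fun w => B.indicator (1 : (ℝ≥0 → KilledReal) → ℝ≥0∞) (stopProc s (lampertiPath α a w)) :=
    (measurable_one.indicator hB).comp ((measurable_stopProc s).comp (measurable_lampertiPath α a))
  have hFi : Measurable fun p : ℝ≥0 × PathSpace => F (incProc p.1 (lampertiPath α a p.2)) :=
    hF.comp (measurable_incProc_uncurry α a)
  have hFl : Measurable fun w => F (lampertiPath α a w) := hF.comp (measurable_lampertiPath α a)
  set c := ∫⁻ w', F (lampertiPath α a w') ∂P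
  have hS1 : MeasurableSet {p : ℝ≥0 × PathSpace | lamperti α a p.1 p.2 ≠ cemetery} :=
    (measurable_lamperti_uncurry α a measurableSet_cemetery).compl
  have meas : ∀ G : ℝ≥0 × PathSpace → ℝ≥0∞, Measurable G → Measurable fun t =>
      ∫⁻ w in {w | lamperti α a t w ≠ cemetery}, G (t, w) ∂P := fun G hG => by
    have e1 : ∀ s, ∫⁻ w in {w | lamperti α a s w ≠ cemetery}, G (s, w) ∂P =
        ∫⁻ w, {p : ℝ≥0 × PathSpace | lamperti α a p.1 p.2 ≠ cemetery}.indicator G (s, w) ∂P :=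
      fun s => by
        rw [← lintegral_indicator (measurableSet_alive α a s)]
        rfl
    simp only [e1]
    exact (hG.indicator hS1).lintegral_prod_right'
  have hmul1 : Measurable fun p : ℝ≥0 × PathSpace =>
      B.indicator (1 : (ℝ≥0 → KilledReal) → ℝ≥0∞) (stopProc s (lampertiPath α a p.2)) *
        F (incProc p.1 (lampertiPath α a p.2)) := (hind.comp measurable_snd).mul hFi
  have hmul2 : Measurable fun p : ℝ≥0 × PathSpace =>
      B.indicator (1 : (ℝ≥0 → KilledReal) → ℝ≥0∞) (stopProc s (lampertiPath α a p.2)) * c :=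
    (hind.comp measurable_snd).mul_const c
  refine (ae_restrict_iff' (measurableSet_Ici (a := s))).1 ?_
  refine ae_eq_of_forall_setLIntegral_eq_of_sigmaFinite (meas _ hmul1) (meas _ hmul2)
    fun T hT _ => ?_
  rw [Measure.restrict_restrict hT]
  set T' := T ∩ Set.Ici s with hT'
  have hT'm : MeasurableSet T' := hT.inter measurableSet_Ici
  have pull : ∀ G : ℝ≥0 × PathSpace → ℝ≥0∞, Measurable G →
      ∫⁻ t in T', ∫⁻ w in {w | lamperti α a t w ≠ cemetery}, G (t, w) ∂P ∂halfLebesgue =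
      ∫⁻ u, ∫⁻ w in {w | 0 < pssMp a u w}, T'.indicator 1 (clockNN α a u w) *
        G (clockNN α a u w, w) * clockRate α a u w ∂P ∂halfLebesgue := fun G hG => by
    have hi : Measurable fun p : ℝ≥0 × PathSpace => T'.indicator (1 : ℝ≥0 → ℝ≥0∞) p.1 * G p :=
      ((measurable_one.indicator hT'm).comp measurable_fst).mul hG
    rw [← lintegral_time_change hα (hP.ae_isDecreasingPath ha) hi, ← lintegral_indicator hT'm]
    refine lintegral_congr fun t => ?_
    by_cases ht : t ∈ T' <;> simp [ht]
  rw [pull _ hmul1, pull _ hmul2]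
  refine lintegral_congr fun u => ?_
  -- the past of the integrand only depends on the path stopped at `u`
  let Ψ : PathSpace → ℝ≥0∞ := fun v => T'.indicator 1 (clockNN α a u v) *
    B.indicator 1 (stopProc s (lampertiPath α a v)) * clockRate α a u v
  have hΨ : Measurable Ψ := (((measurable_one.indicator hT'm).comp
    (measurable_section (measurable_clockNN_uncurry α a) u)).mul hind).mul
    (measurable_section (measurable_clockRate_uncurry α a) u)
  have hfac : ∀ᵐ w ∂P, 0 < pssMp a u w → ∀ x : ℝ≥0∞,
      T'.indicator 1 (clockNN α a u w) * (B.indicator 1 (stopProc s (lampertiPath α a w)) * x) *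
        clockRate α a u w = Ψ (stopPath u w) * x := by
    filter_upwards [hP.ae_isDecreasingPath ha] with w hw hu x
    simp only [Ψ, clockNN_stopPath u hw, clockRate_stopPath]
    by_cases hT : clockNN α a u w ∈ T'
    · rw [stopProc_stopPath hα hw hu hT.2]; ring
    · simp [hT]
  have hpos := measurableSet_pssMp_pos a u
  have hΨF : Measurable fun p : PathSpace × PathSpace => Ψ p.1 * F (lampertiPath α a p.2) :=
    (hΨ.comp measurable_fst).mul (hFl.comp measurable_snd)
  calc _ = ∫⁻ w in {w | 0 < pssMp a u w}, Ψ (stopPath u w) *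
        F (lampertiPath α a (restartPath α a u w)) ∂P := by
        refine setLIntegral_congr_fun_ae hpos ?_
        filter_upwards [hfac, hP.ae_isDecreasingPath ha] with w h1 hw hu
        rw [h1 hu, incProc_clockNN hα ha hw hu]
    _ = ∫⁻ w in {w | 0 < pssMp a u w}, Ψ (stopPath u w) * c ∂P := by
        rw [hP.lintegral_restartPath ha u hΨF]
        simp only [c, lintegral_const_mul _ hFl]
    _ = _ := by
        refine setLIntegral_congr_fun_ae hpos ?_
        filter_upwards [hfac] with w h1 hu
        rw [h1 hu]

lemma tendsto_incProc {w : PathSpace} (hα : 0 < α) (ha : 0 < a)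
    (hw : IsDecreasingPath a fun t => pssMp a t w) {s : ℝ≥0} {v : ℕ → ℝ≥0}
    (hv : Tendsto v atTop (𝓝[≥] s)) (u : ℝ≥0) :
    Tendsto (fun n => incProc (v n) (lampertiPath α a w) u) atTop
      (𝓝 (incProc s (lampertiPath α a w) u)) := by
  have h1 : Tendsto (fun n => lamperti α a (v n) w) atTop (𝓝 (lamperti α a s w)) :=
    (lamperti_right_continuous hα ha hw s).tendsto.comp hv
  have h2 : Tendsto (fun n => lamperti α a (v n + u) w) atTop (𝓝 (lamperti α a (s + u) w)) := by
    refine (lamperti_right_continuous hα ha hw (s + u)).tendsto.comp ?_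
    refine tendsto_nhdsWithin_iff.2 ⟨?_, ?_⟩
    · exact ((continuous_add_const u).tendsto s).comp (hv.mono_right nhdsWithin_le_nhds)
    · filter_upwards [hv.eventually self_mem_nhdsWithin] with n hn
      simp only [Set.mem_Ici] at hn ⊢
      gcongr
  exact (continuous_sumMap_sub.tendsto _).comp
    (h2.prodMk_nhds ((continuous_valK.tendsto _).comp h1))

/-- The Lévy property of the Lamperti transform under the law of the stable subordinator: on survival
at `s`, the increments after `s` are independent of the past and distributed as the whole process. -/
theorem map_past_increments [IsProbabilityMeasure P] (hP : IsUnitStableSubordinator α P) (hα : 0 < α) (ha : 0 < a) (s : ℝ≥0) :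
    (P.restrict {w | lamperti α a s w ≠ cemetery}).map
        (fun w => (stopProc s (lampertiPath α a w), incProc s (lampertiPath α a w))) =
      ((P.restrict {w | lamperti α a s w ≠ cemetery}).map
        fun w => stopProc s (lampertiPath α a w)).prod (P.map (lampertiPath α a)) := by
  have hsp : Measurable fun w => stopProc s (lampertiPath α a w) :=
    (measurable_stopProc s).comp (measurable_lampertiPath α a)
  have hinc := measurable_incProc α a s
  have hlam := measurable_lampertiPath α a
  have halive := measurableSet_alive α a s
  symm
  refine Measure.prod_eq fun B C hB hC => ?_
  rw [Measure.map_apply (hsp.prodMk hinc) (hB.prod hC), Measure.map_apply hsp hB]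
  set ρ := (P.restrict {w | lamperti α a s w ≠ cemetery}).restrict
    ((fun w => stopProc s (lampertiPath α a w)) ⁻¹' B) with hρ
  suffices h : ρ.map (fun w => incProc s (lampertiPath α a w)) =
      (ρ Set.univ) • P.map (lampertiPath α a) by
    have h' := congrArg (fun m => m C) h
    simp only [Measure.map_apply hinc hC, Measure.smul_apply, smul_eq_mul] at h'
    rw [hρ, Measure.restrict_apply (hinc hC), Measure.restrict_apply_univ] at h'
    rw [← h', Set.inter_comm]
    rfl
  have hfin : IsFiniteMeasure ((ρ Set.univ) • P.map (lampertiPath α a)) := by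
    constructor
    rw [Measure.smul_apply, smul_eq_mul]
    exact ENNReal.mul_lt_top (measure_lt_top _ _) (measure_lt_top _ _)
  refine IsProjectiveLimit.unique (P := fun I => (ρ.map
    fun w => incProc s (lampertiPath α a w)).map I.restrict) (fun I => rfl) fun I => ?_
  symm
  refine ext_of_forall_lintegral_eq_of_IsFiniteMeasure fun f => ?_
  have hfm : Measurable fun x : ℝ≥0 → KilledReal => (f (I.restrict x) : ℝ≥0∞) :=
    measurable_coe_nnreal_ennreal.comp (f.continuous.measurable.comp (Finset.measurable_restrict I))
  have hfm' : Measurable fun x : I → KilledReal => (f x : ℝ≥0∞) :=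
    measurable_coe_nnreal_ennreal.comp f.continuous.measurable
  have hind : Measurable fun w => B.indicator (1 : (ℝ≥0 → KilledReal) → ℝ≥0∞) (stopProc s (lampertiPath α a w)) :=
    (measurable_one.indicator hB).comp hsp
  rw [lintegral_map hfm' (Finset.measurable_restrict I), lintegral_map hfm hinc,
    lintegral_map hfm' (Finset.measurable_restrict I), lintegral_smul_measure, lintegral_map hfm hlam]
  set c := ∫⁻ w, (f (I.restrict (lampertiPath α a w)) : ℝ≥0∞) ∂P with hc
  -- rewrite both sides as the value at `s` of the functions of `ae_levy`
  have hRint : ∀ g : PathSpace → ℝ≥0∞, ∫⁻ w, g w ∂ρ =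
      ∫⁻ w in {w | lamperti α a s w ≠ cemetery},
        B.indicator 1 (stopProc s (lampertiPath α a w)) * g w ∂P := fun g => by
    rw [hρ, ← lintegral_indicator (hsp hB)]
    refine lintegral_congr fun w => ?_
    by_cases h : stopProc s (lampertiPath α a w) ∈ B
    · rw [Set.indicator_of_mem (show w ∈ (fun w => stopProc s (lampertiPath α a w)) ⁻¹' B from h),
        Set.indicator_of_mem h, Pi.one_apply, one_mul]
    · rw [Set.indicator_of_notMem (show w ∉ (fun w => stopProc s (lampertiPath α a w)) ⁻¹' B from h),
        Set.indicator_of_notMem h, zero_mul]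
  have hR1 : ρ Set.univ = ∫⁻ w in {w | lamperti α a s w ≠ cemetery},
      B.indicator 1 (stopProc s (lampertiPath α a w)) ∂P := by
    rw [← lintegral_one, hRint]
    simp only [mul_one]
  rw [hRint, hR1, smul_eq_mul, ← lintegral_mul_const _ hind]
  obtain ⟨v, hv, hvlim⟩ := exists_seq_of_ae_ge (hP.ae_levy hα ha s hB hfm)
  have hlim : ∀ (g : ℝ≥0 → PathSpace → ℝ≥0), (∀ t, Measurable (g t)) → (∃ K, ∀ t w, g t w ≤ K) →
      (∀ᵐ w ∂P, Tendsto (fun n => g (v n) w) atTop (𝓝 (g s w))) →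
      Tendsto (fun n => ∫⁻ w in {w | lamperti α a (v n) w ≠ cemetery},
        B.indicator 1 (stopProc s (lampertiPath α a w)) * (g (v n) w : ℝ≥0∞) ∂P) atTop
        (𝓝 (∫⁻ w in {w | lamperti α a s w ≠ cemetery},
        B.indicator 1 (stopProc s (lampertiPath α a w)) * (g s w : ℝ≥0∞) ∂P)) := by
    intro g hg ⟨K, hK⟩ hglim
    simp only [← lintegral_indicator (measurableSet_alive α a _)]
    refine tendsto_lintegral_of_dominated_convergence (fun _ => (K : ℝ≥0∞)) (fun n => ?_) (fun n => ?_)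
      (by simp) ?_
    · exact (hind.mul (measurable_coe_nnreal_ennreal.comp (hg _))).indicator (measurableSet_alive α a _)
    · refine Eventually.of_forall fun w => ?_
      refine (Set.indicator_le_self _ _ w).trans ?_
      calc _ ≤ 1 * (K : ℝ≥0∞) := by
            gcongr
            · exact Set.indicator_le_self _ _ _
            · exact hK _ _
        _ = K := one_mul _
    · filter_upwards [hglim, hP.ae_isDecreasingPath ha] with w hgw hw
      have hgw' : Tendsto (fun n => (g (v n) w : ℝ≥0∞)) atTop (𝓝 (g s w)) :=
        ENNReal.tendsto_coe.2 hgw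
      have hb : B.indicator (1 : (ℝ≥0 → KilledReal) → ℝ≥0∞) (stopProc s (lampertiPath α a w)) ≠ ⊤ :=
        ne_top_of_le_ne_top ENNReal.one_ne_top (Set.indicator_le_self _ _ _)
      by_cases hs : lamperti α a s w = cemetery
      · have : ∀ n, lamperti α a (v n) w = cemetery := fun n => by
          by_contra h
          exact lamperti_ne_of_le hα hw (hv n).1 h hs
        simp [hs, this]
      · have hev : ∀ᶠ n in atTop, lamperti α a (v n) w ≠ cemetery :=
          ((lamperti_right_continuous hα ha hw s).tendsto.comp hvlim).eventually
            (isOpen_ne_cemetery.mem_nhds hs)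
        rw [Set.indicator_of_mem (show w ∈ {w | lamperti α a s w ≠ cemetery} from hs)]
        refine (ENNReal.Tendsto.const_mul hgw' (Or.inr hb)).congr' ?_
        filter_upwards [hev] with n hn
        rw [Set.indicator_of_mem (show w ∈ {w | lamperti α a (v n) w ≠ cemetery} from hn)]
  obtain ⟨K, hK⟩ : ∃ K : ℝ≥0, ∀ x, f x ≤ K := ⟨nndist f 0, fun x => by
    have := f.nndist_coe_le_nndist (g := 0) x
    simpa using this⟩
  have hcfin : c ≠ ⊤ := by
    refine ne_top_of_le_ne_top (b := (K : ℝ≥0∞)) ENNReal.coe_ne_top ?_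
    calc c ≤ ∫⁻ _, (K : ℝ≥0∞) ∂P := lintegral_mono fun w => ENNReal.coe_le_coe.2 (hK _)
      _ = K := by simp
  have lim1 := hlim (fun t w => f (I.restrict (incProc t (lampertiPath α a w))))
    (fun t => f.continuous.measurable.comp ((Finset.measurable_restrict I).comp
      (measurable_incProc α a t))) ⟨K, fun t w => hK _⟩ (by
      filter_upwards [hP.ae_isDecreasingPath ha] with w hw
      refine (f.continuous.tendsto _).comp (tendsto_pi_nhds.2 fun i => ?_)
      exact tendsto_incProc hα ha hw hvlim i)
  have lim2 := hlim (fun _ _ => c.toNNReal) (fun _ => measurable_const) ⟨_, fun _ _ => le_rfl⟩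
    (Eventually.of_forall fun _ => tendsto_const_nhds)
  rw [ENNReal.coe_toNNReal hcfin] at lim2
  exact tendsto_nhds_unique lim1 (lim2.congr fun n => ((hv n).2).symm)

end IsUnitStableSubordinator

/-! ### The renewal measure of the stable subordinator -/

/-- Two probability measures on the line with the same two-sided Laplace transform, finite near the
origin, coincide. -/
lemma ext_of_lintegral_exp {μ ν : Measure ℝ} [IsProbabilityMeasure μ] [IsProbabilityMeasure ν]
    (h : ∀ s : ℝ, ∫⁻ x, ENNReal.ofReal (Real.exp (s * x)) ∂μ =
      ∫⁻ x, ENNReal.ofReal (Real.exp (s * x)) ∂ν) {r : ℝ} (hr : 0 < r)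
    (hfin : ∀ s < r, ∫⁻ x, ENNReal.ofReal (Real.exp (s * x)) ∂μ ≠ ⊤) : μ = ν := by
  have hmgf : mgf id μ = mgf id ν := by
    funext s
    have key : ∀ ρ : Measure ℝ, mgf id ρ s = (∫⁻ x, ENNReal.ofReal (Real.exp (s * x)) ∂ρ).toReal :=
      fun ρ => integral_eq_lintegral_of_nonneg_ae (Eventually.of_forall fun _ => (Real.exp_pos _).le)
        (by fun_prop)
    rw [key, key, h]
  have h0 : (0 : ℝ) ∈ interior (integrableExpSet id μ) := by
    refine mem_interior.2 ⟨Set.Iio r, fun s hs => ?_, isOpen_Iio, hr⟩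
    refine ⟨by fun_prop, ?_⟩
    rw [hasFiniteIntegral_iff_ofReal (Eventually.of_forall fun _ => (Real.exp_pos _).le)]
    exact (hfin s hs).lt_top
  refine Measure.ext_of_charFun (funext fun t => ?_)
  rw [← complexMGF_id_mul_I, ← complexMGF_id_mul_I]
  exact eqOn_complexMGF_of_mgf hmgf (by simpa using h0)

lemma lintegral_exp_gammaMeasure {α s : ℝ} (hα : 0 < α) (hs : s < 1) :
    ∫⁻ x, ENNReal.ofReal (Real.exp (s * x)) ∂(gammaMeasure α 1) =
      ENNReal.ofReal ((1 - s) ^ (-α)) := by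
  have hs' : 0 < 1 - s := by linarith
  have hm : ∀ a r : ℝ, Measurable (gammaPDF a r) := fun a r => (measurable_gammaPDFReal a r).ennreal_ofReal
  rw [gammaMeasure, lintegral_withDensity_eq_lintegral_mul _ (hm _ _) (by fun_prop)]
  have h : ∀ x, (gammaPDF α 1 * fun x => ENNReal.ofReal (Real.exp (s * x))) x =
      ENNReal.ofReal ((1 - s) ^ (-α)) * gammaPDF α (1 - s) x := fun x => by
    rcases lt_or_ge x 0 with hx | hx
    · simp [gammaPDF_of_neg hx]
    · have := Real.Gamma_pos_of_pos hα
      rw [Pi.mul_apply, gammaPDF_of_nonneg hx, gammaPDF_of_nonneg hx,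
        ← ENNReal.ofReal_mul (by positivity), ← ENNReal.ofReal_mul (by positivity)]
      congr 1
      have e : Real.exp (-(1 * x)) * Real.exp (s * x) = Real.exp (-((1 - s) * x)) := by
        rw [← Real.exp_add]; ring_nf
      rw [Real.one_rpow, mul_assoc, e, Real.rpow_neg hs'.le]
      have : (1 - s) ^ α ≠ 0 := (Real.rpow_pos_of_pos hs' _).ne'
      field_simp
  rw [lintegral_congr h, lintegral_const_mul _ (hm _ _), lintegral_gammaPDF_eq_one hα hs', mul_one]

/-- The Laplace transform of a law with the transform of a Gamma law is infinite beyond the pole at `1`. -/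
lemma lintegral_exp_eq_top {μ : Measure ℝ} {α : ℝ} (hα : 0 < α) (hμ : ∀ᵐ x ∂μ, 0 ≤ x)
    (h : ∀ s < 1, ∫⁻ x, ENNReal.ofReal (Real.exp (s * x)) ∂μ = ENNReal.ofReal ((1 - s) ^ (-α)))
    {s : ℝ} (hs : 1 ≤ s) : ∫⁻ x, ENNReal.ofReal (Real.exp (s * x)) ∂μ = ⊤ := by
  have h1 : Tendsto (fun ε : ℝ => ENNReal.ofReal (ε ^ (-α))) (𝓝[>] 0) (𝓝 ⊤) :=
    ENNReal.tendsto_ofReal_atTop.comp (tendsto_rpow_neg_nhdsGT_zero (by linarith))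
  refine top_le_iff.1 (le_of_tendsto h1 ?_)
  filter_upwards [self_mem_nhdsWithin] with ε hε
  have := h (1 - ε) (by simpa using hε)
  rw [sub_sub_cancel] at this
  rw [← this]
  refine lintegral_mono_ae ?_
  filter_upwards [hμ] with x hx
  gcongr
  have : 0 < ε := hε
  linarith

lemma lintegral_exp_neg_halfLebesgue {c : ℝ} (hc : 0 < c) :
    ∫⁻ t : ℝ≥0, ENNReal.ofReal (Real.exp (-(t * c))) ∂halfLebesgue = ENNReal.ofReal c⁻¹ := by
  rw [lintegral_halfLebesgue (by fun_prop)]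
  have h : ∀ t ∈ Set.Ici (0 : ℝ), ENNReal.ofReal (Real.exp (-((t.toNNReal : ℝ) * c))) =
      ENNReal.ofReal c⁻¹ * exponentialPDF c t := fun t ht => by
    rw [Real.coe_toNNReal t ht, exponentialPDF_of_nonneg ht, ← ENNReal.ofReal_mul (by positivity)]
    congr 1
    rw [← mul_assoc, inv_mul_cancel₀ hc.ne', one_mul, mul_comm]
  rw [setLIntegral_congr_fun measurableSet_Ici h, lintegral_const_mul' _ _ ENNReal.ofReal_ne_top]
  have h2 : ∫⁻ x in Set.Ici (0 : ℝ), exponentialPDF c x = 1 := by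
    have h3 := lintegral_add_compl (μ := volume) (exponentialPDF c) (measurableSet_Ici (a := (0 : ℝ)))
    rw [Set.compl_Ici, setLIntegral_congr_fun (g := fun _ => 0) measurableSet_Iio
        (fun x (hx : x < 0) => exponentialPDF_of_neg hx), lintegral_exponentialPDF_eq_one hc] at h3
    simpa using h3
  rw [h2, mul_one]

namespace IsUnitStableSubordinator

variable {α a : ℝ} {P : Measure PathSpace}

/-- The Laplace transform at every time; away from time `1` it comes from the scaling of the process. -/
lemma lintegral_exp_neg [IsProbabilityMeasure P] (hP : IsUnitStableSubordinator α P) (hα : 0 < α)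
    (t : ℝ≥0) {lam : ℝ} (hl : 0 ≤ lam) :
    ∫⁻ w, ENNReal.ofReal (Real.exp (-lam * realCoord t w)) ∂P =
      ENNReal.ofReal (Real.exp (-(t * lam ^ α))) := by
  have hone : ∀ lam : ℝ, 0 ≤ lam → ∫⁻ w, ENNReal.ofReal (Real.exp (-lam * realCoord 1 w)) ∂P =
      ENNReal.ofReal (Real.exp (-lam ^ α)) := fun lam hl => by
    have hm : Measurable fun w => Real.exp (-lam * realCoord 1 w) :=
      ((measurable_realCoord 1).const_mul _).exp
    rw [← hP.laplace lam hl, ofReal_integral_eq_lintegral_ofReal]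
    · by_contra h
      have h1 := hP.laplace lam hl
      rw [integral_undef h] at h1
      exact (Real.exp_pos _).ne h1
    · exact Eventually.of_forall fun _ => (Real.exp_pos _).le
  rcases eq_or_lt_of_le (zero_le : 0 ≤ t) with rfl | ht
  · have : ∀ᵐ w ∂P, ENNReal.ofReal (Real.exp (-lam * realCoord 0 w)) = 1 := by
      filter_upwards [hP.subordinator.zero] with w hw
      simp [hw]
    rw [lintegral_congr_ae this]
    simp
  · set c : ℝ≥0 := t ^ (1 / α) with hc
    have hc0 : 0 < c := NNReal.rpow_pos ht
    have hct : c ^ (-α) * t = 1 := by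
      rw [hc, ← NNReal.rpow_mul, show 1 / α * -α = -1 by field_simp, NNReal.rpow_neg_one,
        inv_mul_cancel₀ ht.ne']
    have h := hP.scaling c hc0
    have hE : Measurable fun x : ℝ≥0 → ℝ => ENNReal.ofReal (Real.exp (-lam * x t)) :=
      ((measurable_pi_apply t).const_mul _).exp.ennreal_ofReal
    have h' := congrArg (fun m => ∫⁻ x, ENNReal.ofReal (Real.exp (-lam * x t)) ∂m) h
    rw [lintegral_map hE (measurable_pi_lambda _ fun t => (measurable_realCoord _).const_mul _),
      lintegral_map hE (measurable_pi_lambda _ measurable_realCoord)] at h'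
    beta_reduce at h'
    rw [hct] at h'
    rw [← h']
    have e := hone (lam * c) (by positivity)
    rw [Real.mul_rpow hl (NNReal.coe_nonneg c)] at e
    have : (c : ℝ) ^ α = t := by
      rw [← NNReal.coe_rpow, hc, ← NNReal.rpow_mul, one_div, inv_mul_cancel₀ hα.ne', NNReal.rpow_one]
    rw [this, mul_comm (lam ^ α)] at e
    rw [← e]
    refine lintegral_congr fun w => ?_
    ring_nf

lemma measurable_realCoord_uncurry : Measurable fun p : ℝ≥0 × PathSpace => realCoord p.1 p.2 :=
  measurable_valK.comp measurable_coord_uncurry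

/-- The potential measure of the stable subordinator has density `x^(α-1) / Γ(α)`: both sides have
Laplace transform `lam^(-α)`. -/
theorem lintegral_potential [IsProbabilityMeasure P] (hP : IsUnitStableSubordinator α P)
    (hα : 0 < α) {f : ℝ → ℝ≥0∞} (hf : Measurable f) :
    ∫⁻ t, ∫⁻ w, f (realCoord t w) ∂P ∂halfLebesgue =
      ∫⁻ x in Set.Ioi 0, f x * ENNReal.ofReal (x ^ (α - 1) / Real.Gamma α) := by
  have hX := measurable_realCoord_uncurry
  set V : Measure ℝ := (halfLebesgue.prod P).map fun p => realCoord p.1 p.2 with hV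
  have hVint : ∀ g : ℝ → ℝ≥0∞, Measurable g →
      ∫⁻ x, g x ∂V = ∫⁻ t, ∫⁻ w, g (realCoord t w) ∂P ∂halfLebesgue := fun g hg => by
    rw [hV, lintegral_map hg hX]
    exact lintegral_prod _ (hg.comp hX).aemeasurable
  have hEm : Measurable fun x : ℝ => ENNReal.ofReal (Real.exp (-x)) := by fun_prop
  set μ := V.withDensity fun x => ENNReal.ofReal (Real.exp (-x)) with hμ
  have hV0 : ∀ᵐ x ∂V, 0 ≤ x := by
    rw [hV, ae_map_iff hX.aemeasurable measurableSet_Ici]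
    refine (Measure.ae_prod_mem_iff_ae_ae_mem (hX measurableSet_Ici)).2 ?_
    refine Eventually.of_forall fun t => ?_
    filter_upwards [hP.subordinator.monotone, hP.subordinator.zero] with w h1 h2
    exact h2 ▸ h1 (zero_le : 0 ≤ t)
  have hμ0 : ∀ᵐ x ∂μ, 0 ≤ x := (withDensity_absolutelyContinuous _ _).ae_le hV0
  have hμexp : ∀ s < 1, ∫⁻ x, ENNReal.ofReal (Real.exp (s * x)) ∂μ =
      ENNReal.ofReal ((1 - s) ^ (-α)) := fun s hs => by
    rw [hμ, lintegral_withDensity_eq_lintegral_mul _ hEm (by fun_prop)]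
    have e : ∀ x : ℝ, ((fun x : ℝ => ENNReal.ofReal (Real.exp (-x))) *
        fun x => ENNReal.ofReal (Real.exp (s * x))) x = ENNReal.ofReal (Real.exp (-(1 - s) * x)) :=
      fun x => by
        rw [Pi.mul_apply, ← ENNReal.ofReal_mul (Real.exp_pos _).le, ← Real.exp_add]; ring_nf
    rw [lintegral_congr e, hVint _ (by fun_prop)]
    simp only [hP.lintegral_exp_neg hα _ (sub_nonneg.2 hs.le)]
    rw [lintegral_exp_neg_halfLebesgue (Real.rpow_pos_of_pos (sub_pos.2 hs) _),
      Real.rpow_neg (sub_nonneg.2 hs.le)]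
  have hμp : IsProbabilityMeasure μ := ⟨by simpa using hμexp 0 zero_lt_one⟩
  have hγp := isProbabilityMeasure_gammaMeasure hα one_pos
  have hγ0 : ∀ᵐ x ∂(gammaMeasure α 1), 0 ≤ x := by
    rw [gammaMeasure, ae_withDensity_iff (show Measurable (gammaPDF α 1) from
      (measurable_gammaPDFReal _ _).ennreal_ofReal)]
    refine Eventually.of_forall fun x hx => ?_
    by_contra! h
    exact hx (gammaPDF_of_neg h)
  have hμγ : μ = gammaMeasure α 1 := by
    refine ext_of_lintegral_exp (fun s => ?_) one_pos fun s hs => by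
      rw [hμexp s hs]; exact ENNReal.ofReal_ne_top
    rcases lt_or_ge s 1 with hs | hs
    · rw [hμexp s hs, lintegral_exp_gammaMeasure hα hs]
    · rw [lintegral_exp_eq_top hα hμ0 hμexp hs,
        lintegral_exp_eq_top hα hγ0 (fun _ => lintegral_exp_gammaMeasure hα) hs]
  have hm : Measurable fun x => f x * ENNReal.ofReal (Real.exp x) := hf.mul (by fun_prop)
  have h1 := congrArg (fun m => ∫⁻ x, f x * ENNReal.ofReal (Real.exp x) ∂m) hμγ
  rw [hμ, lintegral_withDensity_eq_lintegral_mul _ hEm hm, gammaMeasure,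
    lintegral_withDensity_eq_lintegral_mul _ (show Measurable (gammaPDF α 1) from
      (measurable_gammaPDFReal _ _).ennreal_ofReal) hm] at h1
  rw [← hVint f hf]
  calc _ = _ := lintegral_congr fun x => by
        rw [Pi.mul_apply, mul_left_comm, ← ENNReal.ofReal_mul (Real.exp_pos _).le, ← Real.exp_add]
        simp
    _ = _ := h1
    _ = _ := by
      rw [← lintegral_add_compl _ (measurableSet_Ioi (a := (0 : ℝ))), Set.compl_Ioi]
      have h0 : ∫⁻ x in Set.Iic 0, (gammaPDF α 1 * fun x => f x * ENNReal.ofReal (Real.exp x)) x = 0 := by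
        rw [← setLIntegral_congr Iio_ae_eq_Iic]
        exact setLIntegral_eq_zero measurableSet_Iio fun x (hx : x < 0) => by
          simp [gammaPDF_of_neg hx]
      rw [h0, add_zero]
      refine setLIntegral_congr_fun measurableSet_Ioi fun x (hx : 0 < x) => ?_
      have := Real.Gamma_pos_of_pos hα
      rw [Pi.mul_apply, gammaPDF_of_nonneg hx.le, mul_left_comm, ← ENNReal.ofReal_mul (by positivity)]
      congr 2
      rw [Real.one_rpow, mul_assoc, ← Real.exp_add]
      simp [div_eq_mul_inv, mul_comm]

lemma setLIntegral_rpow {α x y : ℝ} (hα : 0 < α) (hx : 0 ≤ x) (hxy : x ≤ y) :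
    ENNReal.ofReal (x ^ α / Real.Gamma (1 + α)) +
      ∫⁻ z in Set.Ioc x y, ENNReal.ofReal (z ^ (α - 1) / Real.Gamma α) =
      ENNReal.ofReal (y ^ α / Real.Gamma (1 + α)) := by
  have hG := Real.Gamma_pos_of_pos hα
  have hG' : Real.Gamma (1 + α) = α * Real.Gamma α := by rw [add_comm, Real.Gamma_add_one hα.ne']
  have hint : IntervalIntegrable (fun z : ℝ => z ^ (α - 1) / Real.Gamma α) volume x y :=
    (intervalIntegral.intervalIntegrable_rpow' (by linarith)).div_const _
  have hle : x ^ α ≤ y ^ α := Real.rpow_le_rpow hx hxy hα.le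
  rw [← ofReal_integral_eq_lintegral_ofReal ((intervalIntegrable_iff_integrableOn_Ioc_of_le hxy).1 hint)
    ((ae_restrict_iff' measurableSet_Ioc).2 (Eventually.of_forall fun z hz => by
      have : 0 ≤ z := hx.trans hz.1.le
      positivity)), ← intervalIntegral.integral_of_le hxy, intervalIntegral.integral_div,
    integral_rpow (Or.inl (by linarith)), sub_add_cancel,
    ← ENNReal.ofReal_add (by rw [hG']; positivity)
      (div_nonneg (div_nonneg (by linarith) hα.le) hG.le), hG']
  congr 1
  field_simp
  ring

/-- The renewal function `U` of the stable subordinator is a multiple of `x^α`. -/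
lemma renewal_eq [IsProbabilityMeasure P] (hP : IsUnitStableSubordinator α P) (hα : 0 < α) {x : ℝ}
    (hx : 0 ≤ x) : renewal P x = ENNReal.ofReal (x ^ α / Real.Gamma (1 + α)) := by
  have hs : ∀ t, {w | ∃ y ≤ x, coord t w = Sum.inl y} =ᵐ[P] {w | realCoord t w ≤ x} := fun t => by
    filter_upwards [hP.ae_coord_ne] with w hw
    apply propext
    constructor
    · rintro ⟨y, hy, h⟩
      change realCoord t w ≤ x
      rwa [realCoord_eq, h]
    · intro h
      exact ⟨_, h, eq_inl_valK (hw t)⟩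
  have hm : Measurable ((Set.Iic x).indicator (1 : ℝ → ℝ≥0∞)) := measurable_one.indicator measurableSet_Iic
  have h1 : ∀ t, P {w | ∃ y ≤ x, coord t w = Sum.inl y} =
      ∫⁻ w, (Set.Iic x).indicator 1 (realCoord t w) ∂P := fun t => by
    rw [measure_congr (hs t)]
    exact (lintegral_indicator_one (measurable_realCoord t measurableSet_Iic)).symm
  have hm2 : Measurable fun t : ℝ≥0 => ∫⁻ w, (Set.Iic x).indicator 1 (realCoord t w) ∂P :=
    (hm.comp measurable_realCoord_uncurry).lintegral_prod_right'
  rw [renewal]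
  simp only [h1]
  rw [← lintegral_halfLebesgue hm2, hP.lintegral_potential hα hm]
  have h2 := setLIntegral_rpow hα le_rfl hx
  rw [Real.zero_rpow hα.ne', zero_div, ENNReal.ofReal_zero, zero_add] at h2
  rw [← h2, ← Set.Ioi_inter_Iic, Set.inter_comm, ← Measure.restrict_restrict measurableSet_Iic,
    ← lintegral_indicator measurableSet_Iic]
  refine lintegral_congr fun z => ?_
  by_cases hz : z ∈ Set.Iic x <;> simp [hz]

/-- The continuous density `x^(α-1) / Γ(α)` of the renewal measure. -/
noncomputable def renewalDensity (α x : ℝ) : ℝ≥0 := Real.toNNReal (x ^ (α - 1) / Real.Gamma α)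

lemma isRenewalDensity [IsProbabilityMeasure P] (hP : IsUnitStableSubordinator α P) (hα : 0 < α) :
    IsRenewalDensity P (renewalDensity α) := by
  refine ⟨?_, fun x y hx hxy => ?_⟩
  · exact continuous_real_toNNReal.comp_continuousOn
      ((ContinuousOn.rpow_const continuousOn_id fun x hx => Or.inl (ne_of_gt hx)).div_const _)
  · rw [hP.renewal_eq hα (hx.le.trans hxy), hP.renewal_eq hα hx.le, ← setLIntegral_rpow hα hx.le hxy]
    rfl

/-- Any continuous density of the renewal measure is the explicit one, at every point: it is the derivative
of `U`. -/
lemma renewalDensity_unique [IsProbabilityMeasure P] (hP : IsUnitStableSubordinator α P) (hα : 0 < α)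
    {u : ℝ → ℝ≥0} (hu : IsRenewalDensity P u) {x : ℝ} (hx : 0 < x) : u x = renewalDensity α x := by
  have hv := hP.isRenewalDensity hα
  have hfin : ∀ y, 0 ≤ y → renewal P y ≠ ⊤ := fun y hy => by
    rw [hP.renewal_eq hα hy]; exact ENNReal.ofReal_ne_top
  have hint : ∀ y z : ℝ, 0 < y → y ≤ z → ∫⁻ r in Set.Ioc y z, (u r : ℝ≥0∞) =
      ∫⁻ r in Set.Ioc y z, (renewalDensity α r : ℝ≥0∞) := fun y z hy hyz => by
    have h := (hu.2 y z hy hyz).symm.trans (hv.2 y z hy hyz)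
    exact (ENNReal.add_right_inj (hfin y hy.le)).1 h
  have hx2 : 0 < x / 2 := by linarith
  have hderiv : ∀ {v : ℝ → ℝ≥0}, ContinuousOn v (Set.Ioi 0) →
      HasDerivAt (fun y => ∫ r in (x / 2)..y, (v r : ℝ)) (v x) x := fun {v} hv => by
    have hc : ContinuousOn (fun r => (v r : ℝ)) (Set.Ioi 0) := continuous_subtype_val.comp_continuousOn hv
    refine intervalIntegral.integral_hasDerivAt_right ?_
      (hc.stronglyMeasurableAtFilter isOpen_Ioi x hx) (hc.continuousAt (Ioi_mem_nhds hx))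
    refine (hc.mono fun z hz => ?_).intervalIntegrable
    rw [Set.uIcc_of_le (by linarith)] at hz
    exact hx2.trans_le hz.1
  have htoReal : ∀ {v : ℝ → ℝ≥0}, ContinuousOn v (Set.Ioi 0) → ∀ y, x / 2 < y →
      ∫ r in (x / 2)..y, (v r : ℝ) = (∫⁻ r in Set.Ioc (x / 2) y, (v r : ℝ≥0∞)).toReal := fun {v} hv y hy => by
    have hc : ContinuousOn (fun r => (v r : ℝ)) (Set.Ioi 0) := continuous_subtype_val.comp_continuousOn hv
    rw [intervalIntegral.integral_of_le hy.le, integral_eq_lintegral_of_nonneg_ae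
      (Eventually.of_forall fun r => NNReal.coe_nonneg (v r))]
    · simp
    · exact (hc.mono fun z hz => hx2.trans hz.1).aestronglyMeasurable measurableSet_Ioc
  have heq : (fun y => ∫ r in (x / 2)..y, (u r : ℝ)) =ᶠ[𝓝 x]
      fun y => ∫ r in (x / 2)..y, (renewalDensity α r : ℝ) := by
    filter_upwards [Ioi_mem_nhds (show x / 2 < x by linarith)] with y hy
    rw [htoReal hu.1 y hy, htoReal hv.1 y hy, hint _ _ hx2 (le_of_lt hy)]
  exact NNReal.coe_injective (((hderiv hv.1).congr_of_eventuallyEq heq).unique (hderiv hu.1)).symm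

end IsUnitStableSubordinator

/-! ### The exponential moments of the Lamperti transform -/

/-- A multiplicative measurable function on the half-line with finite nonzero integral is an
exponential: it is the normalised tail of its own integral, hence solves `f' = -f / c`. -/
lemma eq_exp_of_multiplicative {f : ℝ≥0 → ℝ≥0∞} (hf : Measurable f)
    (hmul : ∀ s t, f (s + t) = f s * f t) {c : ℝ} (hc : 0 < c)
    (hint : ∫⁻ t, f t ∂halfLebesgue = ENNReal.ofReal c) (t : ℝ≥0) :
    f t = ENNReal.ofReal (Real.exp (-(t / c))) := by
  have hc' : ENNReal.ofReal c ≠ 0 := by simpa using hc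
  have htail : ∀ t, ∫⁻ u in Set.Ici t, f u ∂halfLebesgue = f t * ENNReal.ofReal c := fun t => by
    rw [setLIntegral_halfLebesgue_Ici hf t 1 one_ne_zero, ← hint, ← lintegral_const_mul _ hf]
    simp [hmul]
  -- the tail `f t * c` of the integral is at most the whole integral `c`
  have hle : ∀ t, f t ≤ 1 := fun t => by
    have h : f t * ENNReal.ofReal c ≤ 1 * ENNReal.ofReal c := by
      rw [← htail, one_mul, ← hint]
      exact setLIntegral_le_lintegral _ _
    exact (ENNReal.mul_le_mul_iff_left hc' ENNReal.ofReal_ne_top).1 h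
  let g : ℝ → ℝ := fun x => (f x.toNNReal).toReal
  have hg0 : ∀ x, 0 ≤ g x := fun x => ENNReal.toReal_nonneg
  have hg1 : ∀ x, g x ≤ 1 := fun x => ENNReal.toReal_le_of_le_ofReal zero_le_one (by simpa using hle _)
  have hgm : Measurable g := (hf.comp measurable_real_toNNReal).ennreal_toReal
  have hgi : ∀ x y, IntervalIntegrable g volume x y := fun x y => by
    refine (intervalIntegrable_const (c := (1 : ℝ))).mono_fun hgm.aestronglyMeasurable ?_
    refine Eventually.of_forall fun x => ?_
    simpa [abs_of_nonneg (hg0 x)] using hg1 x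
  have hgp : ∀ x, 0 ≤ x → g x = 1 - c⁻¹ * ∫ r in (0 : ℝ)..x, g r := fun x hx => by
    have h1 : ∫⁻ u in Set.Iic x.toNNReal, f u ∂halfLebesgue = ENNReal.ofReal (∫ r in (0 : ℝ)..x, g r) := by
      rw [setLIntegral_halfLebesgue_Iic hf, Real.coe_toNNReal _ hx, ← restrict_Ioc_eq_restrict_Icc,
        intervalIntegral.integral_of_le hx, ofReal_integral_eq_lintegral_ofReal
          ((intervalIntegrable_iff_integrableOn_Ioc_of_le hx).1 (hgi _ _))
          (Eventually.of_forall hg0)]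
      refine lintegral_congr fun r => ?_
      exact (ENNReal.ofReal_toReal (ne_top_of_le_ne_top ENNReal.one_ne_top (hle _))).symm
    have h2 : ∫⁻ u in Set.Iic x.toNNReal, f u ∂halfLebesgue +
        ∫⁻ u in Set.Ici x.toNNReal, f u ∂halfLebesgue = ENNReal.ofReal c := by
      have h := lintegral_add_compl (μ := halfLebesgue) f (measurableSet_Iic (a := x.toNNReal))
      rwa [Set.compl_Iic, setLIntegral_congr Ioi_ae_eq_Ici, hint] at h
    have hi0 : 0 ≤ ∫ r in (0 : ℝ)..x, g r := intervalIntegral.integral_nonneg hx fun _ _ => hg0 _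
    rw [h1, htail, ← ENNReal.ofReal_toReal (ne_top_of_le_ne_top ENNReal.one_ne_top (hle x.toNNReal)),
      ← ENNReal.ofReal_mul ENNReal.toReal_nonneg, ← ENNReal.ofReal_add hi0
        (mul_nonneg ENNReal.toReal_nonneg hc.le)] at h2
    have h3 := (ENNReal.ofReal_eq_ofReal_iff (add_nonneg hi0
        (mul_nonneg ENNReal.toReal_nonneg hc.le)) hc.le).1 h2
    change _ + g x * c = c at h3
    field_simp
    linarith
  set p : ℝ → ℝ := fun x => 1 - c⁻¹ * ∫ r in (0 : ℝ)..x, g r with hp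
  have hpc : Continuous p :=
    continuous_const.sub (continuous_const.mul (intervalIntegral.continuous_primitive hgi 0))
  have hgc : ∀ x, 0 ≤ x → ContinuousWithinAt g (Set.Ici x) x := fun x hx =>
    (hpc.continuousWithinAt).congr (fun y hy => hgp y (hx.trans hy)) (hgp x hx)
  have hpd : ∀ x, 0 ≤ x → HasDerivWithinAt p (-(c⁻¹ * p x)) (Set.Ici x) x := fun x hx => by
    have h := intervalIntegral.integral_hasDerivWithinAt_right (hgi 0 x) (s := Set.Ici x) (t := Set.Ioi x)
      hgm.stronglyMeasurable.stronglyMeasurableAtFilter ((hgc x hx).mono Set.Ioi_subset_Ici_self)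
    have h' := (h.const_mul c⁻¹).const_sub 1
    rwa [hgp x hx] at h'
  -- right derivatives are enough, and they also make sense at the end point `0`
  have hq := constant_of_has_deriv_right_zero (f := fun x => p x * Real.exp (x * c⁻¹)) (a := 0) (b := t)
    (hpc.mul (by fun_prop)).continuousOn (fun x hx => by
      have he : HasDerivWithinAt (fun x => Real.exp (x * c⁻¹)) (Real.exp (x * c⁻¹) * (1 * c⁻¹)) (Set.Ici x) x :=
        (((hasDerivAt_id x).mul_const c⁻¹).exp).hasDerivWithinAt
      have h := (hpd x hx.1).mul he
      rwa [show -(c⁻¹ * p x) * Real.exp (x * c⁻¹) + p x * (Real.exp (x * c⁻¹) * (1 * c⁻¹)) = 0 by ring] at h) t ⟨t.2, le_rfl⟩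
  have hgt : g t = Real.exp (-(t / c)) := by
    rw [hgp t t.2]
    change p t = _
    have : p 0 = 1 := by simp [hp]
    simp only [this, zero_mul, Real.exp_zero, mul_one] at hq
    rw [Real.exp_neg, eq_inv_of_mul_eq_one_left hq, div_eq_mul_inv]
  rw [← hgt]
  simp only [g, Real.toNNReal_coe]
  exact (ENNReal.ofReal_toReal (ne_top_of_le_ne_top ENNReal.one_ne_top (hle _))).symm

/-- The exponential moment `E[exp (lam * ξ_t)]` of the Lamperti transform. -/
noncomputable def expMoment (α a : ℝ) (P : Measure PathSpace) (lam : ℝ) (t : ℝ≥0) : ℝ≥0∞ :=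
  ∫⁻ w, ENNReal.ofReal (killedExp lam (lamperti α a t w)) ∂P

/-- The Laplace exponent `Γ(1 + lam) / Γ(1 + lam - α)` of the Lamperti transform of the stable
subordinator. At `lam = α - 1` the denominator is a pole of `Γ`, and Mathlib's value `Γ(0) = 0` gives
`stableExponent α (α - 1) = 0`, which is also the limit from the right. -/
noncomputable def stableExponent (α lam : ℝ) : ℝ := Real.Gamma (1 + lam) / Real.Gamma (1 + lam - α)

lemma stableExponent_pos {α lam : ℝ} (hα : 0 < α) (hl : α - 1 < lam) : 0 < stableExponent α lam :=
  div_pos (Real.Gamma_pos_of_pos (by linarith)) (Real.Gamma_pos_of_pos (by linarith))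

lemma stableExponent_sub_one (α : ℝ) : stableExponent α (α - 1) = 0 := by
  simp [stableExponent, Real.Gamma_zero]

lemma measurable_killedExp_lamperti_uncurry (α a lam : ℝ) : Measurable fun p : ℝ≥0 × PathSpace =>
    ENNReal.ofReal (killedExp lam (lamperti α a p.1 p.2)) :=
  ((measurable_killedExp lam).comp (measurable_lamperti_uncurry α a)).ennreal_ofReal

lemma measurable_killedExp_lamperti (α a lam : ℝ) (t : ℝ≥0) : Measurable fun w =>
    ENNReal.ofReal (killedExp lam (lamperti α a t w)) :=
  measurable_section (Z := fun t w => ENNReal.ofReal (killedExp lam (lamperti α a t w)))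
    (measurable_killedExp_lamperti_uncurry α a lam) t

lemma measurable_expMoment (α a : ℝ) (P : Measure PathSpace) [SFinite P] (lam : ℝ) :
    Measurable (expMoment α a P lam) :=
  (measurable_killedExp_lamperti_uncurry α a lam).lintegral_prod_right'

lemma killedExp_lamperti_add {α a : ℝ} (hα : 0 < α) {w : PathSpace}
    (hw : IsDecreasingPath a fun t => pssMp a t w) (lam : ℝ) (s t : ℝ≥0) :
    killedExp lam (lamperti α a (s + t) w) =
      killedExp lam (lamperti α a s w) * killedExp lam (incProc s (lampertiPath α a w) t) := by
  have hinc : incProc s (lampertiPath α a w) t =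
    Sum.map (· - valK (lamperti α a s w)) id (lamperti α a (s + t) w) := rfl
  rw [hinc]
  by_cases hs : lamperti α a s w = cemetery
  · have : lamperti α a (s + t) w = cemetery := by
      by_contra h
      exact lamperti_ne_of_le hα hw le_self_add h hs
    rw [hs, this, killedExp_cemetery, zero_mul]
  · by_cases ht : lamperti α a (s + t) w = cemetery
    · rw [ht]
      change 0 = _ * 0
      rw [mul_zero]
    · rw [eq_inl_valK hs, eq_inl_valK ht, Sum.map_inl, killedExp_inl, killedExp_inl, killedExp_inl,
        ← Real.exp_add]
      simp only [valK_inl]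
      ring_nf

namespace IsUnitStableSubordinator

variable {α a : ℝ} {P : Measure PathSpace} [IsProbabilityMeasure P]

/-- The Lévy property of the Lamperti transform, for functionals of the past and of the increments. -/
lemma lintegral_past_increments (hP : IsUnitStableSubordinator α P) (hα : 0 < α) (ha : 0 < a) (s : ℝ≥0)
    {G : (ℝ≥0 → KilledReal) × (ℝ≥0 → KilledReal) → ℝ≥0∞} (hG : Measurable G) :
    ∫⁻ w in {w | lamperti α a s w ≠ cemetery},
        G (stopProc s (lampertiPath α a w), incProc s (lampertiPath α a w)) ∂P =
      ∫⁻ w in {w | lamperti α a s w ≠ cemetery},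
        ∫⁻ w', G (stopProc s (lampertiPath α a w), lampertiPath α a w') ∂P ∂P := by
  have hsp : Measurable fun w => stopProc s (lampertiPath α a w) :=
    (measurable_stopProc s).comp (measurable_lampertiPath α a)
  have h := congrArg (fun m => ∫⁻ x, G x ∂m) (hP.map_past_increments hα ha s)
  beta_reduce at h
  rw [lintegral_map hG (hsp.prodMk (measurable_incProc α a s)), lintegral_prod _ hG.aemeasurable,
    lintegral_map hG.lintegral_prod_right' hsp] at h
  rw [h]
  refine lintegral_congr fun w => ?_
  exact lintegral_map (hG.comp measurable_prodMk_left) (measurable_lampertiPath α a)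

lemma setLIntegral_alive (P : Measure PathSpace) (lam : ℝ) (s : ℝ≥0) (F : PathSpace → ℝ≥0∞) :
    ∫⁻ w in {w | lamperti α a s w ≠ cemetery},
      F w * ENNReal.ofReal (killedExp lam (lamperti α a s w)) ∂P =
    ∫⁻ w, F w * ENNReal.ofReal (killedExp lam (lamperti α a s w)) ∂P := by
  rw [← lintegral_indicator (measurableSet_alive α a s)]
  refine lintegral_congr fun w => ?_
  by_cases h : lamperti α a s w = cemetery
  · rw [Set.indicator_of_notMem (show w ∉ {w | lamperti α a s w ≠ cemetery} from fun h' => h' h), h,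
      killedExp_cemetery]
    simp
  · rw [Set.indicator_of_mem (show w ∈ {w | lamperti α a s w ≠ cemetery} from h)]

/-- The Lévy property for the exponential functionals. -/
lemma lintegral_killedExp_mul (hP : IsUnitStableSubordinator α P) (hα : 0 < α) (ha : 0 < a) (lam : ℝ)
    (s : ℝ≥0) {G : (ℝ≥0 → KilledReal) × (ℝ≥0 → KilledReal) → ℝ≥0∞} (hG : Measurable G) :
    ∫⁻ w, G (stopProc s (lampertiPath α a w), incProc s (lampertiPath α a w)) *
        ENNReal.ofReal (killedExp lam (lamperti α a s w)) ∂P =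
      ∫⁻ w, (∫⁻ w', G (stopProc s (lampertiPath α a w), lampertiPath α a w') ∂P) *
        ENNReal.ofReal (killedExp lam (lamperti α a s w)) ∂P := by
  rw [← setLIntegral_alive P lam s fun w => G (stopProc s (lampertiPath α a w), incProc s (lampertiPath α a w)),
    ← setLIntegral_alive P lam s fun w => ∫⁻ w', G (stopProc s (lampertiPath α a w), lampertiPath α a w') ∂P]
  have hm : Measurable fun p : (ℝ≥0 → KilledReal) × (ℝ≥0 → KilledReal) =>
      G p * ENNReal.ofReal (killedExp lam (p.1 s)) :=
    hG.mul ((measurable_killedExp lam).comp ((measurable_pi_apply s).comp measurable_fst)).ennreal_ofReal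
  have h := hP.lintegral_past_increments hα ha s hm
  have e : ∀ w, stopProc s (lampertiPath α a w) s = lamperti α a s w := fun w => by
    simp only [stopProc, min_self]; rfl
  simp only [e] at h
  rw [h]
  refine lintegral_congr fun w => ?_
  exact lintegral_mul_const _ (hG.comp (measurable_prodMk_left.comp (measurable_lampertiPath α a)))

lemma lintegral_killedExp_add (hP : IsUnitStableSubordinator α P) (hα : 0 < α) (ha : 0 < a) (lam : ℝ)
    (s t : ℝ≥0) {B : Set (ℝ≥0 → KilledReal)} (hB : MeasurableSet B) :
    ∫⁻ w in {w | stopProc s (lampertiPath α a w) ∈ B},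
        ENNReal.ofReal (killedExp lam (lamperti α a (s + t) w)) ∂P =
      expMoment α a P lam t * ∫⁻ w in {w | stopProc s (lampertiPath α a w) ∈ B},
        ENNReal.ofReal (killedExp lam (lamperti α a s w)) ∂P := by
  have hsp : Measurable fun w => stopProc s (lampertiPath α a w) :=
    (measurable_stopProc s).comp (measurable_lampertiPath α a)
  have hBm : MeasurableSet {w | stopProc s (lampertiPath α a w) ∈ B} := hsp hB
  have hG : Measurable fun p : (ℝ≥0 → KilledReal) × (ℝ≥0 → KilledReal) =>
      B.indicator 1 p.1 * ENNReal.ofReal (killedExp lam (p.2 t)) :=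
    ((measurable_one.indicator hB).comp measurable_fst).mul
      ((measurable_killedExp lam).comp ((measurable_pi_apply t).comp measurable_snd)).ennreal_ofReal
  have h := hP.lintegral_killedExp_mul hα ha lam s hG
  have hk : ∀ g : PathSpace → ℝ≥0∞, ∫⁻ w in {w | stopProc s (lampertiPath α a w) ∈ B}, g w ∂P =
      ∫⁻ w, B.indicator 1 (stopProc s (lampertiPath α a w)) * g w ∂P := fun g => by
    rw [← lintegral_indicator hBm]
    refine lintegral_congr fun w => ?_
    by_cases h : stopProc s (lampertiPath α a w) ∈ B
    · rw [Set.indicator_of_mem (show w ∈ {w | stopProc s (lampertiPath α a w) ∈ B} from h),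
        Set.indicator_of_mem h, Pi.one_apply, one_mul]
    · rw [Set.indicator_of_notMem (show w ∉ {w | stopProc s (lampertiPath α a w) ∈ B} from h),
        Set.indicator_of_notMem h, zero_mul]
  have hkm := measurable_killedExp_lamperti α a lam
  have hm : Measurable fun w => B.indicator 1 (stopProc s (lampertiPath α a w)) *
      ENNReal.ofReal (killedExp lam (lamperti α a s w)) :=
    ((measurable_one.indicator hB).comp hsp).mul (hkm s)
  rw [hk, hk, ← lintegral_const_mul _ hm]
  calc _ = _ := by
        refine lintegral_congr_ae ?_
        filter_upwards [hP.ae_isDecreasingPath ha] with w hw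
        rw [killedExp_lamperti_add hα hw, mul_comm (killedExp lam (lamperti α a s w)),
          ENNReal.ofReal_mul (killedExp_nonneg _ _), ← mul_assoc]
    _ = _ := h
    _ = _ := by
        refine lintegral_congr fun w => ?_
        have e : ∫⁻ w', B.indicator 1 (stopProc s (lampertiPath α a w)) *
            ENNReal.ofReal (killedExp lam (lampertiPath α a w' t)) ∂P =
            B.indicator 1 (stopProc s (lampertiPath α a w)) * expMoment α a P lam t :=
          lintegral_const_mul _ (hkm t)
        calc _ = B.indicator 1 (stopProc s (lampertiPath α a w)) * expMoment α a P lam t *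
              ENNReal.ofReal (killedExp lam (lamperti α a s w)) :=
              congrArg (· * ENNReal.ofReal (killedExp lam (lamperti α a s w))) e
          _ = _ := by ring

/-- The exponential moments are multiplicative in time. -/
lemma expMoment_add (hP : IsUnitStableSubordinator α P) (hα : 0 < α) (ha : 0 < a) (lam : ℝ) (s t : ℝ≥0) :
    expMoment α a P lam (s + t) = expMoment α a P lam s * expMoment α a P lam t := by
  have h := hP.lintegral_killedExp_add hα ha lam s t MeasurableSet.univ
  simp only [Set.mem_univ, Set.ofPred_true, Measure.restrict_univ] at h
  rw [mul_comm]
  exact h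

/-- The Beta integral behind the Laplace exponent. -/
lemma lintegral_beta {α a lam : ℝ} (hα : 0 < α) (ha : 0 < a) (hl : α - 1 < lam) :
    ∫⁻ x in Set.Ioi 0, (if x < a then ENNReal.ofReal (((a - x) / a) ^ lam * (a - x) ^ (-α)) else 0) *
      ENNReal.ofReal (x ^ (α - 1) / Real.Gamma α) = ENNReal.ofReal (stableExponent α lam)⁻¹ := by
  have hlam : 0 < 1 + lam - α := by linarith
  have hG := Real.Gamma_pos_of_pos hα
  have hG1 := Real.Gamma_pos_of_pos hlam
  have hG2 := Real.Gamma_pos_of_pos (show 0 < 1 + lam by linarith)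
  set g : ℝ → ℝ≥0∞ := fun x => (if x < a then ENNReal.ofReal (((a - x) / a) ^ lam * (a - x) ^ (-α)) else 0) *
      ENNReal.ofReal (x ^ (α - 1) / Real.Gamma α) with hg
  have hgm : Measurable g := by
    refine Measurable.mul (Measurable.ite measurableSet_Iio ?_ measurable_const) ?_ <;> fun_prop
  have h1 : ∫⁻ x in Set.Ioi 0, g x = ∫⁻ u : ℝ≥0, g u ∂halfLebesgue := by
    rw [lintegral_halfLebesgue (f := fun u : ℝ≥0 => g u) (hgm.comp measurable_coe_nnreal_real),
      setLIntegral_congr Ioi_ae_eq_Ici.symm]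
    refine setLIntegral_congr_fun measurableSet_Ioi fun x hx => ?_
    rw [Real.coe_toNNReal _ (le_of_lt hx)]
  have h2 := setLIntegral_halfLebesgue_Ici (hgm.comp measurable_coe_nnreal_real) 0 a.toNNReal
    (by simpa using ha)
  rw [show Set.Ici (0 : ℝ≥0) = Set.univ from Set.eq_univ_of_forall fun x => (zero_le : 0 ≤ x), Measure.restrict_univ] at h2
  simp only [Function.comp_apply, zero_add, NNReal.coe_mul, Real.coe_toNNReal a ha.le] at h2
  rw [h1, h2, lintegral_halfLebesgue (f := fun u : ℝ≥0 => g (a * u))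
    (hgm.comp (measurable_coe_nnreal_real.const_mul a)),
    setLIntegral_congr Ioi_ae_eq_Ici.symm]
  have h3 : ∀ x ∈ Set.Ioi (0 : ℝ), (a.toNNReal : ℝ≥0∞) * g (a * x.toNNReal) =
      ENNReal.ofReal (stableExponent α lam)⁻¹ * betaPDF α (1 + lam - α) x := fun x hx => by
    have hx0 : 0 < x := hx
    rw [Real.coe_toNNReal x hx0.le]
    rcases lt_or_ge x 1 with hx1 | hx1
    · have hax : a * x < a := by nlinarith
      have h1x : 0 < 1 - x := by linarith
      have e1 : (a - a * x) = a * (1 - x) := by ring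
      rw [betaPDF_of_pos_lt_one hx0 hx1]
      simp only [hg, if_pos hax]
      rw [show (a.toNNReal : ℝ≥0∞) = ENNReal.ofReal a from rfl, ← ENNReal.ofReal_mul' (by positivity),
        ← ENNReal.ofReal_mul ha.le, ← ENNReal.ofReal_mul (by rw [stableExponent]; positivity)]
      congr 1
      rw [e1, mul_div_cancel_left₀ _ ha.ne', Real.mul_rpow ha.le h1x.le, Real.mul_rpow ha.le hx0.le,
        stableExponent, ProbabilityTheory.beta,
        show α + (1 + lam - α) = 1 + lam by ring, show 1 + lam - α - 1 = lam + -α by ring,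
        Real.rpow_add h1x]
      have ea : a ^ (-α) * a ^ (α - 1) * a = 1 := by
        rw [← Real.rpow_add ha, ← Real.rpow_add_one ha.ne',
          show -α + (α - 1) + 1 = 0 by ring, Real.rpow_zero]
      field_simp
      linear_combination ea
    · have hax : ¬ a * x < a := by nlinarith
      rw [betaPDF_eq_zero_of_one_le hx1]
      simp [hg, if_neg hax]
  rw [← lintegral_const_mul _ (by fun_prop), setLIntegral_congr_fun measurableSet_Ioi h3,
    lintegral_const_mul _ (show Measurable (betaPDF α (1 + lam - α)) from
      (measurable_betaPDFReal _ _).ennreal_ofReal)]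
  have h4 : ∫⁻ x in Set.Ioi (0 : ℝ), betaPDF α (1 + lam - α) x = 1 := by
    have h := lintegral_add_compl (μ := volume) (betaPDF α (1 + lam - α)) (measurableSet_Ioi (a := (0 : ℝ)))
    rwa [Set.compl_Ioi, setLIntegral_eq_zero measurableSet_Iic
        (fun x (hx : x ≤ 0) => betaPDF_eq_zero_of_nonpos hx), add_zero,
      lintegral_betaPDF_eq_one hα hlam] at h
  rw [h4, mul_one]

/-- The integral over time of the exponential moments: read in the time scale of `Y` it is an integral
against the potential measure of the subordinator. -/
lemma lintegral_expMoment (hP : IsUnitStableSubordinator α P) (hα : 0 < α) (ha : 0 < a) {lam : ℝ}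
    (hl : α - 1 < lam) :
    ∫⁻ t, expMoment α a P lam t ∂halfLebesgue = ENNReal.ofReal (stableExponent α lam)⁻¹ := by
  have h1 := lintegral_time_change hα (hP.ae_isDecreasingPath ha)
    (measurable_killedExp_lamperti_uncurry α a lam)
  set g : ℝ → ℝ≥0∞ := fun x =>
    if x < a then ENNReal.ofReal (((a - x) / a) ^ lam * (a - x) ^ (-α)) else 0 with hg
  have hgm : Measurable g := Measurable.ite measurableSet_Iio (by fun_prop) measurable_const
  rw [← lintegral_beta hα ha hl, ← hP.lintegral_potential hα hgm]
  calc _ = _ := lintegral_congr fun t => by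
        have := setLIntegral_alive (α := α) (a := a) P lam t 1
        simp only [Pi.one_apply, one_mul] at this
        exact this.symm
    _ = _ := h1
    _ = _ := lintegral_congr fun u => by
        rw [← lintegral_indicator (measurableSet_pssMp_pos a u)]
        refine lintegral_congr_ae ?_
        filter_upwards [hP.ae_isDecreasingPath ha, hP.ae_coord_ne] with w hw hne
        have hy : pssMp a u w = if realCoord u w < a then a - realCoord u w else 0 := by
          rw [pssMp, eq_inl_valK (hne u)]; rfl
        by_cases hlt : realCoord u w < a
        · rw [if_pos hlt] at hy
          have hpos : 0 < pssMp a u w := by linarith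
          rw [Set.indicator_of_mem (show w ∈ {w | 0 < pssMp a u w} from hpos)]
          simp only [hg, if_pos hlt]
          rw [lamperti_clockNN hα hw hpos, killedExp_inl, clockRate, hy,
            ENNReal.ofReal_rpow_of_pos (by linarith), ← ENNReal.ofReal_mul (Real.exp_pos _).le,
            Real.rpow_def_of_pos (x := (a - realCoord u w) / a) (by rw [← hy]; positivity), mul_comm lam]
        · rw [if_neg hlt] at hy
          rw [Set.indicator_of_notMem (show w ∉ {w | 0 < pssMp a u w} from by simp [hy])]
          simp [hg, hlt]

lemma expMoment_eq_of_lt (hP : IsUnitStableSubordinator α P) (hα : 0 < α) (ha : 0 < a) {lam : ℝ}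
    (hl : α - 1 < lam) (t : ℝ≥0) :
    expMoment α a P lam t = ENNReal.ofReal (Real.exp (-(t * stableExponent α lam))) := by
  rw [eq_exp_of_multiplicative (measurable_expMoment α a P lam) (hP.expMoment_add hα ha lam)
    (inv_pos.2 (stableExponent_pos hα hl))
    (hP.lintegral_expMoment hα ha hl), div_inv_eq_mul]

/-- The exponent tends to `0` at the critical value `α - 1`, because `1 / Γ(ε)` does. -/
lemma tendsto_stableExponent {α : ℝ} (hα : 0 < α) :
    Tendsto (fun n : ℕ => stableExponent α (α - 1 + 1 / ((n : ℝ) + 1))) atTop (𝓝 0) := by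
  have hε : Tendsto (fun n : ℕ => 1 / ((n : ℝ) + 1)) atTop (𝓝 0) := tendsto_one_div_add_atTop_nhds_zero_nat
  have hc : ∀ x : ℝ, 0 < x → ContinuousAt Real.Gamma x := fun x hx =>
    (Real.differentiableAt_Gamma fun m => by
      have : (0 : ℝ) ≤ m := by positivity
      linarith).continuousAt
  have h : ∀ n : ℕ, stableExponent α (α - 1 + 1 / ((n : ℝ) + 1)) =
      1 / ((n : ℝ) + 1) * Real.Gamma (α + 1 / ((n : ℝ) + 1)) / Real.Gamma (1 / ((n : ℝ) + 1) + 1) := fun n => by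
    have : (0 : ℝ) < 1 / ((n : ℝ) + 1) := by positivity
    have hG := Real.Gamma_pos_of_pos this
    rw [Real.Gamma_add_one this.ne', stableExponent,
      show 1 + (α - 1 + 1 / ((n : ℝ) + 1)) = α + 1 / ((n : ℝ) + 1) by ring,
      show α + 1 / ((n : ℝ) + 1) - α = 1 / ((n : ℝ) + 1) by ring]
    field_simp
  simp only [h]
  have h1 : Tendsto (fun n : ℕ => Real.Gamma (α + 1 / ((n : ℝ) + 1))) atTop (𝓝 (Real.Gamma α)) :=
    (hc α hα).tendsto.comp (by simpa using hε.const_add α)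
  have h2 : Tendsto (fun n : ℕ => Real.Gamma (1 / ((n : ℝ) + 1) + 1)) atTop (𝓝 (Real.Gamma 1)) :=
    (hc 1 one_pos).tendsto.comp (by simpa using hε.add_const 1)
  have h3 := (hε.mul h1).div h2 (by simp [Real.Gamma_one])
  rw [zero_mul, zero_div] at h3
  exact h3

/-- The exponential moments of the Lamperti transform. The critical exponent `α - 1` is reached by
monotone convergence. -/
theorem expMoment_eq (hP : IsUnitStableSubordinator α P) (hα : 0 < α) (ha : 0 < a) {lam : ℝ}
    (hl : α - 1 ≤ lam) (t : ℝ≥0) :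
    expMoment α a P lam t = ENNReal.ofReal (Real.exp (-(t * stableExponent α lam))) := by
  rcases eq_or_lt_of_le hl with rfl | hl
  swap
  · exact hP.expMoment_eq_of_lt hα ha hl t
  rw [stableExponent_sub_one]
  have h1 : Tendsto (fun n : ℕ => expMoment α a P (α - 1 + 1 / ((n : ℝ) + 1)) t) atTop
      (𝓝 (expMoment α a P (α - 1) t)) := by
    refine lintegral_tendsto_of_tendsto_of_monotone
      (fun n => (measurable_killedExp_lamperti _ _ _ _).aemeasurable) ?_ ?_
    · filter_upwards [hP.ae_isDecreasingPath ha] with w hw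
      intro m n hmn
      refine ENNReal.ofReal_le_ofReal ?_
      have hle : valK (lamperti α a t w) ≤ 0 := by
        by_cases ht : lamperti α a t w = cemetery
        · rw [ht]; exact le_rfl
        · rw [lamperti_eq_lampertiOf] at ht ⊢
          refine (hw.valK_lampertiOf_le hα ha (zero_le : 0 ≤ t) ht).trans ?_
          rw [hw.lampertiOf_zero hα ha, valK_inl]
      by_cases h : lamperti α a t w = cemetery
      · rw [h, killedExp_cemetery, killedExp_cemetery]
      · rw [eq_inl_valK h, killedExp_inl, killedExp_inl]
        refine Real.exp_le_exp.2 (mul_le_mul_of_nonpos_right ?_ hle)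
        gcongr
    · refine Eventually.of_forall fun w => ?_
      refine (ENNReal.continuous_ofReal.tendsto _).comp ?_
      by_cases h : lamperti α a t w = cemetery
      · simp [h, killedExp_cemetery]
      · rw [eq_inl_valK h]
        simp only [killedExp_inl]
        refine (Real.continuous_exp.tendsto _).comp (Tendsto.mul_const _ ?_)
        simpa using tendsto_one_div_add_atTop_nhds_zero_nat.const_add (α - 1)
  have h2 : Tendsto (fun n : ℕ => expMoment α a P (α - 1 + 1 / ((n : ℝ) + 1)) t) atTop
      (𝓝 (ENNReal.ofReal (Real.exp (-(t * 0))))) := by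
    have : ∀ n : ℕ, expMoment α a P (α - 1 + 1 / ((n : ℝ) + 1)) t = _ := fun n =>
      hP.expMoment_eq_of_lt hα ha (by have : (0 : ℝ) < 1 / ((n : ℝ) + 1) := by positivity
                                      linarith) t
    simp only [this]
    refine (ENNReal.continuous_ofReal.tendsto _).comp ((Real.continuous_exp.tendsto _).comp ?_)
    exact ((tendsto_stableExponent hα).const_mul _).neg
  exact tendsto_nhds_unique h1 h2

end IsUnitStableSubordinator

/-! ### Exponential martingales and supermartingales -/

lemma measurable_pastFiltration {Ω : Type*} [m : MeasurableSpace Ω] {Z : ℝ≥0 → Ω → KilledReal}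
    (hZ : ∀ t, Measurable (Z t)) (t : ℝ≥0) : Measurable[pastFiltration Z t] (Z t) := fun B hB =>
  MeasurableSpace.measurableSet_inf.2
    ⟨(le_iSup₂_of_le (f := fun s (_ : s ≤ t) => MeasurableSpace.comap (Z s) inferInstance) t le_rfl le_rfl :
      MeasurableSpace.comap (Z t) inferInstance ≤ pastSigma Z t) _ ⟨B, hB, rfl⟩, hZ t hB⟩

lemma stronglyAdapted_killedExp (α a lam : ℝ) :
    StronglyAdapted (pastFiltration (lamperti α a)) fun t w => killedExp lam (lamperti α a t w) :=
  fun t => ((measurable_killedExp lam).comp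
    (measurable_pastFiltration (measurable_lamperti α a) t)).stronglyMeasurable

lemma exists_of_measurableSet_pastFiltration {α a : ℝ} {s : ℝ≥0} {A : Set PathSpace}
    (hA : MeasurableSet[pastSigma (lamperti α a) s] A) :
    ∃ B, MeasurableSet B ∧ A = {w | stopProc s (lampertiPath α a w) ∈ B} :=
  exists_of_measurableSet_pastSigma hA

namespace IsUnitStableSubordinator

variable {α a : ℝ} {P : Measure PathSpace} [IsProbabilityMeasure P]

lemma integral_killedExp (hP : IsUnitStableSubordinator α P) (hα : 0 < α) (ha : 0 < a) {lam : ℝ}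
    (hl : α - 1 ≤ lam) (t : ℝ≥0) :
    ∫ w, killedExp lam (lamperti α a t w) ∂P = Real.exp (-(t * stableExponent α lam)) := by
  rw [integral_eq_lintegral_of_nonneg_ae (Eventually.of_forall fun w => killedExp_nonneg _ _)
    ((measurable_killedExp lam).comp (measurable_lamperti α a t)).aestronglyMeasurable]
  have h := hP.expMoment_eq hα ha hl t
  rw [expMoment] at h
  rw [h, ENNReal.toReal_ofReal (Real.exp_pos _).le]

lemma integrable_killedExp (hP : IsUnitStableSubordinator α P) (hα : 0 < α) (ha : 0 < a) {lam : ℝ}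
    (hl : α - 1 ≤ lam) (t : ℝ≥0) : Integrable (fun w => killedExp lam (lamperti α a t w)) P := by
  by_contra h
  have h1 := hP.integral_killedExp hα ha hl t
  rw [integral_undef h] at h1
  exact (Real.exp_pos _).ne h1

/-- Conditionally on the past up to `s`, `exp (lam * ξ_t)` is `exp (lam * ξ_s)` times a constant. -/
lemma condExp_killedExp (hP : IsUnitStableSubordinator α P) (hα : 0 < α) (ha : 0 < a) {lam : ℝ}
    (hl : α - 1 ≤ lam) (s u : ℝ≥0) :
    P[fun w => killedExp lam (lamperti α a (s + u) w) | pastFiltration (lamperti α a) s] =ᵐ[P]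
      fun w => Real.exp (-(u * stableExponent α lam)) * killedExp lam (lamperti α a s w) := by
  have hint := hP.integrable_killedExp hα ha hl
  symm
  refine ae_eq_condExp_of_forall_setIntegral_eq ((pastFiltration (lamperti α a)).le s) (hint _)
    (fun A _ _ => ((hint s).const_mul _).integrableOn) (fun A hA _ => ?_) ?_
  · obtain ⟨hA1, hA2⟩ := MeasurableSpace.measurableSet_inf.1 hA
    obtain ⟨B, hB, rfl⟩ := exists_of_measurableSet_pastFiltration hA1
    have h := hP.lintegral_killedExp_add hα ha lam s u hB
    rw [hP.expMoment_eq hα ha hl] at h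
    have key : ∀ t, ∫ w in {w | stopProc s (lampertiPath α a w) ∈ B}, killedExp lam (lamperti α a t w) ∂P =
        (∫⁻ w in {w | stopProc s (lampertiPath α a w) ∈ B},
          ENNReal.ofReal (killedExp lam (lamperti α a t w)) ∂P).toReal := fun t =>
      integral_eq_lintegral_of_nonneg_ae (Eventually.of_forall fun w => killedExp_nonneg _ _)
        ((measurable_killedExp lam).comp (measurable_lamperti α a t)).aestronglyMeasurable
    rw [integral_const_mul, key, key, h, ENNReal.toReal_mul, ENNReal.toReal_ofReal (Real.exp_pos _).le]
  · exact ((stronglyAdapted_killedExp α a lam s).const_mul _).aestronglyMeasurable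

lemma supermartingale_killedExp (hP : IsUnitStableSubordinator α P) (hα : 0 < α) (ha : 0 < a) {lam : ℝ}
    (hl : α - 1 ≤ lam) (h0 : 0 ≤ stableExponent α lam) :
    Supermartingale (fun t w => killedExp lam (lamperti α a t w)) (pastFiltration (lamperti α a)) P := by
  refine ⟨stronglyAdapted_killedExp α a lam, fun s t hst => ?_, hP.integrable_killedExp hα ha hl⟩
  obtain ⟨u, rfl⟩ := le_iff_exists_add.1 hst
  refine (hP.condExp_killedExp hα ha hl s u).le.trans (Eventually.of_forall fun w => ?_)
  refine mul_le_of_le_one_left (killedExp_nonneg _ _) (Real.exp_le_one_iff.2 ?_)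
  exact neg_nonpos.2 (mul_nonneg u.2 h0)

lemma martingale_killedExp (hP : IsUnitStableSubordinator α P) (hα : 0 < α) (ha : 0 < a) {lam : ℝ}
    (hl : α - 1 ≤ lam) (h0 : stableExponent α lam = 0) :
    Martingale (fun t w => killedExp lam (lamperti α a t w)) (pastFiltration (lamperti α a)) P := by
  refine ⟨stronglyAdapted_killedExp α a lam, fun s t hst => ?_⟩
  obtain ⟨u, rfl⟩ := le_iff_exists_add.1 hst
  refine (hP.condExp_killedExp hα ha hl s u).trans (Eventually.of_forall fun w => ?_)
  simp [h0]

/-- If the exponent at `lam` does not vanish, `exp (lam * ξ_t)` is not a martingale: its expectation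
`exp (-t φ)`, with `φ` the exponent, depends on `t`. -/
lemma not_martingale_killedExp (hP : IsUnitStableSubordinator α P) (hα : 0 < α) (ha : 0 < a) {lam : ℝ}
    (hl : α - 1 ≤ lam) (h0 : stableExponent α lam ≠ 0) :
    ¬ Martingale (fun t w => killedExp lam (lamperti α a t w)) (pastFiltration (lamperti α a)) P := by
  intro h
  have h1 := h.setIntegral_eq (zero_le_one : (0 : ℝ≥0) ≤ 1) MeasurableSet.univ
  rw [Measure.restrict_univ, hP.integral_killedExp hα ha hl, hP.integral_killedExp hα ha hl] at h1
  have h2 := Real.exp_injective h1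
  simp at h2
  exact h0 h2

end IsUnitStableSubordinator

/-! ### Exponential changes of measure and gluing of independent segments -/

/-- The negative of a path of the state space, as a real path (with the dummy value `0` at `Δ`). -/
noncomputable def negVal (x : ℝ≥0 → KilledReal) : ℝ≥0 → ℝ := fun u => -valK (x u)

lemma measurable_negVal : Measurable negVal :=
  measurable_pi_lambda _ fun u => (measurable_valK.comp (measurable_pi_apply u)).neg

/-- The law `P` with density `exp (T φ + β ξ_T)`, where `φ` is the Laplace exponent at `β`. -/
noncomputable def tilted (α a β : ℝ) (P : Measure PathSpace) (T : ℝ≥0) : Measure PathSpace :=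
  P.withDensity fun w =>
    ENNReal.ofReal (Real.exp (T * stableExponent α β)) * ENNReal.ofReal (killedExp β (lamperti α a T w))

lemma lintegral_tilted {α a β : ℝ} {P : Measure PathSpace} {T : ℝ≥0} {F : PathSpace → ℝ≥0∞}
    (hF : Measurable F) : ∫⁻ w, F w ∂(tilted α a β P T) =
      ENNReal.ofReal (Real.exp (T * stableExponent α β)) *
        ∫⁻ w, F w * ENNReal.ofReal (killedExp β (lamperti α a T w)) ∂P := by
  have hk := measurable_killedExp_lamperti α a β T
  rw [tilted, lintegral_withDensity_eq_lintegral_mul _ (hk.const_mul _) hF,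
    ← lintegral_const_mul _ (f := fun w => F w * ENNReal.ofReal (killedExp β (lamperti α a T w))) (hF.mul hk)]
  refine lintegral_congr fun w => ?_
  simp only [Pi.mul_apply]
  ring

lemma tilted_absolutelyContinuous {α a β : ℝ} {P : Measure PathSpace} {T : ℝ≥0} : tilted α a β P T ≪ P :=
  withDensity_absolutelyContinuous _ _

lemma ae_tilted_alive {α a β : ℝ} {P : Measure PathSpace} {T : ℝ≥0} :
    ∀ᵐ w ∂(tilted α a β P T), lamperti α a T w ≠ cemetery := by
  rw [tilted, ae_withDensity_iff ((measurable_killedExp_lamperti α a β T).const_mul _)]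
  refine Eventually.of_forall fun w hw h => hw ?_
  rw [h, killedExp_cemetery]
  simp

/-- A path followed by another one from time `n` on (for a first path which stops at `n`). -/
def concat (n : ℝ≥0) (p : (ℝ≥0 → ℝ) × (ℝ≥0 → ℝ)) : ℝ≥0 → ℝ := fun u => p.1 u + p.2 (u - n)

lemma measurable_concat (n : ℝ≥0) : Measurable (concat n) :=
  measurable_pi_lambda _ fun u => ((measurable_pi_apply u).comp measurable_fst).add
    ((measurable_pi_apply (u - n)).comp measurable_snd)

lemma negVal_incProc {x : ℝ≥0 → KilledReal} {s t : ℝ≥0} (ht : x (s + t) ≠ cemetery) :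
    negVal (incProc s x) t = negVal x (s + t) - negVal x s := by
  simp only [negVal, incProc]
  conv_lhs => rw [eq_inl_valK ht]
  simp only [Sum.map_inl, valK_inl]
  ring

lemma negVal_stopProc_add {x : ℝ≥0 → KilledReal} {s t : ℝ≥0} (h : ∀ u ≤ s + t, x u ≠ cemetery) :
    negVal (stopProc (s + t) x) =
      concat s (negVal (stopProc s x), negVal (stopProc t (incProc s x))) := by
  funext u
  have e : negVal (stopProc t (incProc s x)) (u - s) = negVal (incProc s x) (min (u - s) t) := rfl
  have hle : s + min (u - s) t ≤ s + t := by gcongr; exact min_le_right _ _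
  simp only [concat, e]
  rw [negVal_incProc (h _ hle)]
  simp only [negVal, stopProc]
  rcases le_total u s with hu | hu
  · rw [tsub_eq_zero_of_le hu, min_eq_left hu, min_eq_left (hu.trans le_self_add),
      min_eq_left (zero_le : 0 ≤ t), add_zero]
    ring
  · rw [min_eq_right hu, ← min_add_add_left, add_tsub_cancel_of_le hu]
    ring

/-- Families of real paths on the unit time interval (constant from time `1` on) which start at `0`
and are non-decreasing and right-continuous. -/
structure IsUnitSegment {W : Type*} [MeasurableSpace W] (S : ℝ≥0 → W → ℝ) : Prop where
  zero : ∀ w, S 0 w = 0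
  eq_min : ∀ u w, S u w = S (min u 1) w
  monotone : ∀ w, Monotone fun u => S u w
  right_continuous : ∀ w t, ContinuousWithinAt (fun u => S u w) (Set.Ici t) t
  measurable : ∀ u, Measurable (S u)

/-- The path obtained by running the segments `S (ω 0), S (ω 1), …` of unit duration one after
another. -/
noncomputable def glue {W : Type*} (S : ℝ≥0 → W → ℝ) (u : ℝ≥0) (ω : ℕ → W) : ℝ :=
  ∑ k ∈ Finset.range ⌈u⌉₊, S (u - k) (ω k)

namespace IsUnitSegment

variable {W : Type*} [MeasurableSpace W] {S : ℝ≥0 → W → ℝ}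

lemma glue_eq (hS : IsUnitSegment S) {u : ℝ≥0} {n : ℕ} (hu : u ≤ n) (ω : ℕ → W) :
    glue S u ω = ∑ k ∈ Finset.range n, S (u - k) (ω k) := by
  refine Finset.sum_subset (Finset.range_mono (Nat.ceil_le.2 hu)) fun k _ hk => ?_
  rw [Finset.mem_range, not_lt, Nat.ceil_le] at hk
  rw [tsub_eq_zero_of_le hk, hS.zero]

lemma glue_succ (hS : IsUnitSegment S) (u : ℝ≥0) (n : ℕ) (ω : ℕ → W) :
    glue S (min u (n + 1)) ω = glue S (min u n) ω + S (u - n) (ω n) := by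
  rw [hS.glue_eq (n := n + 1) (by push_cast; exact min_le_right _ _), hS.glue_eq (n := n) (min_le_right _ _),
    Finset.sum_range_succ]
  congr 1
  · refine Finset.sum_congr rfl fun k hk => ?_
    have hk' : ((k : ℝ≥0) + 1) ≤ n := by exact_mod_cast Finset.mem_range.1 hk
    rcases le_total u n with h | h
    · rw [min_eq_left h, min_eq_left (h.trans (by simp))]
    · have h1 : (1 : ℝ≥0) ≤ n - k := le_tsub_of_add_le_left hk'
      rw [hS.eq_min, hS.eq_min (min u n - k), min_eq_right h, min_eq_right h1, min_eq_right]
      refine h1.trans (tsub_le_tsub_right (le_min h (by simp)) _)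
  · rw [hS.eq_min, hS.eq_min (u - n)]
    congr 1
    rcases le_total u (n + 1) with h | h
    · rw [min_eq_left h]
    · rw [min_eq_right h, add_tsub_cancel_left, min_self, min_eq_right]
      exact le_tsub_of_add_le_left h

lemma glue_zero (_hS : IsUnitSegment S) (ω : ℕ → W) : glue S 0 ω = 0 := by simp [glue]

lemma monotone_glue (hS : IsUnitSegment S) (ω : ℕ → W) : Monotone fun u => glue S u ω := fun s t h => by
  obtain ⟨n, hn⟩ := exists_nat_ge t
  simp only [hS.glue_eq hn, hS.glue_eq (h.trans hn)]
  exact Finset.sum_le_sum fun k _ => hS.monotone _ (tsub_le_tsub_right h _)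

lemma right_continuous_glue (hS : IsUnitSegment S) (ω : ℕ → W) (t : ℝ≥0) :
    ContinuousWithinAt (fun u => glue S u ω) (Set.Ici t) t := by
  obtain ⟨n, hn⟩ := exists_nat_gt t
  have hc : ContinuousWithinAt (fun u => ∑ k ∈ Finset.range n, S (u - k) (ω k)) (Set.Ici t) t := by
    refine tendsto_finsetSum _ fun k _ => ?_
    have hk := hS.right_continuous (ω k) (t - k)
    refine hk.comp (t := Set.Ici (t - k)) (f := fun u : ℝ≥0 => u - k)
      (by fun_prop) fun u hu => ?_
    exact tsub_le_tsub_right (Set.mem_Ici.1 hu) _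
  refine hc.congr_of_eventuallyEq ?_ (hS.glue_eq hn.le ω)
  filter_upwards [mem_nhdsWithin_of_mem_nhds (Iio_mem_nhds hn)] with u hu
  exact hS.glue_eq (le_of_lt hu) ω

lemma measurable_glue (hS : IsUnitSegment S) (u : ℝ≥0) : Measurable (glue S u) :=
  Finset.measurable_sum _ fun k _ => (hS.measurable _).comp (measurable_pi_apply k)

/-- The last segment is independent of the previous ones. -/
lemma lintegral_glue_succ (hS : IsUnitSegment S) (ρ : Measure W) [IsProbabilityMeasure ρ] (n : ℕ)
    {f : (ℝ≥0 → ℝ) → ℝ≥0∞} (hf : Measurable f) :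
    ∫⁻ ω, f (fun u => glue S (min u (n + 1)) ω) ∂(Measure.infinitePi fun _ : ℕ => ρ) =
      ∫⁻ ω, ∫⁻ w, f (concat n (fun u => glue S (min u n) ω, fun u => S u w)) ∂ρ
        ∂(Measure.infinitePi fun _ : ℕ => ρ) := by
  set μ := Measure.infinitePi fun _ : ℕ => ρ
  have hind : IndepFun (fun (ω : ℕ → W) u => glue S (min u n) ω) (fun ω => ω n) μ := by
    have h := (iIndepFun_infinitePi (P := fun _ : ℕ => ρ) (X := fun _ w => w)
      fun _ => measurable_id).indepFun_finset (Finset.range n) {n} (by simp) fun i => measurable_pi_apply i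
    have h1 : Measurable fun (x : Finset.range n → W) (u : ℝ≥0) =>
        ∑ k : Finset.range n, S (min u n - (k : ℕ)) (x k) :=
      measurable_pi_lambda _ fun u => Finset.measurable_sum _ fun k _ =>
        (hS.measurable _).comp (measurable_pi_apply k)
    have h2 : Measurable fun x : ({n} : Finset ℕ) → W => x ⟨n, by simp⟩ := measurable_pi_apply _
    have h3 := h.comp h1 h2
    refine h3.congr (Eventually.of_forall fun ω => ?_) (Eventually.of_forall fun ω => rfl)
    funext u
    beta_reduce
    rw [hS.glue_eq (min_le_right u (n : ℝ≥0))]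
    exact Finset.sum_coe_sort (Finset.range n) fun k => S (min u n - k) (ω k)
  have hm1 : Measurable fun (ω : ℕ → W) u => glue S (min u n) ω :=
    measurable_pi_lambda _ fun u => hS.measurable_glue _
  have hSm : Measurable fun w u => S u w := measurable_pi_lambda _ hS.measurable
  have hG : Measurable fun p : (ℝ≥0 → ℝ) × W => f (concat n (p.1, fun u => S u p.2)) :=
    hf.comp ((measurable_concat n).comp (measurable_fst.prodMk (hSm.comp measurable_snd)))
  have hprod := (indepFun_iff_map_prod_eq_prod_map_map hm1.aemeasurable
    (measurable_pi_apply n).aemeasurable).1 hind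
  rw [Measure.infinitePi_map_eval] at hprod
  have h := congrArg (fun m => ∫⁻ p, f (concat n (p.1, fun u => S u p.2)) ∂m) hprod
  beta_reduce at h
  rw [lintegral_map hG (hm1.prodMk (measurable_pi_apply n)), lintegral_prod _ hG.aemeasurable,
    lintegral_map hG.lintegral_prod_right' hm1] at h
  rw [← h]
  refine lintegral_congr fun ω => ?_
  congr 1
  funext u
  exact hS.glue_succ u n ω

end IsUnitSegment

/-- A process whose increments are independent of its past has independent increments. -/
lemma hasIndepIncrements_of_past {Ω : Type*} [MeasurableSpace Ω] {μ : Measure Ω} [IsProbabilityMeasure μ]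
    {X : ℝ≥0 → Ω → ℝ}
    (h : ∀ (s t : ℝ≥0) (B : Set (ℝ≥0 → ℝ)) (C : Set ℝ), s ≤ t → MeasurableSet B → MeasurableSet C →
      μ {ω | (fun u => X (min u s) ω) ∈ B ∧ X t ω - X s ω ∈ C} =
        μ {ω | (fun u => X (min u s) ω) ∈ B} * μ {ω | X t ω - X s ω ∈ C}) :
    HasIndepIncrements X μ := by
  refine hasIndepIncrements_iff_nat.2 fun t ht => ?_
  have hrange : ∀ (n : ℕ) (C : ℕ → Set ℝ), (∀ i, MeasurableSet (C i)) →
      μ (⋂ i ∈ Finset.range n, (fun ω => X (t (i + 1)) ω - X (t i) ω) ⁻¹' C i) =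
        ∏ i ∈ Finset.range n, μ ((fun ω => X (t (i + 1)) ω - X (t i) ω) ⁻¹' C i) := by
    intro n C hC
    induction n with
    | zero => simp
    | succ n ih =>
      rw [Finset.prod_range_succ, ← ih]
      have hB : MeasurableSet {x : ℝ≥0 → ℝ | ∀ i ∈ Finset.range n, x (t (i + 1)) - x (t i) ∈ C i} := by
        have : {x : ℝ≥0 → ℝ | ∀ i ∈ Finset.range n, x (t (i + 1)) - x (t i) ∈ C i} =
            ⋂ i ∈ Finset.range n, (fun x : ℝ≥0 → ℝ => x (t (i + 1)) - x (t i)) ⁻¹' C i := by ext; simp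
        rw [this]
        exact Finset.measurableSet_biInter _ fun i _ =>
          ((measurable_pi_apply (t (i + 1))).sub (measurable_pi_apply (t i)) :
            Measurable fun x : ℝ≥0 → ℝ => x (t (i + 1)) - x (t i)) (hC i)
      have e : ∀ ω, ((fun u => X (min u (t n)) ω) ∈
          {x : ℝ≥0 → ℝ | ∀ i ∈ Finset.range n, x (t (i + 1)) - x (t i) ∈ C i}) ↔
          ∀ i ∈ Finset.range n, X (t (i + 1)) ω - X (t i) ω ∈ C i := fun ω => by
        refine forall₂_congr fun i hi => ?_
        have hi' : i + 1 ≤ n := Finset.mem_range.1 hi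
        beta_reduce
        rw [min_eq_left (ht hi'), min_eq_left (ht (i.le_succ.trans hi'))]
      have := h (t n) (t (n + 1)) _ (C n) (ht n.le_succ) hB (hC n)
      simp only [e] at this
      convert this using 2
      · ext ω; simp [Finset.range_add_one, and_comm]
      · congr 1; ext ω; simp
      · rfl
  rw [iIndepFun_iff_measure_inter_preimage_eq_mul]
  intro F C hC
  classical
  obtain ⟨n, hn⟩ := F.exists_nat_subset_range
  have := hrange n (fun i => if i ∈ F then C i else Set.univ) fun i => by
    split_ifs with hi
    · exact hC i hi
    · exact MeasurableSet.univ
  convert this using 1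
  · congr 1
    ext ω
    simp only [Set.mem_iInter, Set.mem_preimage]
    constructor
    · intro h i _
      split_ifs with hi
      · exact h i hi
      · trivial
    · intro h i hi
      simpa [hi] using h i (hn hi)
  · rw [← Finset.prod_subset hn]
    · exact Finset.prod_congr rfl fun i hi => by simp [hi]
    · intro i _ hi
      simp [hi]

namespace IsUnitStableSubordinator

variable {α a β : ℝ} {P : Measure PathSpace} [IsProbabilityMeasure P]

lemma isProbabilityMeasure_tilted (hP : IsUnitStableSubordinator α P) (hα : 0 < α) (ha : 0 < a)
    (hβ : α - 1 ≤ β) (T : ℝ≥0) : IsProbabilityMeasure (tilted α a β P T) := ⟨by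
  have h := hP.expMoment_eq hα ha hβ T
  rw [expMoment] at h
  rw [← lintegral_one, lintegral_tilted measurable_const]
  simp only [one_mul]
  rw [h, ← ENNReal.ofReal_mul (Real.exp_pos _).le, ← Real.exp_add]
  simp⟩

/-- The Lévy property under the change of measure: before and after `s`, the paths are independent
and each follows the changed law. -/
lemma lintegral_tilted_add (hP : IsUnitStableSubordinator α P) (hα : 0 < α) (ha : 0 < a)
    (s t : ℝ≥0) {G : (ℝ≥0 → KilledReal) × (ℝ≥0 → KilledReal) → ℝ≥0∞} (hG : Measurable G) :
    ∫⁻ w, G (stopProc s (lampertiPath α a w), incProc s (lampertiPath α a w)) ∂(tilted α a β P (s + t)) =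
      ∫⁻ w, ∫⁻ w', G (stopProc s (lampertiPath α a w), lampertiPath α a w') ∂(tilted α a β P t)
        ∂(tilted α a β P s) := by
  have hsp : Measurable fun w => stopProc s (lampertiPath α a w) :=
    (measurable_stopProc s).comp (measurable_lampertiPath α a)
  have hlp := measurable_lampertiPath α a
  have hG' : Measurable fun p : (ℝ≥0 → KilledReal) × (ℝ≥0 → KilledReal) =>
      G p * ENNReal.ofReal (killedExp β (p.2 t)) :=
    hG.mul ((measurable_killedExp β).comp ((measurable_pi_apply t).comp measurable_snd)).ennreal_ofReal
  have h := hP.lintegral_killedExp_mul hα ha β s hG'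
  have hGw : ∀ w, Measurable fun w' => G (stopProc s (lampertiPath α a w), lampertiPath α a w') := fun w =>
    hG.comp (measurable_prodMk_left.comp hlp)
  have hGs : Measurable fun w => ∫⁻ w', G (stopProc s (lampertiPath α a w), lampertiPath α a w') *
      ENNReal.ofReal (killedExp β (lamperti α a t w')) ∂P :=
    Measurable.lintegral_prod_right' (f := fun p : PathSpace × PathSpace =>
      G (stopProc s (lampertiPath α a p.1), lampertiPath α a p.2) *
      ENNReal.ofReal (killedExp β (lamperti α a t p.2)))
      ((hG.comp ((hsp.comp measurable_fst).prodMk (hlp.comp measurable_snd))).mul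
        ((measurable_killedExp_lamperti α a β t).comp measurable_snd))
  simp only [lintegral_tilted (hGw _)]
  have hGi : Measurable fun w => G (stopProc s (lampertiPath α a w), incProc s (lampertiPath α a w)) :=
    hG.comp (hsp.prodMk (measurable_incProc α a s))
  rw [lintegral_tilted hGi, lintegral_tilted (hGs.const_mul _)]
  have e : Real.exp ((s + t : ℝ≥0) * stableExponent α β) =
      Real.exp (s * stableExponent α β) * Real.exp (t * stableExponent α β) := by
    rw [← Real.exp_add, NNReal.coe_add]; ring_nf
  rw [e, ENNReal.ofReal_mul (Real.exp_pos _).le, mul_assoc]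
  congr 1
  simp only [mul_assoc]
  have hGs2 : Measurable fun w => (∫⁻ w', G (stopProc s (lampertiPath α a w), lampertiPath α a w') *
      ENNReal.ofReal (killedExp β (lamperti α a t w')) ∂P) *
      ENNReal.ofReal (killedExp β (lamperti α a s w)) := hGs.mul (measurable_killedExp_lamperti α a β s)
  rw [lintegral_const_mul _ hGs2]
  congr 1
  calc _ = _ := by
        refine lintegral_congr_ae ?_
        filter_upwards [hP.ae_isDecreasingPath ha] with w hw
        rw [killedExp_lamperti_add hα hw, mul_comm (killedExp β (lamperti α a s w)),
          ENNReal.ofReal_mul (killedExp_nonneg _ _), ← mul_assoc]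
    _ = _ := h

/-- The changed laws are consistent: on the past up to `s`, the law with density at time `s + t` is the one
with density at time `s`. -/
lemma lintegral_tilted_stop (hP : IsUnitStableSubordinator α P) (hα : 0 < α) (ha : 0 < a)
    (hβ : α - 1 ≤ β) (s t : ℝ≥0) {F : (ℝ≥0 → KilledReal) → ℝ≥0∞} (hF : Measurable F) :
    ∫⁻ w, F (stopProc s (lampertiPath α a w)) ∂(tilted α a β P (s + t)) =
      ∫⁻ w, F (stopProc s (lampertiPath α a w)) ∂(tilted α a β P s) := by
  have := hP.isProbabilityMeasure_tilted hα ha hβ t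
  rw [hP.lintegral_tilted_add hα ha s t (G := fun p => F p.1) (hF.comp measurable_fst)]
  simp

end IsUnitStableSubordinator

/-- A property that holds almost surely holds on a measurable set of full measure. -/
lemma exists_measurable_of_ae {Ω : Type*} [MeasurableSpace Ω] {μ : Measure Ω} {p : Ω → Prop}
    (h : ∀ᵐ ω ∂μ, p ω) : ∃ G, MeasurableSet G ∧ (∀ ω ∈ G, p ω) ∧ ∀ᵐ ω ∂μ, ω ∈ G := by
  obtain ⟨N, hN, hNm, hN0⟩ := exists_measurable_superset_of_null (ae_iff.1 h)
  refine ⟨Nᶜ, hNm.compl, fun ω hω => ?_, measure_eq_zero_iff_ae_notMem.1 hN0⟩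
  by_contra hp
  exact hω (hN hp)

namespace IsUnitStableSubordinator

variable {α a β : ℝ} {P : Measure PathSpace}

/-- Up to time `1`, the negative of `ξ` is under the changed law almost surely equal to a family of segments
all of whose paths are regular. -/
lemma exists_unitSegment (hP : IsUnitStableSubordinator α P) (hα : 0 < α) (ha : 0 < a) (β : ℝ) :
    ∃ S : ℝ≥0 → PathSpace → ℝ, IsUnitSegment S ∧
      ∀ᵐ w ∂(tilted α a β P 1), ∀ u, S u w = negVal (stopProc 1 (lampertiPath α a w)) u := by
  have hgood : ∀ᵐ w ∂(tilted α a β P 1),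
      IsDecreasingPath a (fun t => pssMp a t w) ∧ lamperti α a 1 w ≠ cemetery := by
    filter_upwards [tilted_absolutelyContinuous.ae_le (hP.ae_isDecreasingPath ha),
      ae_tilted_alive] with w h1 h2 using ⟨h1, h2⟩
  obtain ⟨G, hGm, hG, hGae⟩ := exists_measurable_of_ae hgood
  refine ⟨fun u => G.indicator fun w => -valK (lamperti α a (min u 1) w), ⟨fun w => ?_, fun u w => ?_,
    fun w => ?_, fun w t => ?_, fun u => ?_⟩, ?_⟩
  · by_cases hw : w ∈ G
    · rw [Set.indicator_of_mem hw, min_eq_left zero_le_one, lamperti_eq_lampertiOf,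
        (hG w hw).1.lampertiOf_zero hα ha, valK_inl, neg_zero]
    · exact Set.indicator_of_notMem hw _
  · rw [min_assoc, min_self]
  · intro s t hst
    by_cases hw : w ∈ G
    · simp only [Set.indicator_of_mem hw]
      refine neg_le_neg ?_
      have h1 := lamperti_ne_of_le hα (hG w hw).1 (min_le_right t 1) (hG w hw).2
      rw [lamperti_eq_lampertiOf] at h1
      rw [lamperti_eq_lampertiOf, lamperti_eq_lampertiOf]
      exact (hG w hw).1.valK_lampertiOf_le hα ha (min_le_min_right 1 hst) h1
    · simp only [Set.indicator_of_notMem hw]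
      exact le_rfl
  · by_cases hw : w ∈ G
    · simp only [Set.indicator_of_mem hw]
      refine (continuous_valK.continuousAt.comp_continuousWithinAt ?_).neg
      refine (lamperti_right_continuous hα ha (hG w hw).1 (min t 1)).comp (t := Set.Ici (min t 1))
        (f := fun u => min u 1) (by fun_prop) fun u hu =>
          min_le_min_right 1 (Set.mem_Ici.1 hu)
    · simp only [Set.indicator_of_notMem hw]
      exact continuousWithinAt_const
  · exact (measurable_valK.comp (measurable_lamperti α a (min u 1))).neg.indicator hGm
  · filter_upwards [hGae] with w hw u
    exact Set.indicator_of_mem hw _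

variable [IsProbabilityMeasure P]

/-- Independent segments of duration one under the changed law, glued together, follow the changed
law up to any time. -/
lemma lintegral_glue (hP : IsUnitStableSubordinator α P) (hα : 0 < α) (ha : 0 < a)
    (hβ : α - 1 ≤ β) {S : ℝ≥0 → PathSpace → ℝ} (hS : IsUnitSegment S)
    (hSae : ∀ᵐ w ∂(tilted α a β P 1), ∀ u, S u w = negVal (stopProc 1 (lampertiPath α a w)) u) (n : ℕ)
    {f : (ℝ≥0 → ℝ) → ℝ≥0∞} (hf : Measurable f) :
    ∫⁻ ω, f (fun u => glue S (min u n) ω) ∂(Measure.infinitePi fun _ : ℕ => tilted α a β P 1) =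
      ∫⁻ w, f (negVal (stopProc n (lampertiPath α a w))) ∂(tilted α a β P n) := by
  have hprob := hP.isProbabilityMeasure_tilted hα ha hβ
  have hone := hprob 1
  -- each step appends one segment, by the Lévy property under the changed law
  induction n generalizing f with
  | zero =>
    have hzero := hprob 0
    have h1 : ∀ ω, (fun u => glue S (min u ((0 : ℕ) : ℝ≥0)) ω) = fun _ => 0 := fun ω => by
      funext u
      rw [Nat.cast_zero, min_eq_right (zero_le : 0 ≤ u), hS.glue_zero]
    have h2 : ∀ᵐ w ∂(tilted α a β P ((0 : ℕ) : ℝ≥0)),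
        f (negVal (stopProc ((0 : ℕ) : ℝ≥0) (lampertiPath α a w))) = f fun _ => 0 := by
      filter_upwards [tilted_absolutelyContinuous.ae_le (hP.ae_isDecreasingPath ha)] with w hw
      congr 1
      funext u
      simp only [negVal, stopProc, lampertiPath_eq]
      rw [Nat.cast_zero, min_eq_right (zero_le : 0 ≤ u), hw.lampertiOf_zero hα ha, valK_inl, neg_zero]
    simp only [h1]
    rw [lintegral_congr_ae h2]
    simp
  | succ n ih =>
    have hSm : Measurable fun w u => S u w := measurable_pi_lambda _ hS.measurable
    have hG : Measurable fun p : (ℝ≥0 → ℝ) × PathSpace => f (concat n (p.1, fun u => S u p.2)) :=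
      hf.comp ((measurable_concat n).comp (measurable_fst.prodMk (hSm.comp measurable_snd)))
    have hG2 : Measurable fun p : (ℝ≥0 → KilledReal) × (ℝ≥0 → KilledReal) =>
        f (concat n (negVal p.1, negVal (stopProc 1 p.2))) :=
      hf.comp ((measurable_concat n).comp ((measurable_negVal.comp measurable_fst).prodMk
        (measurable_negVal.comp ((measurable_stopProc 1).comp measurable_snd))))
    push_cast
    rw [hS.lintegral_glue_succ _ n hf,
      ih (f := fun x => ∫⁻ w, f (concat n (x, fun u => S u w)) ∂(tilted α a β P 1)) hG.lintegral_prod_right']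
    calc _ = ∫⁻ w, ∫⁻ w', f (concat n (negVal (stopProc n (lampertiPath α a w)),
          negVal (stopProc 1 (lampertiPath α a w')))) ∂(tilted α a β P 1) ∂(tilted α a β P n) := by
          refine lintegral_congr fun w => lintegral_congr_ae ?_
          filter_upwards [hSae] with w' hw'
          simp only [hw']
      _ = _ := (hP.lintegral_tilted_add hα ha n 1 hG2).symm
      _ = _ := by
          refine lintegral_congr_ae ?_
          filter_upwards [tilted_absolutelyContinuous.ae_le (hP.ae_isDecreasingPath ha),
            ae_tilted_alive] with w hw hal
          rw [negVal_stopProc_add (x := lampertiPath α a w) fun u hu => lamperti_ne_of_le hα hw hu hal]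

/-- Under the exponential change of measure, `-ξ` is a strict subordinator, realised here with paths
that are all non-decreasing and right-continuous. -/
theorem exists_tilted_subordinator (hP : IsUnitStableSubordinator α P) (hα : 0 < α) (ha : 0 < a)
    (hβ : α - 1 ≤ β) :
    ∃ (Ω' : Type) (_ : MeasurableSpace Ω') (P' : Measure Ω') (σ : ℝ≥0 → Ω' → ℝ),
      IsProbabilityMeasure P' ∧ IsSubordinator σ P' ∧ (∀ ω, σ 0 ω = 0) ∧
      (∀ ω, Monotone fun t => σ t ω) ∧
      (∀ ω t, ContinuousWithinAt (fun r => σ r ω) (Set.Ici t) t) ∧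
      ∀ (T : ℝ≥0) (f : (ℝ≥0 → ℝ) → ℝ≥0∞), Measurable f → ∫⁻ ω, f (fun u => σ (min u T) ω) ∂P' =
        ∫⁻ w, f (negVal (stopProc T (lampertiPath α a w))) ∂(tilted α a β P T) := by
  obtain ⟨S, hS, hSae⟩ := hP.exists_unitSegment hα ha β
  have hprob := hP.isProbabilityMeasure_tilted hα ha hβ
  have hone := hprob 1
  set P' := Measure.infinitePi fun _ : ℕ => tilted α a β P 1
  have hlaw : ∀ (T : ℝ≥0) (f : (ℝ≥0 → ℝ) → ℝ≥0∞), Measurable f →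
      ∫⁻ ω, f (fun u => glue S (min u T) ω) ∂P' =
        ∫⁻ w, f (negVal (stopProc T (lampertiPath α a w))) ∂(tilted α a β P T) := fun T f hf => by
    obtain ⟨n, hn⟩ := exists_nat_ge T
    obtain ⟨t, ht⟩ := le_iff_exists_add.1 hn
    have hst : Measurable fun (x : ℝ≥0 → ℝ) (u : ℝ≥0) => x (min u T) :=
      measurable_pi_lambda _ fun u => measurable_pi_apply _
    have h := hP.lintegral_glue hα ha hβ hS hSae n (f := fun x => f fun u => x (min u T)) (hf.comp hst)
    have e : ∀ u : ℝ≥0, min (min u T) (n : ℝ≥0) = min u T := fun u =>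
      min_eq_left ((min_le_right _ _).trans hn)
    have e2 : ∀ w, (fun u => negVal (stopProc n (lampertiPath α a w)) (min u T)) =
        negVal (stopProc T (lampertiPath α a w)) := fun w => by
      funext u; simp only [negVal, stopProc, e]
    simp only [e, e2] at h
    rw [h, ht]
    exact hP.lintegral_tilted_stop hα ha hβ T t (F := fun x => f (negVal x)) (hf.comp measurable_negVal)
  -- increments after `s` are independent of the past, and stationary
  have hpath : ∀ (s t : ℝ≥0) (F : (ℝ≥0 → ℝ) → ℝ≥0∞) (g : ℝ → ℝ≥0∞), Measurable F → Measurable g →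
      ∫⁻ ω, F (fun u => glue S (min u s) ω) * g (glue S (s + t) ω - glue S s ω) ∂P' =
        (∫⁻ ω, F (fun u => glue S (min u s) ω) ∂P') * ∫⁻ ω, g (glue S t ω) ∂P' := by
    intro s t F g hF hg
    have hst : Measurable fun (x : ℝ≥0 → ℝ) (u : ℝ≥0) => x (min u s) :=
      measurable_pi_lambda _ fun u => measurable_pi_apply _
    have hsub : Measurable fun x : ℝ≥0 → ℝ => x (s + t) - x s :=
      (measurable_pi_apply (s + t)).sub (measurable_pi_apply s)
    have h1 := hlaw (s + t) (fun x => F (fun u => x (min u s)) * g (x (s + t) - x s))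
      ((hF.comp hst).mul (hg.comp hsub))
    have e : ∀ u : ℝ≥0, min (min u s) (s + t) = min u s := fun u =>
      min_eq_left ((min_le_right _ _).trans le_self_add)
    simp only [e, min_self, min_eq_left (le_self_add : s ≤ s + t)] at h1
    have h2 := hlaw t (fun x => g (x t)) (hg.comp (measurable_pi_apply t))
    simp only [min_self] at h2
    have hG : Measurable fun p : (ℝ≥0 → KilledReal) × (ℝ≥0 → KilledReal) =>
        F (negVal p.1) * g (negVal p.2 t) :=
      (hF.comp (measurable_negVal.comp measurable_fst)).mul
        (hg.comp ((measurable_pi_apply t).comp (measurable_negVal.comp measurable_snd)))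
    have hgt : Measurable fun w => g (negVal (lampertiPath α a w) t) :=
      hg.comp ((measurable_pi_apply t).comp (measurable_negVal.comp (measurable_lampertiPath α a)))
    have hFs : Measurable fun w => F (negVal (stopProc s (lampertiPath α a w))) :=
      hF.comp (measurable_negVal.comp ((measurable_stopProc s).comp (measurable_lampertiPath α a)))
    rw [h1, hlaw s F hF, h2]
    calc _ = ∫⁻ w, F (negVal (stopProc s (lampertiPath α a w))) *
          g (negVal (incProc s (lampertiPath α a w)) t) ∂(tilted α a β P (s + t)) := by
          refine lintegral_congr_ae ?_
          filter_upwards [ae_tilted_alive] with w hw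
          rw [negVal_incProc (x := lampertiPath α a w) hw]
          simp only [negVal, stopProc, e, min_self, min_eq_left (le_self_add : s ≤ s + t)]
          rfl
      _ = _ := hP.lintegral_tilted_add hα ha s t hG
      _ = _ := by
          simp only [lintegral_const_mul _ hgt]
          rw [lintegral_mul_const _ hFs]
          simp only [negVal, stopProc, min_self]
  have hσm := hS.measurable_glue
  have hσd : ∀ s t, Measurable fun ω => glue S (s + t) ω - glue S s ω := fun s t => (hσm _).sub (hσm _)
  have hinc : ∀ s t, P'.map (fun ω => glue S (s + t) ω - glue S s ω) = P'.map (glue S t) := fun s t => by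
    refine Measure.ext fun C hC => ?_
    have h := hpath s t 1 (C.indicator 1) measurable_one (measurable_one.indicator hC)
    simp only [Pi.one_apply, one_mul, lintegral_one, measure_univ] at h
    rw [Measure.map_apply (hσd s t) hC, Measure.map_apply (hσm _) hC,
      ← lintegral_indicator_one ((hσd s t) hC), ← lintegral_indicator_one ((hσm t) hC)]
    exact h
  refine ⟨ℕ → PathSpace, inferInstance, P', glue S, inferInstance, ⟨hσm, ?_, ?_, hinc, ?_, ?_⟩,
    hS.glue_zero, hS.monotone_glue, hS.right_continuous_glue, hlaw⟩
  · exact Eventually.of_forall hS.glue_zero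
  · refine hasIndepIncrements_of_past fun s t B C hst hB hC => ?_
    obtain ⟨t, rfl⟩ := le_iff_exists_add.1 hst
    have hm1 : MeasurableSet {ω : ℕ → PathSpace | (fun u => glue S (min u s) ω) ∈ B} :=
      (measurable_pi_lambda _ fun u => hσm (min u s) : Measurable fun ω u => glue S (min u s) ω) hB
    have hm2 : MeasurableSet {ω | glue S (s + t) ω - glue S s ω ∈ C} := (hσd s t) hC
    have h := hpath s t (B.indicator 1) (C.indicator 1) (measurable_one.indicator hB)
      (measurable_one.indicator hC)
    have hC2 : P' {ω | glue S (s + t) ω - glue S s ω ∈ C} = ∫⁻ ω, C.indicator 1 (glue S t ω) ∂P' := by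
      have h3 := congrArg (fun m => m C) (hinc s t)
      beta_reduce at h3
      rw [Measure.map_apply (hσd s t) hC, Measure.map_apply (hσm _) hC,
        ← lintegral_indicator_one ((hσm t) hC)] at h3
      exact h3
    have hm12 : MeasurableSet {ω : ℕ → PathSpace | (fun u => glue S (min u s) ω) ∈ B ∧
        glue S (s + t) ω - glue S s ω ∈ C} := hm1.inter hm2
    rw [hC2, ← lintegral_indicator_one hm1, ← lintegral_indicator_one hm12]
    refine Eq.trans (lintegral_congr fun ω => ?_) h
    by_cases h1 : (fun u => glue S (min u s) ω) ∈ B <;>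
      by_cases h2 : glue S (s + t) ω - glue S s ω ∈ C <;>
      simp [Set.indicator, h1, h2]
  · exact Eventually.of_forall hS.monotone_glue
  · exact Eventually.of_forall hS.right_continuous_glue

end IsUnitStableSubordinator

/-! ### The law of the Lamperti transform under an exponential change of measure -/

lemma measurableSet_eval_eq (t : ℝ≥0) : MeasurableSet {x : ℝ≥0 → KilledReal | x t = cemetery} :=
  (measurable_pi_apply t : Measurable fun x : ℝ≥0 → KilledReal => x t) measurableSet_cemetery

lemma measurableSet_eval_ne (t : ℝ≥0) : MeasurableSet {x : ℝ≥0 → KilledReal | x t ≠ cemetery} :=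
  (measurableSet_eval_eq t).compl

/-- Two laws on paths in `ℝ ∪ {Δ}` coincide as soon as they agree, for every `t`, on the events that
the path is alive at `t` and its restriction to `[0, t]` is in a given set. -/
lemma ext_of_alive {μ ν : Measure (ℝ≥0 → KilledReal)} [IsProbabilityMeasure μ] [IsProbabilityMeasure ν]
    (h : ∀ (t : ℝ≥0) (B : Set (ℝ≥0 → KilledReal)), MeasurableSet B →
      μ {x | x t ≠ cemetery ∧ stopProc t x ∈ B} = ν {x | x t ≠ cemetery ∧ stopProc t x ∈ B}) : μ = ν := by
  let C : Set (Set (ℝ≥0 → KilledReal)) := {A | ∃ (t : ℝ≥0) (B : Set (ℝ≥0 → KilledReal)),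
    MeasurableSet B ∧ A = {x | x t ≠ cemetery ∧ stopProc t x ∈ B}}
  have halive : ∀ t, MeasurableSet {x : ℝ≥0 → KilledReal | x t ≠ cemetery} := measurableSet_eval_ne
  have hC : ∀ A ∈ C, MeasurableSet A := by
    rintro A ⟨t, B, hB, rfl⟩
    exact (halive t).inter (measurable_stopProc t hB)
  refine ext_of_generate_finite C ?_ ?_ ?_ (by simp)
  · apply le_antisymm
    · refine iSup_le fun t => ?_
      rintro _ ⟨D, hD, rfl⟩
      have h1 : MeasurableSet[MeasurableSpace.generateFrom C]
          {x : ℝ≥0 → KilledReal | x t ≠ cemetery ∧ stopProc t x ∈ (fun y => y t) ⁻¹' D} :=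
        MeasurableSpace.measurableSet_generateFrom ⟨t, _, measurable_pi_apply t hD, rfl⟩
      have h2 : MeasurableSet[MeasurableSpace.generateFrom C]
          {x : ℝ≥0 → KilledReal | x t ≠ cemetery ∧ stopProc t x ∈ Set.univ} :=
        MeasurableSpace.measurableSet_generateFrom ⟨t, _, MeasurableSet.univ, rfl⟩
      by_cases hΔ : cemetery ∈ D
      · convert h1.union h2.compl using 1
        ext x
        by_cases hx : x t = cemetery <;> simp [stopProc, hx, hΔ]
      · convert h1 using 1
        ext x
        by_cases hx : x t = cemetery <;> simp [stopProc, hx, hΔ]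
    · exact MeasurableSpace.generateFrom_le hC
  · have key : ∀ (s t : ℝ≥0) (B B' : Set (ℝ≥0 → KilledReal)), s ≤ t → MeasurableSet B → MeasurableSet B' →
        {x | x s ≠ cemetery ∧ stopProc s x ∈ B} ∩ {x | x t ≠ cemetery ∧ stopProc t x ∈ B'} ∈ C := by
      intro s t B B' hst hB hB'
      refine ⟨t, {y | y s ≠ cemetery ∧ stopProc s y ∈ B} ∩ B',
        ((halive s).inter (measurable_stopProc s hB)).inter hB', ?_⟩
      ext x
      have e : stopProc s (stopProc t x) = stopProc s x := by
        funext u; simp only [stopProc, min_assoc, min_eq_left hst]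
      have e2 : stopProc t x s = x s := by simp only [stopProc, min_eq_left hst]
      simp only [Set.mem_inter_iff, Set.mem_ofPred_eq, e, e2]
      tauto
    rintro _ ⟨s, B, hB, rfl⟩ _ ⟨t, B', hB', rfl⟩ -
    rcases le_total s t with hst | hst
    · exact key s t B B' hst hB hB'
    · rw [Set.inter_comm]
      exact key t s B' B hst hB' hB
  · rintro _ ⟨t, B, hB, rfl⟩
    exact h t B hB

/-- The law on `[0, ∞]` of an exponential time with parameter `q`, which is `∞` if `q = 0`. -/
lemma exists_exponential_time {q : ℝ} (hq : 0 ≤ q) : ∃ ν : Measure ℝ≥0∞, IsProbabilityMeasure ν ∧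
    ∀ t : ℝ≥0, ν (Set.Ioi t) = ENNReal.ofReal (Real.exp (-(q * t))) := by
  rcases eq_or_lt_of_le hq with rfl | hq
  · refine ⟨Measure.dirac ⊤, inferInstance, fun t => ?_⟩
    rw [Measure.dirac_apply' _ measurableSet_Ioi]
    simp
  · have hp := isProbabilityMeasure_expMeasure hq
    refine ⟨(expMeasure q).map ENNReal.ofReal,
      Measure.isProbabilityMeasure_map ENNReal.measurable_ofReal.aemeasurable, fun t => ?_⟩
    rw [Measure.map_apply ENNReal.measurable_ofReal measurableSet_Ioi]
    have h1 : ENNReal.ofReal ⁻¹' Set.Ioi (t : ℝ≥0∞) = (Set.Iic (t : ℝ))ᶜ := by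
      ext x
      simp only [Set.mem_preimage, Set.mem_Ioi, Set.compl_Iic]
      rw [← ENNReal.ofReal_coe_nnreal, ENNReal.ofReal_lt_ofReal_iff']
      constructor
      · exact fun h => h.1
      · exact fun h => ⟨h, t.2.trans_lt h⟩
    have h2 := cdf_expMeasure_eq hq t
    rw [cdf_eq_real, if_pos (NNReal.coe_nonneg t)] at h2
    rw [h1, prob_compl_eq_one_sub measurableSet_Iic, ← ofReal_measureReal, h2,
      ← ENNReal.ofReal_one, ← ENNReal.ofReal_sub _ (by
        have : Real.exp (-(q * t)) ≤ 1 := Real.exp_le_one_iff.2 (neg_nonpos.2 (mul_nonneg hq.le t.2))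
        linarith), sub_sub_cancel]

/-- Almost surely under a law with the Esscher property, `ξ` can be tested with functionals of its
path up to a fixed time. -/
lemma IsEsscherTransform.lintegral_stop {α a β : ℝ} {P Q : Measure PathSpace} [SFinite P]
    (hα : 0 < α) (ha : 0 < a) (hE : IsEsscherTransform β (lamperti α a) P Q)
    (hQ : ∀ᵐ w ∂Q, IsDecreasingPath a fun t => pssMp a t w) (t : ℝ≥0)
    {F : (ℝ≥0 → KilledReal) → ℝ≥0∞} (hF : Measurable F) :
    ∫⁻ w in {w | lamperti α a t w ≠ cemetery}, F (stopProc t (lampertiPath α a w)) ∂Q =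
      ∫⁻ w, F (stopProc t (lampertiPath α a w)) * ENNReal.ofReal (killedExp β (lamperti α a t w)) ∂P := by
  have hsp : Measurable fun w => stopProc t (lampertiPath α a w) :=
    (measurable_stopProc t).comp (measurable_lampertiPath α a)
  have hk : Measurable fun w => ENNReal.ofReal (killedExp β (lamperti α a t w)) :=
    measurable_killedExp_lamperti α a β t
  have hFs : Measurable fun w => F (stopProc t (lampertiPath α a w)) := hF.comp hsp
  have key : (Q.restrict {w | lamperti α a t w ≠ cemetery}).map (fun w => stopProc t (lampertiPath α a w)) =
      (P.withDensity fun w => ENNReal.ofReal (killedExp β (lamperti α a t w))).map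
        fun w => stopProc t (lampertiPath α a w) := by
    refine Measure.ext fun B hB => ?_
    rw [Measure.map_apply hsp hB, Measure.map_apply hsp hB, Measure.restrict_apply (hsp hB),
      withDensity_apply _ (hsp hB)]
    have hA : MeasurableSet[pastSigma (lamperti α a) t]
        ((fun w => stopProc t (lampertiPath α a w)) ⁻¹' B) := by
      rw [pastSigma_eq_comap]
      exact ⟨B, hB, rfl⟩
    rw [← hE t _ hA]
    refine measure_congr ?_
    filter_upwards [hQ] with w hw
    apply propext
    have := hw.lt_lifetime_lampertiOf_iff hα ha t
    rw [← lampertiPath_eq] at this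
    exact and_congr Iff.rfl this.symm
  have h := congrArg (fun m => ∫⁻ x, F x ∂m) key
  beta_reduce at h
  rw [lintegral_map hF hsp, lintegral_map hF hsp,
    lintegral_withDensity_eq_lintegral_mul _ hk hFs] at h
  rw [h]
  refine lintegral_congr fun w => ?_
  simp only [Pi.mul_apply]
  rw [mul_comm]

namespace IsUnitStableSubordinator

variable {α a β : ℝ} {P : Measure PathSpace} [IsProbabilityMeasure P]

/-- The law of `ξ` under a law with the Esscher property: the exponential change of measure makes
`-ξ` a strict subordinator up to any fixed time, at the price of a killing at the rate given by the
exponent. -/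
theorem isNegKilledSubordinator_of_isEsscherTransform (hP : IsUnitStableSubordinator α P) (hα : 0 < α)
    (ha : 0 < a) (hβ : α - 1 ≤ β) (hφ : 0 ≤ stableExponent α β) {Q : Measure PathSpace}
    [IsProbabilityMeasure Q] (hQ : ∀ᵐ w ∂Q, IsDecreasingPath a fun t => pssMp a t w)
    (hE : IsEsscherTransform β (lamperti α a) P Q) :
    IsNegKilledSubordinator (stableExponent α β) (lamperti α a) Q := by
  obtain ⟨Ω₁, m₁, P₁, σ, hP₁, hσ, hσ0, hσmono, hσrc, hσlaw⟩ := hP.exists_tilted_subordinator hα ha hβ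
  obtain ⟨ν, hν, hνtail⟩ := exists_exponential_time hφ
  set φ := stableExponent α β with hφdef
  -- `-σ` killed at an independent exponential time
  let Z : Ω₁ × ℝ≥0∞ → ℝ≥0 → KilledReal := fun ω t =>
    if (t : ℝ≥0∞) < ω.2 then Sum.inl (-(σ t ω.1)) else cemetery
  have hZm : Measurable Z := measurable_pi_lambda _ fun t => Measurable.ite
    (measurableSet_lt measurable_const measurable_snd)
    (measurable_inl.comp ((hσ.measurable t).comp measurable_fst).neg) measurable_const
  have hlam := measurable_lampertiPath α a
  have hlaw : Q.map (lampertiPath α a) = (P₁.prod ν).map Z := by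
    have := Measure.isProbabilityMeasure_map (μ := Q) hlam.aemeasurable
    have := Measure.isProbabilityMeasure_map (μ := P₁.prod ν) hZm.aemeasurable
    refine ext_of_alive fun t B hB => ?_
    have hm : MeasurableSet {x : ℝ≥0 → KilledReal | x t ≠ cemetery ∧ stopProc t x ∈ B} :=
      (measurableSet_eval_ne t).inter (measurable_stopProc t hB)
    rw [Measure.map_apply hlam hm, Measure.map_apply hZm hm]
    have hind : Measurable (B.indicator (1 : (ℝ≥0 → KilledReal) → ℝ≥0∞)) := measurable_one.indicator hB
    have hsp : Measurable fun w => stopProc t (lampertiPath α a w) := (measurable_stopProc t).comp hlam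
    -- the left-hand side, as an expectation under the changed law
    have h1 : Q (lampertiPath α a ⁻¹' {x | x t ≠ cemetery ∧ stopProc t x ∈ B}) =
        ∫⁻ w, B.indicator 1 (stopProc t (lampertiPath α a w)) *
          ENNReal.ofReal (killedExp β (lamperti α a t w)) ∂P := by
      rw [← hE.lintegral_stop hα ha hQ t hind, ← lintegral_indicator (measurableSet_alive α a t),
        ← lintegral_indicator_one (hlam hm)]
      refine lintegral_congr fun w => ?_
      have e : lampertiPath α a w t = lamperti α a t w := rfl
      by_cases h1 : lamperti α a t w ≠ cemetery <;>
        by_cases h2 : stopProc t (lampertiPath α a w) ∈ B <;>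
        simp [Set.indicator, e, h1, h2]
    -- the right-hand side
    let neg : (ℝ≥0 → ℝ) → ℝ≥0 → KilledReal := fun x u => Sum.inl (-(x u))
    have hneg : Measurable neg := measurable_pi_lambda _ fun u =>
      measurable_inl.comp (measurable_pi_apply u).neg
    have h2 : (P₁.prod ν) (Z ⁻¹' {x | x t ≠ cemetery ∧ stopProc t x ∈ B}) =
        P₁ {ω | neg (fun u => σ (min u t) ω) ∈ B} * ν (Set.Ioi t) := by
      rw [← Measure.prod_prod]
      congr 1
      ext ⟨ω, e⟩
      simp only [Set.mem_preimage, Set.mem_ofPred_eq, Set.mem_prod, Set.mem_Ioi, Z]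
      by_cases he : (t : ℝ≥0∞) < e
      · have hs : stopProc t (fun u : ℝ≥0 => if (u : ℝ≥0∞) < e then
            (Sum.inl (-(σ u ω)) : KilledReal) else cemetery) = neg (fun u => σ (min u t) ω) := by
          funext u
          simp only [stopProc, neg]
          rw [if_pos (lt_of_le_of_lt (ENNReal.coe_le_coe.2 (min_le_right u t)) he)]
        rw [if_pos he, hs]
        simp [he]
      · simp [he]
    have h3 : P₁ {ω | neg (fun u => σ (min u t) ω) ∈ B} =
        ∫⁻ w, B.indicator 1 (stopProc t (lampertiPath α a w)) ∂(tilted α a β P t) := by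
      have hm2 : MeasurableSet {ω | neg (fun u => σ (min u t) ω) ∈ B} :=
        (hneg.comp (measurable_pi_lambda _ fun u => hσ.measurable (min u t))) hB
      have h := hσlaw t (fun x => B.indicator 1 (neg x)) (hind.comp hneg)
      rw [← lintegral_indicator_one hm2]
      refine Eq.trans ?_ (h.trans (lintegral_congr_ae ?_))
      · exact lintegral_congr fun ω => by simp [Set.indicator]
      · filter_upwards [tilted_absolutelyContinuous.ae_le (hP.ae_isDecreasingPath ha),
          ae_tilted_alive] with w hw hal
        congr 1
        funext u
        simp only [neg, negVal, neg_neg]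
        exact (eq_inl_valK (lamperti_ne_of_le hα hw (min_le_right u t) hal)).symm
    have hBs : Measurable fun w => B.indicator (1 : (ℝ≥0 → KilledReal) → ℝ≥0∞)
        (stopProc t (lampertiPath α a w)) := hind.comp hsp
    rw [h1, h2, h3, hνtail, lintegral_tilted hBs, mul_comm (ENNReal.ofReal _) (∫⁻ w, _ ∂P),
      mul_assoc, ← ENNReal.ofReal_mul (Real.exp_pos _).le, ← Real.exp_add, ← hφdef, mul_comm φ]
    simp
  refine ⟨?_, Ω₁ × ℝ≥0∞, inferInstance, P₁.prod ν, fun t ω => σ t ω.1, Prod.snd, inferInstance, ?_,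
    measurable_snd, fun t => ?_, ?_, hlaw⟩
  · -- `ξ` does not explode before its lifetime, because `σ` does not
    have hbm : MeasurableSet {x : ℝ≥0 → KilledReal | ∀ n : ℕ, ∃ k : ℕ, ∀ q : ℚ, (q : ℝ).toNNReal ≤ n →
        x (q : ℝ).toNNReal ≠ cemetery → -(k : ℝ) ≤ valK (x (q : ℝ).toNNReal)} := by
      simp only [Set.ofPred_forall, Set.ofPred_exists]
      refine MeasurableSet.iInter fun n => MeasurableSet.iUnion fun k => MeasurableSet.iInter fun q =>
        MeasurableSet.iInter fun _ => ?_
      have e : {x : ℝ≥0 → KilledReal | x (q : ℝ).toNNReal ≠ cemetery → -(k : ℝ) ≤ valK (x (q : ℝ).toNNReal)} =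
        {x | x (q : ℝ).toNNReal = cemetery} ∪ {x | -(k : ℝ) ≤ valK (x (q : ℝ).toNNReal)} := by
        ext x; simp only [Set.mem_ofPred_eq, Set.mem_union]; tauto
      have := (measurableSet_eval_eq (q : ℝ).toNNReal).union
        (measurableSet_le (measurable_const (a := -(k : ℝ)))
        (measurable_valK.comp (measurable_pi_apply (X := fun _ : ℝ≥0 => KilledReal) (q : ℝ).toNNReal)))
      rw [e]
      exact this
    have hb : ∀ᵐ x ∂((P₁.prod ν).map Z), ∀ n : ℕ, ∃ k : ℕ, ∀ q : ℚ, (q : ℝ).toNNReal ≤ n →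
        x (q : ℝ).toNNReal ≠ cemetery → -(k : ℝ) ≤ valK (x (q : ℝ).toNNReal) := by
      rw [ae_map_iff hZm.aemeasurable hbm]
      refine Eventually.of_forall fun ω n => ?_
      obtain ⟨k, hk⟩ := exists_nat_ge (σ n ω.1)
      refine ⟨k, fun q hq hne => ?_⟩
      by_cases he : ((q : ℝ).toNNReal : ℝ≥0∞) < ω.2
      · simp only [Z, if_pos he, valK_inl]
        have := hσmono ω.1 hq
        simp only at this
        linarith
      · simp only [Z, if_neg he] at hne
        exact absurd rfl hne
    rw [← hlaw, ae_map_iff hlam.aemeasurable hbm] at hb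
    filter_upwards [hQ, hb] with w hw hbw
    have hk : IsKilledPath (lampertiPath α a w) := by
      rw [lampertiPath_eq]
      refine hw.isKilledPath_lampertiOf hα ha fun t => ?_
      obtain ⟨n, hn⟩ := exists_nat_ge t
      obtain ⟨k, hk⟩ := hbw n
      refine ⟨-(k : ℝ), fun s hs hne => ?_⟩
      -- pass from rational times to all times by right-continuity
      by_contra! hlt
      have hrc := hw.lampertiOf_right_continuous hα ha s
      have hopen : IsOpen {x : KilledReal | x ≠ cemetery ∧ valK x < -(k : ℝ)} :=
        isOpen_ne_cemetery.inter (isOpen_lt continuous_valK continuous_const)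
      have hev := hrc.eventually (hopen.mem_nhds ⟨hne, hlt⟩)
      have hev2 : ∀ᶠ u in 𝓝[>] s, (lampertiOf α a (fun t => pssMp a t w) u ≠ cemetery ∧
          valK (lampertiOf α a (fun t => pssMp a t w) u) < -(k : ℝ)) ∧ u < t :=
        (hev.filter_mono (nhdsWithin_mono _ Set.Ioi_subset_Ici_self)).and
          (mem_nhdsWithin_of_mem_nhds (Iio_mem_nhds hs))
      obtain ⟨v, hv, hvs⟩ := mem_nhdsGT_iff_exists_Ioo_subset.1 hev2
      obtain ⟨q, -, hq1, hq2⟩ := (NNReal.lt_iff_exists_rat_btwn _ _).1 hv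
      obtain ⟨⟨h1, h2⟩, h3⟩ := hvs ⟨hq1, hq2⟩
      have := hk q (h3.le.trans hn)
      rw [lampertiPath_eq] at this
      exact absurd (this h1) (not_le.2 h2)
    exact hk
  · have hmp : Measure.map Prod.fst (P₁.prod ν) = P₁ := Measure.map_fst_prod.trans (by simp)
    refine ⟨fun t => (hσ.measurable t).comp measurable_fst, Eventually.of_forall fun ω => hσ0 _, ?_, ?_,
      Eventually.of_forall fun ω => hσmono _, Eventually.of_forall fun ω => hσrc _⟩
    · intro n t ht
      have h := hσ.indep n t ht
      rw [iIndepFun_iff_measure_inter_preimage_eq_mul] at h ⊢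
      intro S sets hsets
      have hd : ∀ i : Fin n, Measurable fun ω => σ (t i.succ) ω - σ (t i.castSucc) ω :=
        fun i => (hσ.measurable _).sub (hσ.measurable _)
      have h1 := h S hsets
      rw [← hmp, Measure.map_apply measurable_fst
        (Finset.measurableSet_biInter S fun i hi => hd i (hsets i hi))] at h1
      refine Eq.trans ?_ (h1.trans (Finset.prod_congr rfl fun i hi => ?_))
      · congr 1
        ext ω
        simp
      · rw [Measure.map_apply measurable_fst (hd i (hsets i hi))]
        rfl
    · intro s t
      have h := hσ.stationary s t
      have hd : Measurable fun ω => σ (s + t) ω - σ s ω := (hσ.measurable _).sub (hσ.measurable _)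
      rw [← hmp, Measure.map_map hd measurable_fst,
        Measure.map_map (hσ.measurable _) measurable_fst] at h
      exact h
  · have : {ω : Ω₁ × ℝ≥0∞ | (t : ℝ≥0∞) < ω.2} = Set.univ ×ˢ Set.Ioi (t : ℝ≥0∞) := by
      ext ω; simp
    rw [this, Measure.prod_prod, hνtail]
    simp
  · have h := indepFun_prod (μ := P₁) (ν := ν) (X := fun ω t => σ t ω) (Y := fun e : ℝ≥0∞ => e)
      (measurable_pi_lambda _ hσ.measurable) measurable_id
    exact h.symm

/-- The Laplace exponent under an Esscher transform of parameter `β` is the original one shifted by `β`. -/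
lemma hasLaplaceExponentAt_of_isEsscherTransform (hP : IsUnitStableSubordinator α P) (hα : 0 < α)
    (ha : 0 < a) {Q : Measure PathSpace} (hQ : ∀ᵐ w ∂Q, IsDecreasingPath a fun t => pssMp a t w)
    (hE : IsEsscherTransform β (lamperti α a) P Q) {lam : ℝ} (hl : α - 1 ≤ lam + β) :
    HasLaplaceExponentAt (lamperti α a) Q lam (stableExponent α (lam + β)) := by
  have key : ∀ t : ℝ≥0, ∫ w, killedExp lam (lamperti α a t w) ∂Q =
      Real.exp (-(t * stableExponent α (lam + β))) := fun t => by
    rw [integral_eq_lintegral_of_nonneg_ae (Eventually.of_forall fun w => killedExp_nonneg _ _)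
      ((measurable_killedExp lam).comp (measurable_lamperti α a t)).aestronglyMeasurable]
    have hF : Measurable fun x : ℝ≥0 → KilledReal => ENNReal.ofReal (killedExp lam (x t)) :=
      ((measurable_killedExp lam).comp (measurable_pi_apply t)).ennreal_ofReal
    have h1 := hE.lintegral_stop hα ha hQ t hF
    have e : ∀ w, stopProc t (lampertiPath α a w) t = lamperti α a t w := fun w => by
      simp only [stopProc, min_self]; rfl
    simp only [e] at h1
    have h2 := setLIntegral_alive (α := α) (a := a) Q lam t 1
    simp only [Pi.one_apply, one_mul] at h2
    have h3 := hP.expMoment_eq hα ha hl t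
    rw [← h2, h1]
    have e2 : ∀ w, ENNReal.ofReal (killedExp lam (lamperti α a t w)) *
        ENNReal.ofReal (killedExp β (lamperti α a t w)) =
        ENNReal.ofReal (killedExp (lam + β) (lamperti α a t w)) := fun w => by
      rw [← ENNReal.ofReal_mul (killedExp_nonneg _ _)]
      congr 1
      by_cases h : lamperti α a t w = cemetery
      · simp only [h, killedExp_cemetery, mul_zero]
      · rw [eq_inl_valK h, killedExp_inl, killedExp_inl, killedExp_inl, ← Real.exp_add, add_mul]
    simp only [e2]
    rw [expMoment] at h3
    rw [h3, ENNReal.toReal_ofReal (Real.exp_pos _).le]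
  refine ⟨?_, key⟩
  rw [laplaceExponent, key, Real.log_exp]
  simp

end IsUnitStableSubordinator

/-- A law is its own Esscher transform of parameter `0`, so that the results for Esscher transforms include
`P` itself. -/
lemma isEsscherTransform_zero {α a : ℝ} (hα : 0 < α) (ha : 0 < a) {P : Measure PathSpace}
    (hP : ∀ᵐ w ∂P, IsDecreasingPath a fun t => pssMp a t w) :
    IsEsscherTransform 0 (lamperti α a) P P := by
  intro t A hA
  obtain ⟨B, hB, rfl⟩ := exists_of_measurableSet_pastFiltration hA
  have hBm : MeasurableSet {w | stopProc t (lampertiPath α a w) ∈ B} :=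
    ((measurable_stopProc t).comp (measurable_lampertiPath α a)) hB
  have h1 : P ({w | stopProc t (lampertiPath α a w) ∈ B} ∩ {w | (t : ℝ≥0∞) < lifetime fun s => lamperti α a s w}) =
      P ({w | stopProc t (lampertiPath α a w) ∈ B} ∩ {w | lamperti α a t w ≠ cemetery}) := by
    refine measure_congr ?_
    filter_upwards [hP] with w hw
    apply propext
    have := hw.lt_lifetime_lampertiOf_iff hα ha t
    rw [← lampertiPath_eq] at this
    exact and_congr Iff.rfl this
  rw [h1, Set.inter_comm, ← Measure.restrict_apply' hBm, ← lintegral_indicator_one (measurableSet_alive α a t)]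
  refine lintegral_congr fun w => ?_
  by_cases h : lamperti α a t w = cemetery
  · rw [Set.indicator_of_notMem (show w ∉ {w | lamperti α a t w ≠ cemetery} from fun h' => h' h), h,
      killedExp_cemetery]
    simp
  · rw [Set.indicator_of_mem (show w ∈ {w | lamperti α a t w ≠ cemetery} from h), eq_inl_valK h,
      killedExp_inl]
    simp

/-! ### The Doob transforms -/

/-- The function `(Y_t / a)^β` of the path, which is `0` from the absorption time of `Y` on. -/
noncomputable def powerDensity (a β : ℝ) (t : ℝ≥0) (w : PathSpace) : ℝ≥0∞ :=
  ENNReal.ofReal (if 0 < pssMp a t w then Real.exp (β * Real.log (pssMp a t w / a)) else 0)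

/-- The law `Q` has density `(Y_t / a)^β` with respect to `P` on the past of the coordinate process up
to `t`, in restriction to the event that the path is alive at `t`. -/
def IsPowerTransform (a β : ℝ) (P Q : Measure PathSpace) : Prop :=
  ∀ (t : ℝ≥0) (B : Set PathSpace), MeasurableSet B →
    Q ({w | stopPath t w ∈ B} ∩ {w | coord t w ≠ cemetery}) =
      ∫⁻ w in {w | stopPath t w ∈ B}, powerDensity a β t w ∂P

lemma measurable_powerDensity_uncurry (a β : ℝ) :
    Measurable fun p : ℝ≥0 × PathSpace => powerDensity a β p.1 p.2 := by
  have h := measurable_pssMp_uncurry a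
  exact (Measurable.ite (measurableSet_lt measurable_const h)
    (Real.measurable_exp.comp (((Real.measurable_log.comp (h.div_const a)).const_mul β)))
    measurable_const).ennreal_ofReal

lemma measurable_powerDensity (a β : ℝ) (t : ℝ≥0) : Measurable (powerDensity a β t) :=
  measurable_section (Z := fun t w => powerDensity a β t w) (measurable_powerDensity_uncurry a β) t

lemma powerDensity_of_pos {a β : ℝ} {t : ℝ≥0} {w : PathSpace} (h : 0 < pssMp a t w) :
    powerDensity a β t w = ENNReal.ofReal (killedExp β (Sum.inl (Real.log (pssMp a t w / a)))) := by
  rw [powerDensity, if_pos h, killedExp_inl]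

lemma powerDensity_of_eq_zero {a β : ℝ} {t : ℝ≥0} {w : PathSpace} (h : pssMp a t w = 0) :
    powerDensity a β t w = 0 := by
  rw [powerDensity, if_neg (by simp [h]), ENNReal.ofReal_zero]

lemma powerDensity_eq_rpow {a β : ℝ} (ha : 0 < a) {t : ℝ≥0} {w : PathSpace} (h : 0 < pssMp a t w) :
    powerDensity a β t w = ENNReal.ofReal ((pssMp a t w / a) ^ β) := by
  rw [powerDensity, if_pos h, Real.rpow_def_of_pos (div_pos h ha), mul_comm]

/-- The events in the past of the coordinate process at `t` are the events of the path stopped at `t`. -/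
lemma measurableSet_pastSigma_coord_iff {t : ℝ≥0} {A : Set PathSpace} :
    MeasurableSet[pastSigma coord t] A ↔ ∃ B : Set PathSpace, MeasurableSet B ∧ A = {w | stopPath t w ∈ B} := by
  constructor
  · intro hA
    obtain ⟨B, hB, rfl⟩ := exists_of_measurableSet_pastSigma hA
    exact ⟨Subtype.val ⁻¹' B, ⟨B, hB, rfl⟩, rfl⟩
  · rintro ⟨_, ⟨B, hB, rfl⟩, rfl⟩
    rw [pastSigma_eq_comap]
    exact ⟨B, hB, rfl⟩

/-- A Doob transform by a function which is a power of the distance to `a`. -/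
lemma isDoobTransform_iff {a β : ℝ} {h : ℝ → ℝ≥0∞} {P Q : Measure PathSpace} (ha : 0 < a)
    (h0 : ∀ x, a ≤ x → h x = 0) (hh : ∀ x, x < a → h x / h 0 = ENNReal.ofReal (((a - x) / a) ^ β)) :
    IsDoobTransform P h Q ↔ IsProbabilityMeasure Q ∧ IsPowerTransform a β P Q := by
  have key : ∀ t w, Sum.elim h (fun _ => 0) (coord t w) / h 0 = powerDensity a β t w := fun t w => by
    by_cases hp : 0 < pssMp a t w
    · have h1 := pssMp_pos_iff.1 hp
      rw [powerDensity_eq_rpow ha hp, pssMp_of_pos hp, ← hh _ h1.2, realCoord_eq]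
      conv_lhs => rw [eq_inl_valK h1.1]
      rfl
    · have hz : pssMp a t w = 0 := le_antisymm (not_lt.1 hp) (pssMp_nonneg a t w)
      rw [powerDensity_of_eq_zero hz]
      by_cases hc : coord t w = cemetery
      · rw [hc]; exact ENNReal.zero_div
      · have h2 : a ≤ valK (coord t w) := by
          rw [pssMp_pos_iff, realCoord_eq] at hp
          by_contra hlt
          exact hp ⟨hc, not_le.1 hlt⟩
        rw [eq_inl_valK hc, Sum.elim_inl, h0 _ h2, ENNReal.zero_div]
  refine and_congr Iff.rfl ⟨fun H t B hB => ?_, fun H t A hA => ?_⟩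
  · have h1 := H t _ (measurableSet_pastSigma_coord_iff.2 ⟨B, hB, rfl⟩)
    simp only [key, lt_lifetime_coord_iff] at h1
    exact h1
  · obtain ⟨B, hB, rfl⟩ := measurableSet_pastSigma_coord_iff.1 hA
    simp only [key, lt_lifetime_coord_iff]
    exact H t B hB

namespace IsPowerTransform

variable {α a β : ℝ} {P Q : Measure PathSpace}

lemma measurableSet_coord_ne (t : ℝ≥0) : MeasurableSet {w | coord t w ≠ cemetery} :=
  (measurable_coord t measurableSet_cemetery).compl

lemma lintegral_stopPath (hQ : IsPowerTransform a β P Q) [SFinite P] (t : ℝ≥0) {F : PathSpace → ℝ≥0∞}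
    (hF : Measurable F) :
    ∫⁻ w in {w | coord t w ≠ cemetery}, F (stopPath t w) ∂Q =
      ∫⁻ w, F (stopPath t w) * powerDensity a β t w ∂P := by
  have hs := measurable_stopPath t
  have hFs : Measurable fun w => F (stopPath t w) := hF.comp hs
  have key : (Q.restrict {w | coord t w ≠ cemetery}).map (stopPath t) =
      (P.withDensity (powerDensity a β t)).map (stopPath t) := by
    refine Measure.ext fun B hB => ?_
    rw [Measure.map_apply hs hB, Measure.map_apply hs hB, Measure.restrict_apply (hs hB),
      withDensity_apply _ (hs hB)]
    exact hQ t B hB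
  have h := congrArg (fun m => ∫⁻ x, F x ∂m) key
  beta_reduce at h
  rw [lintegral_map hF hs, lintegral_map hF hs,
    lintegral_withDensity_eq_lintegral_mul _ (measurable_powerDensity a β t) hFs] at h
  rw [h]
  refine lintegral_congr fun w => ?_
  simp only [Pi.mul_apply]
  rw [mul_comm]

/-- The transforming property determines a probability measure. -/
lemma unique {Q' : Measure PathSpace} [IsProbabilityMeasure Q] [IsProbabilityMeasure Q']
    (hQ : IsPowerTransform a β P Q) (hQ' : IsPowerTransform a β P Q') : Q = Q' := by
  have hval : Measurable (Subtype.val : PathSpace → ℝ≥0 → KilledReal) := measurable_subtype_coe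
  have h : Q.map (fun w => w.1) = Q'.map fun w => w.1 := by
    have := Measure.isProbabilityMeasure_map (μ := Q) hval.aemeasurable
    have := Measure.isProbabilityMeasure_map (μ := Q') hval.aemeasurable
    refine ext_of_alive fun t B hB => ?_
    have hm : MeasurableSet {x : ℝ≥0 → KilledReal | x t ≠ cemetery ∧ stopProc t x ∈ B} :=
      (measurableSet_eval_ne t).inter (measurable_stopProc t hB)
    have e : (fun w : PathSpace => w.1) ⁻¹' {x : ℝ≥0 → KilledReal | x t ≠ cemetery ∧ stopProc t x ∈ B} =
        {w | stopPath t w ∈ Subtype.val ⁻¹' B} ∩ {w | coord t w ≠ cemetery} := Set.inter_comm _ _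
    rw [Measure.map_apply hval hm, Measure.map_apply hval hm, e, hQ t _ (hval hB), hQ' t _ (hval hB)]
  have h2 := map_pathSpace_eq (f := fun w => w) (g := fun w => w) measurable_id measurable_id h
  rwa [Measure.map_id', Measure.map_id'] at h2

/-- Almost sure properties of `P` which only involve the path up to a time `t` are inherited by the
transform on the event that the path is alive at `t`. -/
lemma ae_of_ae (hQ : IsPowerTransform a β P Q) (t : ℝ≥0) {p : PathSpace → Prop}
    (hp : MeasurableSet {w | p w}) (h : ∀ᵐ w ∂P, p (stopPath t w)) :
    ∀ᵐ w ∂Q, coord t w ≠ cemetery → p (stopPath t w) := by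
  have h1 := hQ t {w | p w}ᶜ hp.compl
  rw [setLIntegral_measure_zero _ _ (by exact h)] at h1
  rw [ae_iff]
  refine measure_mono_null (fun w hw => ?_) h1
  simp only [Classical.not_imp, Set.mem_ofPred_eq] at hw
  exact ⟨hw.2, hw.1⟩

lemma ae_isDecreasingPath [IsProbabilityMeasure P] [IsProbabilityMeasure Q] (hQ : IsPowerTransform a β P Q)
    (ha : 0 < a) (hP : ∀ᵐ w ∂P, IsDecreasingPath a fun t => pssMp a t w) :
    ∀ᵐ w ∂Q, IsDecreasingPath a fun t => pssMp a t w := by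
  have hz0 : ∀ᵐ w ∂Q, coord 0 w ≠ cemetery := by
    have h := hQ 0 Set.univ MeasurableSet.univ
    have e : ∫⁻ w, powerDensity a β 0 w ∂P = 1 := by
      rw [← measure_univ (μ := P), ← lintegral_one]
      refine lintegral_congr_ae ?_
      filter_upwards [hP] with w hw
      have h1 : pssMp a 0 w = a := hw.zero
      have h2 : 0 < pssMp a 0 w := by rw [h1]; exact ha
      rw [powerDensity_of_pos h2, h1, div_self ha.ne']
      simp [killedExp_inl]
    simp only [Set.mem_univ, Set.ofPred_true, Set.univ_inter, Measure.restrict_univ, e] at h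
    exact (prob_compl_eq_zero_iff (measurableSet_coord_ne 0)).2 h
  have hz : ∀ᵐ w ∂Q, coord 0 w ≠ cemetery → pssMp a 0 (stopPath 0 w) = a := by
    refine hQ.ae_of_ae 0 (measurableSet_eq_fun (measurable_pssMp a 0) measurable_const) ?_
    filter_upwards [hP] with w hw
    rw [pssMp_stopPath, min_self]
    exact hw.zero
  have hanti : ∀ᵐ w ∂Q, ∀ q r : ℚ, (q : ℝ).toNNReal ≤ (r : ℝ).toNNReal →
      pssMp a (r : ℝ).toNNReal w ≤ pssMp a (q : ℝ).toNNReal w := by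
    rw [ae_all_iff]; intro q
    rw [ae_all_iff]; intro r
    by_cases hqr : (q : ℝ).toNNReal ≤ (r : ℝ).toNNReal
    · have h1 := hQ.ae_of_ae (r : ℝ).toNNReal
        (measurableSet_le (measurable_pssMp a (r : ℝ).toNNReal) (measurable_pssMp a (q : ℝ).toNNReal)) (by
          filter_upwards [hP] with w hw
          rw [pssMp_stopPath, pssMp_stopPath, min_self, min_eq_left hqr]
          exact hw.antitone hqr)
      filter_upwards [h1] with w hw _
      by_cases hc : coord (r : ℝ).toNNReal w = cemetery
      · rw [pssMp_of_eq hc]; exact pssMp_nonneg _ _ _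
      · have := hw hc
        rwa [pssMp_stopPath, pssMp_stopPath, min_self, min_eq_left hqr] at this
    · exact Eventually.of_forall fun w h => absurd h hqr
  filter_upwards [hz0, hz, hanti] with w h0 h1 h2
  have hstep : ∀ (q : ℚ) (t : ℝ≥0), (q : ℝ).toNNReal < t → pssMp a t w ≤ pssMp a (q : ℝ).toNNReal w := by
    intro q t hqt
    by_contra! hlt
    have hev := (pssMp_right_continuous a w t).eventually (Ioi_mem_nhds hlt)
    obtain ⟨v, hv, hvs⟩ := mem_nhdsGT_iff_exists_Ioo_subset.1
      (hev.filter_mono (nhdsWithin_mono _ Set.Ioi_subset_Ici_self))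
    obtain ⟨r, -, hr1, hr2⟩ := (NNReal.lt_iff_exists_rat_btwn _ _).1 hv
    exact absurd (h2 q r (hqt.trans hr1).le) (not_le.2 (hvs ⟨hr1, hr2⟩))
  exact
    { antitone := by
        intro s t hst
        rcases hst.eq_or_lt with rfl | hst
        · rfl
        by_contra! hlt
        have hev := (pssMp_right_continuous a w s).eventually (Iio_mem_nhds hlt)
        have hev2 := (hev.filter_mono (nhdsWithin_mono _ Set.Ioi_subset_Ici_self)).and
          (mem_nhdsWithin_of_mem_nhds (Iio_mem_nhds hst))
        obtain ⟨v, hv, hvs⟩ := mem_nhdsGT_iff_exists_Ioo_subset.1 hev2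
        obtain ⟨q, -, hq1, hq2⟩ := (NNReal.lt_iff_exists_rat_btwn _ _).1 hv
        obtain ⟨h3, h4⟩ := hvs ⟨hq1, hq2⟩
        exact absurd (hstep q t h4) (not_le.2 h3)
      nonneg := fun t => pssMp_nonneg a t w
      right_continuous := pssMp_right_continuous a w
      zero := by
        have := h1 h0
        rwa [pssMp_stopPath, min_self] at this }

/-- The Esscher property at almost every time: it is the transforming property at fixed times, read in
the time scale of `ξ`. -/
lemma ae_lintegral_alive [IsProbabilityMeasure P] [IsProbabilityMeasure Q] (hQ : IsPowerTransform a β P Q)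
    (hα : 0 < α) (ha : 0 < a) (hP : ∀ᵐ w ∂P, IsDecreasingPath a fun t => pssMp a t w) (s : ℝ≥0)
    {B : Set (ℝ≥0 → KilledReal)} (hB : MeasurableSet B) :
    ∀ᵐ t ∂halfLebesgue, s ≤ t →
      ∫⁻ w in {w | lamperti α a t w ≠ cemetery}, B.indicator 1 (stopProc s (lampertiPath α a w)) ∂Q =
        ∫⁻ w in {w | lamperti α a t w ≠ cemetery}, B.indicator 1 (stopProc s (lampertiPath α a w)) *
          ENNReal.ofReal (killedExp β (lamperti α a t w)) ∂P := by
  have hQd := hQ.ae_isDecreasingPath ha hP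
  have hind : Measurable fun w => B.indicator (1 : (ℝ≥0 → KilledReal) → ℝ≥0∞) (stopProc s (lampertiPath α a w)) :=
    (measurable_one.indicator hB).comp ((measurable_stopProc s).comp (measurable_lampertiPath α a))
  have hS1 : MeasurableSet {p : ℝ≥0 × PathSpace | lamperti α a p.1 p.2 ≠ cemetery} :=
    (measurable_lamperti_uncurry α a measurableSet_cemetery).compl
  have meas : ∀ (ρ : Measure PathSpace) [SFinite ρ] (G : ℝ≥0 × PathSpace → ℝ≥0∞), Measurable G →
      Measurable fun t => ∫⁻ w in {w | lamperti α a t w ≠ cemetery}, G (t, w) ∂ρ := fun ρ _ G hG => by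
    have e1 : ∀ s, ∫⁻ w in {w | lamperti α a s w ≠ cemetery}, G (s, w) ∂ρ =
        ∫⁻ w, {p : ℝ≥0 × PathSpace | lamperti α a p.1 p.2 ≠ cemetery}.indicator G (s, w) ∂ρ :=
      fun s => by
        rw [← lintegral_indicator (measurableSet_alive α a s)]
        rfl
    simp only [e1]
    exact (hG.indicator hS1).lintegral_prod_right'
  have hmul1 : Measurable fun p : ℝ≥0 × PathSpace =>
      B.indicator (1 : (ℝ≥0 → KilledReal) → ℝ≥0∞) (stopProc s (lampertiPath α a p.2)) :=
    hind.comp measurable_snd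
  have hmul2 : Measurable fun p : ℝ≥0 × PathSpace =>
      B.indicator (1 : (ℝ≥0 → KilledReal) → ℝ≥0∞) (stopProc s (lampertiPath α a p.2)) *
        ENNReal.ofReal (killedExp β (lamperti α a p.1 p.2)) :=
    hmul1.mul ((measurable_killedExp β).comp (measurable_lamperti_uncurry α a)).ennreal_ofReal
  refine (ae_restrict_iff' (measurableSet_Ici (a := s))).1 ?_
  refine ae_eq_of_forall_setLIntegral_eq_of_sigmaFinite (meas Q _ hmul1) (meas P _ hmul2)
    fun T hT _ => ?_
  rw [Measure.restrict_restrict hT]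
  set T' := T ∩ Set.Ici s with hT'
  have hT'm : MeasurableSet T' := hT.inter measurableSet_Ici
  have pull : ∀ (ρ : Measure PathSpace) [SFinite ρ] (_ : ∀ᵐ w ∂ρ, IsDecreasingPath a fun t => pssMp a t w)
      (G : ℝ≥0 × PathSpace → ℝ≥0∞), Measurable G →
      ∫⁻ t in T', ∫⁻ w in {w | lamperti α a t w ≠ cemetery}, G (t, w) ∂ρ ∂halfLebesgue =
      ∫⁻ u, ∫⁻ w in {w | 0 < pssMp a u w}, T'.indicator 1 (clockNN α a u w) *
        G (clockNN α a u w, w) * clockRate α a u w ∂ρ ∂halfLebesgue := fun ρ _ hR G hG => by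
    have hi : Measurable fun p : ℝ≥0 × PathSpace => T'.indicator (1 : ℝ≥0 → ℝ≥0∞) p.1 * G p :=
      ((measurable_one.indicator hT'm).comp measurable_fst).mul hG
    rw [← lintegral_time_change hα hR hi, ← lintegral_indicator hT'm]
    refine lintegral_congr fun t => ?_
    by_cases ht : t ∈ T' <;> simp [ht]
  rw [pull Q hQd _ hmul1, pull P hP _ hmul2]
  refine lintegral_congr fun u => ?_
  -- the past of the integrand only depends on the path stopped at `u`
  let Ψ : PathSpace → ℝ≥0∞ := {w | 0 < pssMp a u w}.indicator fun v => T'.indicator 1 (clockNN α a u v) *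
    B.indicator 1 (stopProc s (lampertiPath α a v)) * clockRate α a u v
  have hpos := measurableSet_pssMp_pos a u
  have hΨ : Measurable Ψ := ((((measurable_one.indicator hT'm).comp
    (measurable_section (measurable_clockNN_uncurry α a) u)).mul hind).mul
    (measurable_section (measurable_clockRate_uncurry α a) u)).indicator hpos
  have hfac : ∀ w, IsDecreasingPath a (fun t => pssMp a t w) → 0 < pssMp a u w →
      T'.indicator 1 (clockNN α a u w) * B.indicator 1 (stopProc s (lampertiPath α a w)) *
        clockRate α a u w = Ψ (stopPath u w) := by
    intro w hw hu
    have hm : stopPath u w ∈ {w | 0 < pssMp a u w} := by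
      show 0 < pssMp a u (stopPath u w)
      rwa [pssMp_stopPath, min_self]
    simp only [Ψ, Set.indicator_of_mem hm, clockNN_stopPath u hw, clockRate_stopPath]
    by_cases hT : clockNN α a u w ∈ T'
    · rw [stopProc_stopPath hα hw hu hT.2]
    · simp [hT]
  have hzero : ∀ w, ¬ 0 < pssMp a u w → Ψ (stopPath u w) = 0 := fun w hu =>
    Set.indicator_of_notMem (show stopPath u w ∉ {w | 0 < pssMp a u w} from fun h => hu (by
      have h' : 0 < pssMp a u (stopPath u w) := h
      rwa [pssMp_stopPath, min_self] at h')) _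
  calc _ = ∫⁻ w in {w | coord u w ≠ cemetery}, Ψ (stopPath u w) ∂Q := by
        rw [← lintegral_indicator hpos, ← lintegral_indicator (measurableSet_coord_ne u)]
        refine lintegral_congr_ae ?_
        filter_upwards [hQd] with w hw
        by_cases hu : 0 < pssMp a u w
        · rw [Set.indicator_of_mem (show w ∈ {w | 0 < pssMp a u w} from hu),
            Set.indicator_of_mem (show w ∈ {w | coord u w ≠ cemetery} from (pssMp_pos_iff.1 hu).1),
            hfac w hw hu]
        · rw [Set.indicator_of_notMem (show w ∉ {w | 0 < pssMp a u w} from hu)]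
          symm
          by_cases hc : coord u w ≠ cemetery
          · rw [Set.indicator_of_mem (show w ∈ {w | coord u w ≠ cemetery} from hc), hzero w hu]
          · rw [Set.indicator_of_notMem (show w ∉ {w | coord u w ≠ cemetery} from hc)]
    _ = ∫⁻ w, Ψ (stopPath u w) * powerDensity a β u w ∂P := hQ.lintegral_stopPath u hΨ
    _ = _ := by
        rw [← lintegral_indicator hpos]
        refine lintegral_congr_ae ?_
        filter_upwards [hP] with w hw
        by_cases hu : 0 < pssMp a u w
        · rw [Set.indicator_of_mem (show w ∈ {w | 0 < pssMp a u w} from hu), ← hfac w hw hu,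
            powerDensity_of_pos hu, lamperti_clockNN hα hw hu]
          ring
        · rw [Set.indicator_of_notMem (show w ∉ {w | 0 < pssMp a u w} from hu), hzero w hu, zero_mul]

/-- A Doob transform of the stable subordinator by a power of the distance to `a` is an Esscher transform
of the underlying process `ξ`. -/
theorem isEsscherTransform [IsProbabilityMeasure P] [IsProbabilityMeasure Q] (hQ : IsPowerTransform a β P Q)
    (hP : IsUnitStableSubordinator α P) (hα : 0 < α) (ha : 0 < a) (hβ : α - 1 ≤ β) :
    IsEsscherTransform β (lamperti α a) P Q := by
  intro s A hA
  obtain ⟨B, hB, rfl⟩ := exists_of_measurableSet_pastFiltration hA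
  have hPd := hP.ae_isDecreasingPath ha
  have hQd := hQ.ae_isDecreasingPath ha hPd
  have hsp : Measurable fun w => stopProc s (lampertiPath α a w) :=
    (measurable_stopProc s).comp (measurable_lampertiPath α a)
  have hBm : MeasurableSet {w | stopProc s (lampertiPath α a w) ∈ B} := hsp hB
  have hind : Measurable fun w => B.indicator (1 : (ℝ≥0 → KilledReal) → ℝ≥0∞) (stopProc s (lampertiPath α a w)) :=
    (measurable_one.indicator hB).comp hsp
  obtain ⟨v, hv1, hv⟩ := exists_seq_of_ae_ge (hQ.ae_lintegral_alive (α := α) hα ha hPd s hB)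
  have hvs : Tendsto v atTop (𝓝 s) := hv.mono_right nhdsWithin_le_nhds
  -- the left-hand side converges by right-continuity of `ξ` at `s`
  have hL : Tendsto (fun n => ∫⁻ w in {w | lamperti α a (v n) w ≠ cemetery},
      B.indicator 1 (stopProc s (lampertiPath α a w)) ∂Q) atTop
      (𝓝 (∫⁻ w in {w | lamperti α a s w ≠ cemetery}, B.indicator 1 (stopProc s (lampertiPath α a w)) ∂Q)) := by
    have e : ∀ t, ∫⁻ w in {w | lamperti α a t w ≠ cemetery}, B.indicator 1 (stopProc s (lampertiPath α a w)) ∂Q =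
        ∫⁻ w, {w | lamperti α a t w ≠ cemetery}.indicator
          (fun w => B.indicator 1 (stopProc s (lampertiPath α a w))) w ∂Q := fun t =>
      (lintegral_indicator (measurableSet_alive α a t) _).symm
    simp only [e]
    refine tendsto_lintegral_of_dominated_convergence (fun _ => 1)
      (fun n => hind.indicator (measurableSet_alive α a (v n))) (fun n => Eventually.of_forall fun w => ?_)
      (by simp) ?_
    · refine (Set.indicator_le_self _ _ w).trans ?_
      exact Set.indicator_le_self' (fun _ _ => zero_le_one) _
    · filter_upwards [hQd] with w hw
      by_cases hs : lamperti α a s w ≠ cemetery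
      · have hev := ((lamperti_right_continuous hα ha hw s).tendsto.comp hv).eventually
          (isOpen_ne_cemetery.mem_nhds hs)
        refine tendsto_const_nhds.congr' ?_
        filter_upwards [hev] with n hn
        rw [Set.indicator_of_mem (show w ∈ {w | lamperti α a s w ≠ cemetery} from hs),
          Set.indicator_of_mem (show w ∈ {w | lamperti α a (v n) w ≠ cemetery} from hn)]
      · refine tendsto_const_nhds.congr fun n => ?_
        rw [Set.indicator_of_notMem (show w ∉ {w | lamperti α a s w ≠ cemetery} from hs),
          Set.indicator_of_notMem (show w ∉ {w | lamperti α a (v n) w ≠ cemetery} from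
            fun h => hs (lamperti_ne_of_le hα hw (hv1 n).1 h))]
  -- the right-hand side converges because the exponential moments of `ξ` are continuous in time
  have e2 : ∀ t, ∫⁻ w in {w | lamperti α a t w ≠ cemetery}, B.indicator 1 (stopProc s (lampertiPath α a w)) *
      ENNReal.ofReal (killedExp β (lamperti α a t w)) ∂P =
      ∫⁻ w in {w | stopProc s (lampertiPath α a w) ∈ B}, ENNReal.ofReal (killedExp β (lamperti α a t w)) ∂P := by
    intro t
    rw [IsUnitStableSubordinator.setLIntegral_alive P β t
      fun w => B.indicator 1 (stopProc s (lampertiPath α a w)), ← lintegral_indicator hBm]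
    refine lintegral_congr fun w => ?_
    by_cases h : stopProc s (lampertiPath α a w) ∈ B <;> simp [Set.indicator, h]
  have hR : Tendsto (fun n => ∫⁻ w in {w | lamperti α a (v n) w ≠ cemetery},
      B.indicator 1 (stopProc s (lampertiPath α a w)) * ENNReal.ofReal (killedExp β (lamperti α a (v n) w)) ∂P)
      atTop (𝓝 (∫⁻ w in {w | stopProc s (lampertiPath α a w) ∈ B},
        ENNReal.ofReal (killedExp β (lamperti α a s w)) ∂P)) := by
    have e3 : ∀ n, ∫⁻ w in {w | stopProc s (lampertiPath α a w) ∈ B},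
        ENNReal.ofReal (killedExp β (lamperti α a (v n) w)) ∂P =
        ENNReal.ofReal (Real.exp (-((v n - s : ℝ≥0) * stableExponent α β))) *
        ∫⁻ w in {w | stopProc s (lampertiPath α a w) ∈ B},
          ENNReal.ofReal (killedExp β (lamperti α a s w)) ∂P := fun n => by
      have h := hP.lintegral_killedExp_add hα ha β s (v n - s) hB
      rw [add_tsub_cancel_of_le (hv1 n).1, hP.expMoment_eq hα ha hβ] at h
      exact h
    simp only [e2, e3]
    have hc : Tendsto (fun n => ENNReal.ofReal (Real.exp (-((v n - s : ℝ≥0) * stableExponent α β)))) atTop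
        (𝓝 1) := by
      have h1 : Tendsto (fun n => v n - s) atTop (𝓝 0) := by
        have := hvs.sub (tendsto_const_nhds (x := s))
        rwa [tsub_self] at this
      have hcont : Continuous fun x : ℝ≥0 => ENNReal.ofReal (Real.exp (-((x : ℝ) * stableExponent α β))) :=
        ENNReal.continuous_ofReal.comp (by fun_prop)
      have h2 := hcont.tendsto 0
      simp only [NNReal.coe_zero, zero_mul, neg_zero, Real.exp_zero, ENNReal.ofReal_one] at h2
      exact h2.comp h1
    have := ENNReal.Tendsto.mul_const (b := ∫⁻ w in {w | stopProc s (lampertiPath α a w) ∈ B},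
          ENNReal.ofReal (killedExp β (lamperti α a s w)) ∂P) hc (Or.inl one_ne_zero)
    rwa [one_mul] at this
  have hlim := tendsto_nhds_unique (hL.congr fun n => (hv1 n).2) hR
  rw [← hlim, ← lintegral_indicator (measurableSet_alive α a s)]
  have hAm : MeasurableSet ({w | stopProc s (lampertiPath α a w) ∈ B} ∩ {w | lamperti α a s w ≠ cemetery}) :=
    hBm.inter (measurableSet_alive α a s)
  have h1 : Q ({w | stopProc s (lampertiPath α a w) ∈ B} ∩ {w | (s : ℝ≥0∞) < lifetime fun r => lamperti α a r w}) =
      Q ({w | stopProc s (lampertiPath α a w) ∈ B} ∩ {w | lamperti α a s w ≠ cemetery}) := by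
    refine measure_congr ?_
    filter_upwards [hQd] with w hw
    apply propext
    have := hw.lt_lifetime_lampertiOf_iff hα ha s
    rw [← lampertiPath_eq] at this
    exact and_congr Iff.rfl this
  rw [h1, ← lintegral_indicator_one hAm]
  refine lintegral_congr fun w => ?_
  by_cases h1 : lamperti α a s w ≠ cemetery <;>
    by_cases h2 : stopProc s (lampertiPath α a w) ∈ B <;>
    simp [Set.indicator, h1, h2]

end IsPowerTransform

/-! ### Existence of the conditioned process -/

/-- The path killed at time `s`. -/
noncomputable def killPath (s : ℝ≥0) (w : PathSpace) : PathSpace :=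
  ⟨fun t => if t < s then w.1 t else cemetery, by
    refine ⟨fun t => ?_, fun t => ?_, fun r t h hr => ?_⟩
    · rcases lt_or_ge t s with h | h
      · refine (w.2.right_continuous t).congr_of_eventuallyEq ?_ (if_pos h)
        filter_upwards [mem_nhdsWithin_of_mem_nhds (Iio_mem_nhds h)] with u hu
        exact if_pos hu
      · refine continuousWithinAt_const.congr (fun u hu => if_neg (not_lt.2 (h.trans hu)))
          (if_neg (not_lt.2 h))
    · rcases le_or_gt t s with h | h
      · obtain ⟨l, hl⟩ := w.2.left_limit t
        refine ⟨l, hl.congr' ?_⟩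
        filter_upwards [self_mem_nhdsWithin] with u hu
        exact (if_pos ((Set.mem_Iio.1 hu).trans_le h)).symm
      · refine ⟨cemetery, tendsto_const_nhds.congr' ?_⟩
        filter_upwards [Ioo_mem_nhdsLT h] with u hu
        exact (if_neg (not_lt.2 hu.1.le)).symm
    · by_cases hts : t < s
      · simp only [if_pos hts]
        rw [if_pos (h.trans_lt hts)] at hr
        exact w.2.absorbed r t h hr
      · exact if_neg hts⟩

lemma indicator_one_congr {X Y : Type*} {A : Set X} {B : Set Y} {x : X} {y : Y} (h : x ∈ A ↔ y ∈ B) :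
    A.indicator (1 : X → ℝ≥0∞) x = B.indicator 1 y := by
  classical
  by_cases hx : x ∈ A
  · rw [Set.indicator_of_mem hx, Set.indicator_of_mem (h.1 hx), Pi.one_apply, Pi.one_apply]
  · rw [Set.indicator_of_notMem hx, Set.indicator_of_notMem (mt h.2 hx)]

lemma coord_killPath (s t : ℝ≥0) (w : PathSpace) :
    coord t (killPath s w) = if t < s then coord t w else cemetery := rfl

lemma measurable_killPath : Measurable fun p : ℝ≥0 × PathSpace => killPath p.1 p.2 := by
  refine measurable_pathSpace fun t => ?_
  simp only [coord_killPath]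
  exact Measurable.ite (measurableSet_lt measurable_const measurable_fst)
    ((measurable_coord t).comp measurable_snd) measurable_const

lemma stopPath_killPath {s t : ℝ≥0} (h : t < s) (w : PathSpace) :
    stopPath t (killPath s w) = stopPath t w := by
  apply Subtype.ext
  funext u
  exact if_pos ((min_le_right u t).trans_lt h)

namespace IsUnitStableSubordinator

variable {α a : ℝ} {P : Measure PathSpace} [IsProbabilityMeasure P]

/-- The renewal function with a strict inequality, which has the same value, and value `0` at negative
levels. -/
lemma lintegral_measure_lt (hP : IsUnitStableSubordinator α P) (hα : 0 < α) (x : ℝ) :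
    ∫⁻ r, P {w | realCoord r w < x} ∂halfLebesgue =
      ENNReal.ofReal ((max x 0) ^ α / Real.Gamma (1 + α)) := by
  have h := hP.lintegral_potential hα (measurable_one.indicator (measurableSet_Iio (a := x)))
  have e : ∀ r, ∫⁻ w, (Set.Iio x).indicator (1 : ℝ → ℝ≥0∞) (realCoord r w) ∂P =
      P {w | realCoord r w < x} := fun r => by
    rw [← lintegral_indicator_one (measurableSet_lt (measurable_realCoord r) measurable_const)]
    rfl
  simp only [e] at h
  have h2 := setLIntegral_rpow hα le_rfl (le_max_right x 0)
  rw [Real.zero_rpow hα.ne', zero_div, ENNReal.ofReal_zero, zero_add] at h2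
  rw [h, ← h2, ← Set.Ioi_inter_Iic, Set.inter_comm, ← Measure.restrict_restrict measurableSet_Iic,
    ← lintegral_indicator measurableSet_Iic]
  refine setLIntegral_congr_fun_ae measurableSet_Ioi ?_
  have hx : ∀ᵐ z : ℝ, z ≠ x := by simp [ae_iff]
  filter_upwards [hx] with z hz hz0
  have hz0' : ¬ z ≤ 0 := not_le.2 hz0
  by_cases hzx : z < x
  · simp [Set.indicator, hzx, hzx.le]
  · have : ¬ z ≤ x := fun h => hzx (lt_of_le_of_ne h hz)
    simp [Set.indicator, hzx, this, hz0']

/-- Integrating over a killing time, uniform on the set of times before the passage above `a`: the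
mass that is left after `t` is the renewal function at the distance to `a`. -/
lemma lintegral_killed (hP : IsUnitStableSubordinator α P) (hα : 0 < α) (ha : 0 < a) (t : ℝ≥0)
    {B : Set PathSpace} (hB : MeasurableSet B) :
    ∫⁻ s in Set.Ici t, ∫⁻ w, {w | stopPath t w ∈ B ∧ realCoord s w < a}.indicator 1 w ∂P ∂halfLebesgue =
      ENNReal.ofReal (a ^ α / Real.Gamma (1 + α)) *
        ∫⁻ w in {w | stopPath t w ∈ B}, powerDensity a α t w ∂P := by
  have hX := measurable_realCoord_uncurry
  have hBs : MeasurableSet {w | stopPath t w ∈ B} := measurable_stopPath t hB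
  let G : ℝ≥0 → PathSpace × PathSpace → ℝ≥0∞ := fun r =>
    {p | p.1 ∈ B ∧ realCoord t p.1 + realCoord r p.2 < a}.indicator 1
  have hGm : ∀ r, Measurable (G r) := fun r => by
    have hlt : MeasurableSet {p : PathSpace × PathSpace | realCoord t p.1 + realCoord r p.2 < a} :=
      measurableSet_lt (((measurable_realCoord t).comp measurable_fst).add ((measurable_realCoord r).comp measurable_snd)) measurable_const
    exact measurable_one.indicator ((measurable_fst hB).inter hlt)
  have hm : Measurable fun s => ∫⁻ w, {w | stopPath t w ∈ B ∧ realCoord s w < a}.indicator (1 : PathSpace → ℝ≥0∞) w ∂P := by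
    have hS : MeasurableSet {p : ℝ≥0 × PathSpace | stopPath t p.2 ∈ B ∧ realCoord p.1 p.2 < a} :=
      (measurable_snd hBs).inter (measurableSet_lt hX measurable_const)
    exact (measurable_one.indicator hS).lintegral_prod_right'
  have h1 := setLIntegral_halfLebesgue_Ici hm t 1 one_ne_zero
  simp only [one_mul, ENNReal.coe_one] at h1
  rw [h1]
  -- the Markov property at `t`
  have h2 : ∀ r, ∫⁻ w, {w | stopPath t w ∈ B ∧ realCoord (t + r) w < a}.indicator 1 w ∂P =
      ∫⁻ w, {w | stopPath t w ∈ B}.indicator 1 w * P {w' | realCoord r w' < a - realCoord t w} ∂P := by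
    intro r
    have hinner : Measurable fun w => ∫⁻ w', G r (w, w') ∂P := (hGm r).lintegral_prod_right'
    calc _ = ∫⁻ w, G r (stopPath t w, shiftPath t w) ∂P := by
          refine lintegral_congr_ae ?_
          filter_upwards [hP.ae_coord_ne] with w hw
          have e : realCoord t (stopPath t w) + realCoord r (shiftPath t w) = realCoord (t + r) w := by
            simp only [realCoord_eq, coord_stopPath, min_self, coord_shiftPath]
            rw [eq_inl_valK (hw (t + r)), eq_inl_valK (hw t)]
            simp
          refine indicator_one_congr ?_
          simp only [Set.mem_ofPred_eq]
          rw [e]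
      _ = ∫⁻ w, ∫⁻ w', G r (stopPath t w, w') ∂P ∂P := by
          rw [← lintegral_map (hGm r) ((measurable_stopPath t).prodMk (measurable_shiftPath t)),
            hP.map_stopPath_shiftPath t, lintegral_prod _ (hGm r).aemeasurable,
            lintegral_map hinner (measurable_stopPath t)]
      _ = _ := by
          refine lintegral_congr fun w => ?_
          have e : realCoord t (stopPath t w) = realCoord t w := by
            simp only [realCoord_eq, coord_stopPath, min_self]
          by_cases hw : stopPath t w ∈ B
          · rw [Set.indicator_of_mem (show w ∈ {w | stopPath t w ∈ B} from hw), Pi.one_apply, one_mul,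
              ← lintegral_indicator_one (measurableSet_lt (measurable_realCoord r) measurable_const)]
            refine lintegral_congr fun w' => ?_
            refine indicator_one_congr ?_
            simp only [Set.mem_ofPred_eq, e, hw, true_and, lt_sub_iff_add_lt']
          · rw [Set.indicator_of_notMem (show w ∉ {w | stopPath t w ∈ B} from hw), zero_mul]
            simp [G, hw]
  simp only [h2]
  have hjoint : Measurable fun p : ℝ≥0 × PathSpace => P {w' | realCoord p.1 w' < a - realCoord t p.2} := by
    have hS : MeasurableSet {q : (ℝ≥0 × PathSpace) × PathSpace | realCoord q.1.1 q.2 < a - realCoord t q.1.2} :=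
      measurableSet_lt (hX.comp ((measurable_fst.comp measurable_fst).prodMk measurable_snd))
        (((measurable_realCoord t).comp (measurable_snd.comp measurable_fst)).const_sub a)
    exact measurable_measure_prodMk_left hS
  have hmul : Measurable fun p : ℝ≥0 × PathSpace => {w | stopPath t w ∈ B}.indicator (1 : PathSpace → ℝ≥0∞) p.2 *
      P {w' | realCoord p.1 w' < a - realCoord t p.2} :=
    ((measurable_one.indicator hBs).comp measurable_snd).mul hjoint
  rw [lintegral_lintegral_swap (f := fun r w => {w | stopPath t w ∈ B}.indicator (1 : PathSpace → ℝ≥0∞) w *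
      P {w' | realCoord r w' < a - realCoord t w}) hmul.aemeasurable,
    ← lintegral_const_mul _ (measurable_powerDensity a α t), ← lintegral_indicator hBs]
  refine lintegral_congr_ae ?_
  filter_upwards [hP.ae_coord_ne] with w hw
  have hjw : Measurable fun x : ℝ≥0 => P {w' | realCoord x w' < a - realCoord t w} :=
    hjoint.comp measurable_prodMk_right
  rw [lintegral_const_mul _ hjw, hP.lintegral_measure_lt hα]
  by_cases hwB : stopPath t w ∈ B
  · rw [Set.indicator_of_mem (show w ∈ {w | stopPath t w ∈ B} from hwB),
      Set.indicator_of_mem (show w ∈ {w | stopPath t w ∈ B} from hwB), Pi.one_apply, one_mul,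
      ← pssMp_of_ne (hw t)]
    rcases (pssMp_nonneg a t w).eq_or_lt with h0 | h0
    · rw [powerDensity_of_eq_zero h0.symm, ← h0, Real.zero_rpow hα.ne']
      simp
    · rw [powerDensity_eq_rpow ha h0, ← ENNReal.ofReal_mul
        (div_nonneg (Real.rpow_nonneg ha.le _) (Real.Gamma_pos_of_pos (by linarith)).le),
        Real.div_rpow h0.le ha.le]
      congr 1
      have := (Real.rpow_pos_of_pos ha α).ne'
      field_simp
  · rw [Set.indicator_of_notMem (show w ∉ {w | stopPath t w ∈ B} from hwB),
      Set.indicator_of_notMem (show w ∉ {w | stopPath t w ∈ B} from hwB), zero_mul]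

/-- The conditioned process is obtained by killing the subordinator at a time chosen uniformly before
its passage above `a`, under the law biased by the passage time. -/
theorem exists_isPowerTransform_self (hP : IsUnitStableSubordinator α P) (hα : 0 < α) (ha : 0 < a) :
    ∃ Q : Measure PathSpace, IsProbabilityMeasure Q ∧ IsPowerTransform a α P Q := by
  have hX := measurable_realCoord_uncurry
  -- the total mass `U(a)`, which normalises the law of the killed path
  set c := ENNReal.ofReal (a ^ α / Real.Gamma (1 + α)) with hc
  have hc0 : c ≠ 0 := by
    have : 0 < a ^ α / Real.Gamma (1 + α) :=
      div_pos (Real.rpow_pos_of_pos ha _) (Real.Gamma_pos_of_pos (by linarith))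
    simpa [hc] using this
  have hctop : c ≠ ⊤ := ENNReal.ofReal_ne_top
  let S : Set (ℝ≥0 × PathSpace) := {p | realCoord p.1 p.2 < a}
  have hS : MeasurableSet S := measurableSet_lt hX measurable_const
  let M : Measure PathSpace := ((halfLebesgue.prod P).restrict S).map fun p => killPath p.1 p.2
  have hM : ∀ A : Set PathSpace, MeasurableSet A → M A =
      ∫⁻ s, ∫⁻ w, {w | killPath s w ∈ A ∧ realCoord s w < a}.indicator 1 w ∂P ∂halfLebesgue := fun A hA => by
    have h1 := measurable_killPath hA
    rw [Measure.map_apply measurable_killPath hA, Measure.restrict_apply h1,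
      ← lintegral_indicator_one (h1.inter hS), lintegral_prod _ (measurable_one.indicator (h1.inter hS)).aemeasurable]
    rfl
  have hQ : IsPowerTransform a α P (c⁻¹ • M) := fun t B hB => by
    have hE : MeasurableSet ({w | stopPath t w ∈ B} ∩ {w | coord t w ≠ cemetery}) :=
      (measurable_stopPath t hB).inter (IsPowerTransform.measurableSet_coord_ne t)
    have key : M ({w | stopPath t w ∈ B} ∩ {w | coord t w ≠ cemetery}) =
        c * ∫⁻ w in {w | stopPath t w ∈ B}, powerDensity a α t w ∂P := by
      rw [hM _ hE, ← hP.lintegral_killed hα ha t hB, ← lintegral_indicator measurableSet_Ici]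
      have hne : ∀ᵐ s ∂halfLebesgue, s ≠ t := by simp [ae_iff]
      refine lintegral_congr_ae ?_
      filter_upwards [hne] with s hst
      by_cases h : t < s
      · rw [Set.indicator_of_mem (show s ∈ Set.Ici t from h.le)]
        refine lintegral_congr_ae ?_
        filter_upwards [hP.ae_coord_ne] with w hw
        have e1 : coord t (killPath s w) ≠ cemetery := by rw [coord_killPath, if_pos h]; exact hw t
        have e2 : killPath s w ∈ {w | stopPath t w ∈ B} ∩ {w | coord t w ≠ cemetery} ↔ stopPath t w ∈ B := by
          rw [← stopPath_killPath h w]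
          exact and_iff_left e1
        refine indicator_one_congr ?_
        exact and_congr_left' e2
      · have h' : s ∉ Set.Ici t := fun h2 => h (lt_of_le_of_ne h2 (Ne.symm hst))
        rw [Set.indicator_of_notMem h']
        have e1 : ∀ w, coord t (killPath s w) = cemetery := fun w => by rw [coord_killPath, if_neg h]
        simp [Set.indicator, e1]
    rw [Measure.smul_apply, key, smul_eq_mul, ← mul_assoc, ENNReal.inv_mul_cancel hc0 hctop, one_mul]
  refine ⟨c⁻¹ • M, ⟨?_⟩, hQ⟩
  have hMu : M Set.univ = c := by
    have h := hP.lintegral_measure_lt hα a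
    rw [max_eq_left ha.le] at h
    rw [hM _ MeasurableSet.univ, hc, ← h]
    refine lintegral_congr fun s => ?_
    rw [← lintegral_indicator_one (measurableSet_lt (measurable_realCoord s) measurable_const)]
    refine lintegral_congr fun w => ?_
    simp [Set.indicator]
  rw [Measure.smul_apply, hMu, smul_eq_mul, ENNReal.inv_mul_cancel hc0 hctop]

end IsUnitStableSubordinator

/-! ### The inverse Lamperti transform -/

/-- The additive functional `∫_0^r exp (α x_u) du` of a path. -/
noncomputable def expClock (α : ℝ) (x : PathSpace) (r : ℝ≥0) : ℝ≥0∞ :=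
  ∫⁻ u in Set.Iic r, ENNReal.ofReal (killedExp α (coord u x)) ∂halfLebesgue

/-- The inverse of `a^α ∫_0^r exp (α x_u) du`, written as the length of a sublevel set. It is infinite if
the functional never exceeds its argument. -/
noncomputable def expInv (α a : ℝ) (x : PathSpace) (t : ℝ≥0) : ℝ≥0∞ :=
  halfLebesgue {u | expClock α x u ≤ ENNReal.ofReal (a ^ (-α) * t)}

open scoped Classical in
/-- The path `t ↦ a - a exp (x_r)`, where `r` is the value at `t` of the inverse clock of `x`, killed
when that value is infinite. -/
noncomputable def invLamperti (α a : ℝ) (x : PathSpace) (t : ℝ≥0) : KilledReal :=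
  if expInv α a x t ≠ ⊤ then Sum.inl (a - a * killedExp 1 (coord (expInv α a x t).toNNReal x)) else cemetery

lemma measurable_killedExp_coord_uncurry (α : ℝ) :
    Measurable fun p : ℝ≥0 × PathSpace => ENNReal.ofReal (killedExp α (coord p.1 p.2)) :=
  ((measurable_killedExp α).comp measurable_coord_uncurry).ennreal_ofReal

lemma measurable_killedExp_coord_path (α : ℝ) (x : PathSpace) :
    Measurable fun u => ENNReal.ofReal (killedExp α (coord u x)) :=
  (measurable_killedExp_coord_uncurry α).comp measurable_prodMk_right

lemma measurable_expClock_uncurry (α : ℝ) :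
    Measurable fun p : ℝ≥0 × PathSpace => expClock α p.2 p.1 := by
  have e : ∀ p : ℝ≥0 × PathSpace, expClock α p.2 p.1 = ∫⁻ u,
      {q : (ℝ≥0 × PathSpace) × ℝ≥0 | q.2 ≤ q.1.1}.indicator
        (fun q => ENNReal.ofReal (killedExp α (coord q.2 q.1.2))) (p, u) ∂halfLebesgue := fun p => by
    rw [expClock, ← lintegral_indicator measurableSet_Iic]
    rfl
  simp only [e]
  refine Measurable.lintegral_prod_right' (Measurable.indicator ?_ ?_)
  · exact (measurable_killedExp_coord_uncurry α).comp
      (measurable_snd.prodMk (measurable_snd.comp measurable_fst))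
  · exact measurableSet_le measurable_snd (measurable_fst.comp measurable_fst)

lemma measurable_expClock (α : ℝ) (r : ℝ≥0) : Measurable fun x => expClock α x r :=
  (measurable_expClock_uncurry α).comp measurable_prodMk_left

lemma measurable_expInv (α a : ℝ) (t : ℝ≥0) : Measurable fun x => expInv α a x t := by
  have hS : MeasurableSet {p : PathSpace × ℝ≥0 | expClock α p.1 p.2 ≤ ENNReal.ofReal (a ^ (-α) * t)} :=
    measurableSet_le ((measurable_expClock_uncurry α).comp measurable_swap) measurable_const
  exact measurable_measure_prodMk_left hS

lemma measurable_invLamperti (α a : ℝ) : Measurable fun x => invLamperti α a x := by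
  refine measurable_pi_lambda _ fun t => ?_
  have h := measurable_expInv α a t
  have hc : Measurable fun x => coord (expInv α a x t).toNNReal x :=
    measurable_coord_uncurry.comp (h.ennreal_toNNReal.prodMk measurable_id)
  exact Measurable.ite (h (measurableSet_singleton ⊤).compl)
    (measurable_inl.comp ((((measurable_killedExp 1).comp hc).const_mul a).const_sub a)) measurable_const

lemma expClock_mono (α : ℝ) (x : PathSpace) : Monotone (expClock α x) := fun _ _ h =>
  lintegral_mono_set (Set.Iic_subset_Iic.2 h)

lemma expClock_add (α : ℝ) (x : PathSpace) {r s : ℝ≥0} (h : r ≤ s) :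
    expClock α x s = expClock α x r +
      ∫⁻ u in Set.Ioc r s, ENNReal.ofReal (killedExp α (coord u x)) ∂halfLebesgue := by
  rw [expClock, expClock, ← lintegral_union measurableSet_Ioc, Set.Iic_union_Ioc_eq_Iic h]
  exact Set.disjoint_left.2 fun x hx hx' => absurd hx'.1 (not_lt.2 hx)

lemma expClock_zero (α : ℝ) (x : PathSpace) : expClock α x 0 = 0 := by
  rw [expClock, setLIntegral_measure_zero]
  simpa using halfLebesgue_Iic 0

lemma expClock_stopPath (α : ℝ) (x : PathSpace) {r T : ℝ≥0} (h : r ≤ T) :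
    expClock α (stopPath T x) r = expClock α x r := by
  refine setLIntegral_congr_fun measurableSet_Iic fun u hu => ?_
  simp only [coord_stopPath, min_eq_left (le_trans (Set.mem_Iic.1 hu) h)]

lemma expInv_mono {α a : ℝ} (ha : 0 < a) (x : PathSpace) : Monotone (expInv α a x) := fun s t h =>
  measure_mono fun u hu => le_trans (show expClock α x u ≤ _ from hu) (ENNReal.ofReal_le_ofReal (by
    have : (s : ℝ) ≤ t := by exact_mod_cast h
    gcongr))

lemma expInv_le {α a : ℝ} {x : PathSpace} {t T : ℝ≥0} (h : ENNReal.ofReal (a ^ (-α) * t) < expClock α x T) :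
    expInv α a x t ≤ T := by
  rw [← halfLebesgue_Iic]
  refine measure_mono fun u hu => ?_
  by_contra hcon
  exact absurd (h.trans_le (expClock_mono α x (not_le.1 hcon).le)) (not_lt.2 hu)

lemma expInv_ne_top_iff {α a : ℝ} {x : PathSpace} {t : ℝ≥0} :
    expInv α a x t ≠ ⊤ ↔ ∃ n : ℕ, ENNReal.ofReal (a ^ (-α) * t) < expClock α x n := by
  constructor
  · intro h
    by_contra! hcon
    refine h ?_
    have e : {u | expClock α x u ≤ ENNReal.ofReal (a ^ (-α) * t)} = Set.univ := by
      refine Set.eq_univ_of_forall fun u => ?_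
      obtain ⟨n, hn⟩ := exists_nat_ge u
      exact (expClock_mono α x hn).trans (hcon n)
    rw [expInv, e]
    refine ENNReal.eq_top_of_forall_nnreal_le fun r => ?_
    rw [← halfLebesgue_Iic]
    exact measure_mono (Set.subset_univ _)
  · rintro ⟨n, hn⟩
    exact ne_top_of_le_ne_top ENNReal.coe_ne_top (expInv_le hn)

lemma invLamperti_ne_iff {α a : ℝ} {x : PathSpace} {t : ℝ≥0} :
    invLamperti α a x t ≠ cemetery ↔ expInv α a x t ≠ ⊤ := by
  rw [invLamperti]
  split_ifs with h
  · exact iff_of_true (inl_ne_cemetery _) h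
  · exact iff_of_false (fun h' => h' rfl) h

/-- Up to the instants reached before the time `T` of `x`, the inverse transform only depends on `x`
stopped at `T`. -/
lemma invLamperti_stopPath {α a : ℝ} {x : PathSpace} {s T : ℝ≥0}
    (h : ENNReal.ofReal (a ^ (-α) * s) < expClock α x T) :
    invLamperti α a (stopPath T x) s = invLamperti α a x s := by
  have e : expInv α a (stopPath T x) s = expInv α a x s := by
    rw [expInv, expInv]
    congr 1
    ext u
    simp only [Set.mem_ofPred_eq]
    rcases le_total u T with hu | hu
    · rw [expClock_stopPath α x hu]
    · refine iff_of_false (not_le.2 ?_) (not_le.2 (h.trans_le (expClock_mono α x hu)))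
      refine lt_of_lt_of_le ?_ (expClock_mono α (stopPath T x) hu)
      rwa [expClock_stopPath α x le_rfl]
  have hle := expInv_le h
  have hT : (expInv α a x s).toNNReal ≤ T := by
    simpa using ENNReal.toNNReal_mono ENNReal.coe_ne_top hle
  simp only [invLamperti, e, coord_stopPath, min_eq_left hT]

/-- Non-increasing paths issued from `0` which are never killed. -/
structure IsUnkilledDecreasing (x : PathSpace) : Prop where
  alive : ∀ t, coord t x ≠ cemetery
  antitone : Antitone fun t => realCoord t x
  zero : coord 0 x = Sum.inl 0

namespace IsUnkilledDecreasing

variable {α a : ℝ} {x : PathSpace}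

lemma killedExp_coord (hx : IsUnkilledDecreasing x) (u : ℝ≥0) :
    killedExp α (coord u x) = Real.exp (α * realCoord u x) := by
  rw [eq_inl_valK (hx.alive u), killedExp_inl]
  rfl

lemma realCoord_nonpos (hx : IsUnkilledDecreasing x) (u : ℝ≥0) : realCoord u x ≤ 0 := by
  have h := hx.antitone (zero_le : 0 ≤ u)
  have h0 : realCoord 0 x = 0 := by rw [realCoord_eq, hx.zero, valK_inl]
  simp only [h0] at h
  exact h

lemma expClock_le (hα : 0 < α) (hx : IsUnkilledDecreasing x) {r s : ℝ≥0} (h : r ≤ s) :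
    expClock α x s ≤ expClock α x r + ((s - r : ℝ≥0) : ℝ≥0∞) := by
  rw [expClock_add α x h]
  gcongr
  calc _ ≤ ∫⁻ _ in Set.Ioc r s, 1 ∂halfLebesgue := by
        refine lintegral_mono fun u => ?_
        rw [hx.killedExp_coord, ← ENNReal.ofReal_one]
        refine ENNReal.ofReal_le_ofReal (Real.exp_le_one_iff.2 ?_)
        exact mul_nonpos_of_nonneg_of_nonpos hα.le (hx.realCoord_nonpos u)
    _ = _ := by rw [setLIntegral_one, halfLebesgue_Ioc h]

lemma expClock_ne_top (hα : 0 < α) (hx : IsUnkilledDecreasing x) (r : ℝ≥0) : expClock α x r ≠ ⊤ := by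
  have h := hx.expClock_le hα (zero_le : 0 ≤ r)
  rw [expClock_zero, zero_add] at h
  exact ne_top_of_le_ne_top ENNReal.coe_ne_top h

lemma expClock_strictMono (hα : 0 < α) (hx : IsUnkilledDecreasing x) : StrictMono (expClock α x) := by
  intro r s h
  rw [expClock_add α x h.le]
  refine ENNReal.lt_add_right (hx.expClock_ne_top hα r) fun h0 => ?_
  have h1 : ∫⁻ _ in Set.Ioc r s, ENNReal.ofReal (Real.exp (α * realCoord s x)) ∂halfLebesgue ≤ 0 := by
    rw [← h0]
    refine setLIntegral_mono (measurable_killedExp_coord_path α x) fun u hu => ?_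
    rw [hx.killedExp_coord]
    have := hx.antitone hu.2
    exact ENNReal.ofReal_le_ofReal (Real.exp_le_exp.2 (mul_le_mul_of_nonneg_left this hα.le))
  rw [setLIntegral_const, halfLebesgue_Ioc h.le] at h1
  have h2 : ENNReal.ofReal (Real.exp (α * realCoord s x)) ≠ 0 := by simpa using Real.exp_pos _
  have h3 : ((s - r : ℝ≥0) : ℝ≥0∞) ≠ 0 := by
    simpa [tsub_eq_zero_iff_le] using h
  exact mul_ne_zero h2 h3 (le_antisymm h1 zero_le)

lemma exists_expClock_eq (hα : 0 < α) (hx : IsUnkilledDecreasing x) {c : ℝ≥0∞} {v : ℝ≥0}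
    (h : c ≤ expClock α x v) : ∃ q ≤ v, expClock α x q = c := by
  have hfin := hx.expClock_ne_top hα
  have hlip : LipschitzWith 1 fun r => (expClock α x r).toReal := by
    refine LipschitzWith.of_le_add_mul 1 fun r s => ?_
    rcases le_total r s with hrs | hrs
    · have := ENNReal.toReal_mono (hfin s) (expClock_mono α x hrs)
      have h2 : 0 ≤ ((1 : ℝ≥0) : ℝ) * dist r s := by positivity
      linarith
    · have h1 := ENNReal.toReal_mono (ENNReal.add_ne_top.2 ⟨hfin s, ENNReal.coe_ne_top⟩)
        (hx.expClock_le hα hrs)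
      rw [ENNReal.toReal_add (hfin s) ENNReal.coe_ne_top, ENNReal.coe_toReal, NNReal.coe_sub hrs] at h1
      have h2 : (r : ℝ) - s ≤ dist r s := by rw [NNReal.dist_eq]; exact le_abs_self _
      simpa using h1.trans (add_le_add le_rfl h2)
  have h0 : (expClock α x 0).toReal ≤ c.toReal := by rw [expClock_zero]; simp
  obtain ⟨q, hq, hqc⟩ := intermediate_value_Icc (zero_le : 0 ≤ v) hlip.continuous.continuousOn
    ⟨h0, ENNReal.toReal_mono (hfin v) h⟩
  exact ⟨q, hq.2, (ENNReal.toReal_eq_toReal_iff' (hfin q) (ne_top_of_le_ne_top (hfin v) h)).1 hqc⟩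

lemma expInv_eq (hα : 0 < α) (hx : IsUnkilledDecreasing x) {q t : ℝ≥0}
    (h : expClock α x q = ENNReal.ofReal (a ^ (-α) * t)) : expInv α a x t = q := by
  rw [expInv, ← h, ← halfLebesgue_Iic]
  congr 1
  ext u
  exact (hx.expClock_strictMono hα).le_iff_le

/-- The inverse transform has a left limit at its lifetime because it is bounded there by `a`. -/
lemma isKilledPath_invLamperti (hα : 0 < α) (ha : 0 < a) (hx : IsUnkilledDecreasing x) :
    IsKilledPath (invLamperti α a x) := by
  have hdead : ∀ s t, s ≤ t → invLamperti α a x s = cemetery → invLamperti α a x t = cemetery := by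
    intro s t hst h
    by_contra hcon
    have h1 := invLamperti_ne_iff.1 hcon
    exact invLamperti_ne_iff.2 (ne_top_of_le_ne_top h1 (expInv_mono ha x hst)) h
  refine ⟨fun t => ?_, fun t => ?_, hdead⟩
  · by_cases ht : invLamperti α a x t = cemetery
    · exact (continuousWithinAt_const (b := cemetery)).congr (fun s hs => hdead t s hs ht) ht
    · obtain ⟨n, hn⟩ := expInv_ne_top_iff.1 (invLamperti_ne_iff.1 ht)
      obtain ⟨q, -, hq⟩ := hx.exists_expClock_eq hα hn.le
      have hval : ∀ {q s : ℝ≥0}, expClock α x q = ENNReal.ofReal (a ^ (-α) * s) →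
          invLamperti α a x s = Sum.inl (a - a * killedExp 1 (coord q x)) := fun {q s} h => by
        have := hx.expInv_eq hα h
        rw [invLamperti, this, if_pos ENNReal.coe_ne_top, ENNReal.toNNReal_coe]
      have hG : ContinuousWithinAt (fun u => (Sum.inl (a - a * killedExp 1 (coord u x)) : KilledReal))
          (Set.Ici q) q := by
        have hc : Continuous fun y : KilledReal => (Sum.inl (a - a * killedExp 1 y) : KilledReal) :=
          continuous_inl.comp (continuous_const.sub (continuous_const.mul (continuous_killedExp 1)))
        exact hc.continuousAt.comp_continuousWithinAt (x.2.right_continuous q)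
      rw [ContinuousWithinAt, hval hq]
      intro U hU
      obtain ⟨v, hv, hvU⟩ := mem_nhdsGE_iff_exists_Ico_subset.1 (hG hU)
      have hlt : ENNReal.ofReal (a ^ (-α) * t) < expClock α x v := by
        rw [← hq]; exact hx.expClock_strictMono hα hv
      have hcont : Continuous fun s : ℝ≥0 => ENNReal.ofReal (a ^ (-α) * s) :=
        ENNReal.continuous_ofReal.comp (by fun_prop)
      rw [mem_map]
      filter_upwards [mem_nhdsWithin_of_mem_nhds (hcont.continuousAt.eventually (gt_mem_nhds hlt)),
        self_mem_nhdsWithin] with s hs hts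
      have hs' : ENNReal.ofReal (a ^ (-α) * s) < expClock α x v := hs
      obtain ⟨q', -, hq'⟩ := hx.exists_expClock_eq hα hs'.le
      have h1 : q ≤ q' := by
        rw [← (hx.expClock_strictMono hα).le_iff_le, hq, hq']
        have : (t : ℝ) ≤ s := by exact_mod_cast hts
        exact ENNReal.ofReal_le_ofReal (by gcongr)
      have h2 : q' < v := by
        rw [← (hx.expClock_strictMono hα).lt_iff_lt, hq']
        exact hs'
      rw [Set.mem_preimage, hval hq']
      exact hvU ⟨h1, h2⟩
  · by_cases hall : ∀ s < t, invLamperti α a x s ≠ cemetery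
    · have hm : MonotoneOn (fun s => a - a * killedExp 1 (coord (expInv α a x s).toNNReal x)) (Set.Iio t) := by
        intro s hs s' hs' h
        have h1 : (expInv α a x s).toNNReal ≤ (expInv α a x s').toNNReal :=
          ENNReal.toNNReal_mono (invLamperti_ne_iff.1 (hall s' hs')) (expInv_mono ha x h)
        have h2 := hx.antitone h1
        simp only [hx.killedExp_coord, one_mul]
        have := Real.exp_le_exp.2 h2
        gcongr
      have hlim := MonotoneOn.tendsto_nhdsLT hm ⟨a, by
        rintro _ ⟨s, -, rfl⟩
        have := mul_nonneg ha.le (killedExp_nonneg 1 (coord (expInv α a x s).toNNReal x))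
        simp only
        linarith⟩
      refine ⟨Sum.inl _, ((continuous_inl.tendsto _).comp hlim).congr' ?_⟩
      filter_upwards [self_mem_nhdsWithin] with s hs
      rw [invLamperti, if_pos (invLamperti_ne_iff.1 (hall s hs))]
      rfl
    · push Not at hall
      obtain ⟨s, hs, hsd⟩ := hall
      refine ⟨cemetery, tendsto_const_nhds.congr' ?_⟩
      filter_upwards [Ioo_mem_nhdsLT hs] with s' hs'
      exact (hdead s s' hs'.1.le hsd).symm

end IsUnkilledDecreasing

/-- The inverse transform of the Lamperti transform `x` of a path `w` recovers `w`; moreover the clock of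
`x` at a time `T` before its death exceeds `a^(-α) t` exactly when the clock of `w` at `t` is less
than `T`. -/
lemma lt_expClock_iff {α a : ℝ} (hα : 0 < α) (ha : 0 < a) {w x : PathSpace}
    (hw : IsDecreasingPath a fun t => pssMp a t w) {T : ℝ≥0} (hT : lamperti α a T w ≠ cemetery)
    (hx : ∀ u ≤ T, coord u x = lamperti α a u w) (t : ℝ≥0) :
    (ENNReal.ofReal (a ^ (-α) * t) < expClock α x T ↔ 0 < pssMp a t w ∧ clockNN α a t w < T) ∧
      (ENNReal.ofReal (a ^ (-α) * t) < expClock α x T → invLamperti α a x t = coord t w) := by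
  have hT' := hT
  rw [lamperti_eq_lampertiOf] at hT'
  obtain ⟨r, hr, hrT⟩ := hw.exists_of_lampertiOf_ne hα hT'
  have hc : 0 < a ^ (-α) := Real.rpow_pos_of_pos ha _
  have hclock : ∀ q s : ℝ≥0, q ≤ r → clockOf α (fun t => pssMp a t w) q = s → s ≤ T →
      expClock α x s = ENNReal.ofReal (a ^ (-α) * q) := fun q s hqr hqs hsT => by
    rw [← hw.lintegral_exp_lampertiOf hα ha (hr.trans_le (hw.antitone hqr)) hqs]
    refine setLIntegral_congr_fun measurableSet_Iic fun u hu => ?_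
    simp only [hx u (le_trans hu hsT), lamperti_eq_lampertiOf]
  have hlt : ENNReal.ofReal (a ^ (-α) * t) < expClock α x T ↔ t < r := by
    rw [hclock r T le_rfl hrT le_rfl, ENNReal.ofReal_lt_ofReal_iff']
    constructor
    · rintro ⟨h, -⟩
      exact_mod_cast (mul_lt_mul_iff_right₀ hc).1 h
    · intro h
      have h' : (t : ℝ) < r := by exact_mod_cast h
      exact ⟨(mul_lt_mul_iff_right₀ hc).2 h', mul_pos hc (lt_of_le_of_lt t.2 h')⟩
  refine ⟨hlt.trans ⟨fun h => ?_, fun h => ?_⟩, fun h => ?_⟩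
  · have ht : 0 < pssMp a t w := hr.trans_le (hw.antitone h.le)
    refine ⟨ht, ?_⟩
    have h1 := (hw.clockOf_lt_iff hα ht).2 h
    rw [hrT, ← coe_clockNN hα hw ht] at h1
    exact_mod_cast h1
  · rw [← hw.clockOf_lt_iff hα h.1, hrT, ← coe_clockNN hα hw h.1]
    exact_mod_cast h.2
  · have htr := hlt.1 h
    have ht : 0 < pssMp a t w := hr.trans_le (hw.antitone htr.le)
    have hct := coe_clockNN hα hw ht
    have hlt' := (hw.clockOf_lt_iff hα ht).2 htr
    rw [hrT, ← hct] at hlt'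
    have hA : clockNN α a t w < T := by exact_mod_cast hlt'
    have hinv : expInv α a x t = clockNN α a t w := by
      rw [expInv, ← halfLebesgue_Iic]
      congr 1
      ext u
      simp only [Set.mem_ofPred_eq, Set.mem_Iic]
      rcases le_or_gt u T with hu | hu
      · obtain ⟨q, hqr, hq, hqu⟩ := hw.exists_of_le_clockOf (s := u) hα hr (by rw [hrT]; exact_mod_cast hu)
        rw [hclock q u hqr hqu hu, ENNReal.ofReal_le_ofReal_iff (mul_nonneg hc.le (NNReal.coe_nonneg t)),
          mul_le_mul_iff_right₀ hc, ← not_lt, ← not_lt, ← ENNReal.coe_lt_coe, hct, ← hqu,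
          hw.clockOf_lt_iff hα ht, NNReal.coe_lt_coe]
      · exact iff_of_false (not_le.2 (h.trans_le (expClock_mono α x hu.le))) (not_le.2 (hA.trans hu))
    rw [invLamperti, hinv, if_pos ENNReal.coe_ne_top, ENNReal.toNNReal_coe, hx _ hA.le,
      lamperti_clockNN hα hw ht, killedExp_inl, one_mul, Real.exp_log (div_pos ht ha),
      mul_div_cancel₀ _ ha.ne', pssMp_of_pos ht, sub_sub_cancel, realCoord_eq]
    exact (eq_inl_valK (pssMp_pos_iff.1 ht).1).symm

/-! ### Existence of the continuously absorbed process -/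

namespace IsUnitStableSubordinator

variable {α a β : ℝ} {P : Measure PathSpace} [IsProbabilityMeasure P]

/-- Almost surely under `P`, the path of `ξ` is càdlàg: the left limit at the lifetime is finite, as `-ξ` is
a killed subordinator. -/
lemma ae_isKilledPath (hP : IsUnitStableSubordinator α P) (hα0 : 0 < α) (hα1 : α < 1) (ha : 0 < a) :
    ∀ᵐ w ∂P, IsKilledPath (lampertiPath α a w) := by
  have hd := hP.ae_isDecreasingPath ha
  exact (hP.isNegKilledSubordinator_of_isEsscherTransform hα0 ha (by linarith)
    (stableExponent_pos hα0 (by linarith)).le hd (isEsscherTransform_zero hα0 ha hd)).1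

/-- The mass of the exponential density at the time `N` of `ξ` on an event of the past of `Y` up to a
time `t` that the clock reaches before `N`. -/
lemma lintegral_killedExp_of_clockNN_lt (hP : IsUnitStableSubordinator α P) (hα : 0 < α) (ha : 0 < a)
    (hβ : α - 1 ≤ β) (h0 : stableExponent α β = 0) (t N : ℝ≥0) {B : Set PathSpace} (hB : MeasurableSet B) :
    ∫⁻ w in {w | 0 < pssMp a t w}, {w | stopPath t w ∈ B ∧ clockNN α a t w < N}.indicator 1 w *
        ENNReal.ofReal (killedExp β (lamperti α a N w)) ∂P =
      ∫⁻ w in {w | 0 < pssMp a t w}, {w | stopPath t w ∈ B ∧ clockNN α a t w < N}.indicator 1 w *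
        powerDensity a β t w ∂P := by
  have hpos := measurableSet_pssMp_pos a t
  have hclock : Measurable (clockNN α a t) := measurable_section (measurable_clockNN_uncurry α a) t
  let S : Set PathSpace := {v | v ∈ B ∧ clockNN α a t v < N}
  have hlt : MeasurableSet {v | clockNN α a t v < N} := measurableSet_lt hclock measurable_const
  have hS : MeasurableSet S := hB.inter hlt
  let F : PathSpace × PathSpace → ℝ≥0∞ := fun p => S.indicator 1 p.1 * powerDensity a β t p.1 *
    ENNReal.ofReal (killedExp β (lamperti α a (N - clockNN α a t p.1) p.2))
  have hF : Measurable F := by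
    have h1 : Measurable fun p : PathSpace × PathSpace => lamperti α a (N - clockNN α a t p.1) p.2 :=
      measurable_comp_uncurry (measurable_lamperti_uncurry α a)
        ((hclock.comp measurable_fst).const_sub N) measurable_snd
    have h2 : Measurable fun p : PathSpace × PathSpace => S.indicator (1 : PathSpace → ℝ≥0∞) p.1 :=
      (measurable_one.indicator hS).comp measurable_fst
    have h3 : Measurable fun p : PathSpace × PathSpace => powerDensity a β t p.1 :=
      (measurable_powerDensity a β t).comp measurable_fst
    exact (h2.mul h3).mul ((measurable_killedExp β).comp h1).ennreal_ofReal
  have hpast : ∀ w, IsDecreasingPath a (fun t => pssMp a t w) →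
      ({w | stopPath t w ∈ B ∧ clockNN α a t w < N}.indicator 1 w : ℝ≥0∞) = S.indicator 1 (stopPath t w) :=
    fun w hw => indicator_one_congr (by
      show stopPath t w ∈ B ∧ clockNN α a t w < N ↔ stopPath t w ∈ B ∧ clockNN α a t (stopPath t w) < N
      rw [clockNN_stopPath t hw])
  have hdens : ∀ w, powerDensity a β t (stopPath t w) = powerDensity a β t w := fun w => by
    simp only [powerDensity, pssMp_stopPath, min_self]
  calc _ = ∫⁻ w in {w | 0 < pssMp a t w}, F (stopPath t w, restartPath α a t w) ∂P := by
        refine setLIntegral_congr_fun_ae hpos ?_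
        filter_upwards [hP.ae_isDecreasingPath ha] with w hw hu
        rw [hpast w hw]
        by_cases hwS : stopPath t w ∈ S
        · have hlt : clockNN α a t w < N := by
            have := hwS.2
            rwa [clockNN_stopPath t hw] at this
          have hN : lamperti α a N w = Sum.map (Real.log (pssMp a t w / a) + ·) id
              (lamperti α a (N - clockNN α a t w) (restartPath α a t w)) := by
            rw [← lamperti_add_clockNN hα ha hw hu, add_tsub_cancel_of_le hlt.le]
          simp only [F, Set.indicator_of_mem hwS, Pi.one_apply, one_mul, hdens,
            clockNN_stopPath t hw, powerDensity_of_pos hu]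
          rw [hN, ← ENNReal.ofReal_mul (killedExp_nonneg _ _)]
          congr 1
          rcases lamperti α a (N - clockNN α a t w) (restartPath α a t w) with y | y
          · simp only [Sum.map_inl, killedExp_inl, mul_add, Real.exp_add]
          · exact (mul_zero _).symm
        · simp only [F, Set.indicator_of_notMem hwS, zero_mul]
    _ = ∫⁻ w in {w | 0 < pssMp a t w}, ∫⁻ w', F (stopPath t w, w') ∂P ∂P :=
        hP.lintegral_restartPath ha t hF
    _ = _ := by
        refine setLIntegral_congr_fun_ae hpos ?_
        filter_upwards [hP.ae_isDecreasingPath ha] with w hw hu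
        have hm : Measurable fun w' => ENNReal.ofReal
            (killedExp β (lamperti α a (N - clockNN α a t (stopPath t w)) w')) :=
          measurable_killedExp_lamperti α a β _
        have h1 := hP.expMoment_eq hα ha hβ (N - clockNN α a t (stopPath t w))
        rw [h0, mul_zero, neg_zero, Real.exp_zero, ENNReal.ofReal_one, expMoment] at h1
        simp only [F]
        rw [lintegral_const_mul _ hm, h1, mul_one, hpast w hw, hdens]

/-- If the exponential functional of `ξ` is a martingale then the transform by the corresponding power of
the distance to `a` exists: its law is that of the inverse Lamperti transform of `-σ`, where `σ` is the
subordinator given by the exponential change of measure. -/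
theorem exists_isPowerTransform_of_stableExponent_eq_zero (hP : IsUnitStableSubordinator α P) (hα0 : 0 < α)
    (hα1 : α < 1) (ha : 0 < a) (hβ : α - 1 ≤ β) (h0 : stableExponent α β = 0) :
    ∃ Q : Measure PathSpace, IsProbabilityMeasure Q ∧ IsPowerTransform a β P Q := by
  obtain ⟨Ω₁, m₁, P₁, σ, hP₁, hσ, hσ0, hσmono, hσrc, hσlaw⟩ := hP.exists_tilted_subordinator hα0 ha hβ
  -- `-σ` as a path in `𝔻`
  let X : Ω₁ → PathSpace := fun ω => ⟨fun t => Sum.inl (-(σ t ω)), fun t =>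
      continuous_inl.continuousAt.comp_continuousWithinAt (hσrc ω t).neg,
    fun t => ⟨_, (continuous_inl.tendsto _).comp ((hσmono ω).tendsto_nhdsLT t).neg⟩,
    fun s t _ h => absurd h (inl_ne_cemetery _)⟩
  have hXc : ∀ t ω, coord t (X ω) = Sum.inl (-(σ t ω)) := fun t ω => rfl
  have hX : Measurable X := measurable_pathSpace fun t => measurable_inl.comp (hσ.measurable t).neg
  have hXnice : ∀ ω, IsUnkilledDecreasing (X ω) := fun ω =>
    { alive := fun t => inl_ne_cemetery _
      antitone := fun s t h => neg_le_neg (hσmono ω h)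
      zero := by rw [hXc, hσ0, neg_zero] }
  let J : Ω₁ → PathSpace := fun ω =>
    ⟨invLamperti α a (X ω), (hXnice ω).isKilledPath_invLamperti hα0 ha⟩
  have hJ : Measurable J := ((measurable_invLamperti α a).comp hX).subtype_mk
  -- `ξ` as a path in `𝔻`
  obtain ⟨G, hGm, hG, hGae⟩ := exists_measurable_of_ae (hP.ae_isKilledPath hα0 hα1 ha)
  classical
  let Ξ : PathSpace → PathSpace := fun w => if h : w ∈ G then ⟨lampertiPath α a w, hG w h⟩ else w
  have hΞc : ∀ w ∈ G, ∀ u, coord u (Ξ w) = lamperti α a u w := fun w hw u => by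
    simp only [Ξ, dif_pos hw]; rfl
  have hΞ : Measurable Ξ := by
    refine measurable_pathSpace fun u => ?_
    have e : (fun w => coord u (Ξ w)) = fun w => if w ∈ G then lamperti α a u w else coord u w := by
      funext w
      by_cases hw : w ∈ G
      · rw [hΞc w hw, if_pos hw]
      · simp only [Ξ, dif_neg hw, if_neg hw]
    rw [e]
    exact Measurable.ite hGm (measurable_lamperti α a u) (measurable_coord u)
  -- up to time `N`, the path `-σ` has the law of `ξ` under the changed measure
  have hlaw : ∀ N : ℝ≥0, P₁.map (fun ω => stopPath N (X ω)) =
      (tilted α a β P N).map fun w => stopPath N (Ξ w) := fun N => by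
    have hm1 := (measurable_stopPath N).comp hX
    have hm2 := (measurable_stopPath N).comp hΞ
    refine map_pathSpace_eq hm1 hm2 (Measure.ext fun B hB => ?_)
    have hv1 : Measurable fun ω => (stopPath N (X ω)).1 := measurable_subtype_coe.comp hm1
    have hv2 : Measurable fun w => (stopPath N (Ξ w)).1 := measurable_subtype_coe.comp hm2
    let neg : (ℝ≥0 → ℝ) → ℝ≥0 → KilledReal := fun x u => Sum.inl (-(x u))
    have hneg : Measurable neg := measurable_pi_lambda _ fun u =>
      measurable_inl.comp (measurable_pi_apply u).neg
    have h := hσlaw N (fun x => B.indicator 1 (neg x)) ((measurable_one.indicator hB).comp hneg)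
    rw [Measure.map_apply hv1 hB, Measure.map_apply hv2 hB, ← lintegral_indicator_one (hv1 hB),
      ← lintegral_indicator_one (hv2 hB)]
    refine Eq.trans (lintegral_congr fun ω => indicator_one_congr Iff.rfl)
      (h.trans (lintegral_congr_ae ?_))
    filter_upwards [tilted_absolutelyContinuous.ae_le (hP.ae_isDecreasingPath ha),
      tilted_absolutelyContinuous.ae_le hGae, ae_tilted_alive] with w hw hwG hal
    refine indicator_one_congr ?_
    have e : neg (negVal (stopProc N (lampertiPath α a w))) = (stopPath N (Ξ w)).1 := by
      funext u
      have h1 : (stopPath N (Ξ w)).1 u = lamperti α a (min u N) w := hΞc w hwG (min u N)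
      rw [h1]
      simp only [neg, negVal, neg_neg]
      exact (eq_inl_valK (lamperti_ne_of_le hα0 hw (min_le_right u N) hal)).symm
    rw [e]
    rfl
  have hc : 0 < a ^ (-α) := Real.rpow_pos_of_pos ha _
  refine ⟨P₁.map J, Measure.isProbabilityMeasure_map hJ.aemeasurable, fun t B hB => ?_⟩
  obtain ⟨B', hB', rfl⟩ := hB
  have hBm : MeasurableSet (Subtype.val ⁻¹' B' : Set PathSpace) := ⟨B', hB', rfl⟩
  have hE : MeasurableSet ({w | stopPath t w ∈ (Subtype.val ⁻¹' B' : Set PathSpace)} ∩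
      {w | coord t w ≠ cemetery}) :=
    (measurable_stopPath t hBm).inter (IsPowerTransform.measurableSet_coord_ne t)
  -- the event in terms of `-σ`, cut according to the time of `-σ` which is reached at `t`
  let S : ℕ → Set PathSpace := fun N =>
    {x | stopProc t (invLamperti α a x) ∈ B' ∧ ENNReal.ofReal (a ^ (-α) * t) < expClock α x N}
  have hS : ∀ N, MeasurableSet (S N) := fun N =>
    (((measurable_stopProc t).comp (measurable_invLamperti α a)) hB').inter
      (measurableSet_lt measurable_const (measurable_expClock α N))
  have hSmono : Monotone fun N => X ⁻¹' S N := fun N M h ω hω =>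
    ⟨hω.1, hω.2.trans_le (expClock_mono α _ (by exact_mod_cast h))⟩
  have hpre : J ⁻¹' ({w | stopPath t w ∈ (Subtype.val ⁻¹' B' : Set PathSpace)} ∩
      {w | coord t w ≠ cemetery}) = ⋃ N, X ⁻¹' S N := by
    ext ω
    have h1 : ω ∈ J ⁻¹' ({w | stopPath t w ∈ (Subtype.val ⁻¹' B' : Set PathSpace)} ∩
      {w | coord t w ≠ cemetery}) ↔ stopProc t (invLamperti α a (X ω)) ∈ B' ∧
        invLamperti α a (X ω) t ≠ cemetery := Iff.rfl
    rw [h1, invLamperti_ne_iff, expInv_ne_top_iff, Set.mem_iUnion, ← exists_and_left]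
    rfl
  have hle : ∀ u, ENNReal.ofReal (a ^ (-α) * (min u t : ℝ≥0)) ≤ ENNReal.ofReal (a ^ (-α) * t) := fun u => by
    have : ((min u t : ℝ≥0) : ℝ) ≤ t := by exact_mod_cast min_le_right u t
    exact ENNReal.ofReal_le_ofReal (by gcongr)
  have hSstop : ∀ (N : ℕ) x, stopPath N x ∈ S N ↔ x ∈ S N := fun N x => by
    simp only [S, Set.mem_ofPred_eq, expClock_stopPath α x le_rfl]
    refine and_congr_left fun h => ?_
    have e : stopProc t (invLamperti α a (stopPath N x)) = stopProc t (invLamperti α a x) := by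
      funext u
      exact invLamperti_stopPath ((hle u).trans_lt h)
    rw [e]
  set ρ := P.withDensity (powerDensity a β t) with hρ
  let A : ℕ → Set PathSpace := fun N =>
    {w | 0 < pssMp a t w} ∩ {w | stopPath t w ∈ (Subtype.val ⁻¹' B' : Set PathSpace) ∧ clockNN α a t w < N}
  have hclock : Measurable (clockNN α a t) := measurable_section (measurable_clockNN_uncurry α a) t
  have hA0 : ∀ N : ℕ, MeasurableSet {w | stopPath t w ∈ (Subtype.val ⁻¹' B' : Set PathSpace) ∧
      clockNN α a t w < N} := fun N => by
    have hlt : MeasurableSet {w | clockNN α a t w < N} := measurableSet_lt hclock measurable_const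
    exact (measurable_stopPath t hBm).inter hlt
  have hA : ∀ N, MeasurableSet (A N) := fun N => (measurableSet_pssMp_pos a t).inter (hA0 N)
  have hAmono : Monotone A := fun N M h w hw =>
    ⟨hw.1, hw.2.1, hw.2.2.trans_le (by exact_mod_cast h)⟩
  -- in terms of `Y`, the cut-off says that the clock at `t` is less than `N`
  have hN : ∀ N : ℕ, P₁ (X ⁻¹' S N) = ρ (A N) := fun N => by
    have hm1 : Measurable fun ω => stopPath N (X ω) := (measurable_stopPath N).comp hX
    have hm2 : Measurable fun w => stopPath N (Ξ w) := (measurable_stopPath N).comp hΞ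
    have e1 : P₁ (X ⁻¹' S N) = (tilted α a β P N) ((fun w => stopPath N (Ξ w)) ⁻¹' S N) := by
      rw [← Measure.map_apply hm2 (hS N), ← hlaw N, Measure.map_apply hm1 (hS N)]
      congr 1
      ext ω
      exact (hSstop N (X ω)).symm
    have e2 : (fun w => stopPath N (Ξ w)) ⁻¹' S N =ᵐ[tilted α a β P N] A N := by
      filter_upwards [tilted_absolutelyContinuous.ae_le (hP.ae_isDecreasingPath ha),
        tilted_absolutelyContinuous.ae_le hGae, ae_tilted_alive] with w hw hwG hal
      apply propext
      have hx : ∀ u ≤ (N : ℝ≥0), coord u (stopPath N (Ξ w)) = lamperti α a u w := fun u hu => by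
        rw [coord_stopPath, min_eq_left hu, hΞc w hwG]
      have h1 := lt_expClock_iff hα0 ha hw hal hx t
      show (stopProc t (invLamperti α a (stopPath N (Ξ w))) ∈ B' ∧
        ENNReal.ofReal (a ^ (-α) * t) < expClock α (stopPath N (Ξ w)) N) ↔
        0 < pssMp a t w ∧ (stopPath t w).1 ∈ B' ∧ clockNN α a t w < N
      rw [and_left_comm, ← h1.1]
      refine and_congr_left fun h => ?_
      have e : stopProc t (invLamperti α a (stopPath N (Ξ w))) = (stopPath t w).1 := by
        funext u
        exact (lt_expClock_iff hα0 ha hw hal hx (min u t)).2 ((hle u).trans_lt h)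
      rw [e]
    rw [e1, measure_congr e2, ← lintegral_indicator_one (hA N),
      lintegral_tilted (measurable_one.indicator (hA N)), h0, mul_zero, Real.exp_zero, ENNReal.ofReal_one,
      one_mul, hρ, withDensity_apply _ (hA N)]
    have h3 := hP.lintegral_killedExp_of_clockNN_lt hα0 ha hβ h0 t N hBm
    have h4 : ∀ f : PathSpace → ℝ≥0∞, ∫⁻ w in {w | 0 < pssMp a t w},
        {w | stopPath t w ∈ (Subtype.val ⁻¹' B' : Set PathSpace) ∧ clockNN α a t w < N}.indicator 1 w * f w ∂P =
        ∫⁻ w, (A N).indicator 1 w * f w ∂P := fun f => by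
      rw [← lintegral_indicator (measurableSet_pssMp_pos a t)]
      refine lintegral_congr fun w => ?_
      simp only [A, Set.inter_indicator_one, Pi.mul_apply]
      by_cases hw : w ∈ {w | 0 < pssMp a t w}
      · simp only [Set.indicator_of_mem hw, Pi.one_apply, one_mul]
      · simp only [Set.indicator_of_notMem hw, zero_mul]
    rw [h4, h4] at h3
    rw [h3, ← lintegral_indicator (hA N)]
    refine lintegral_congr fun w => ?_
    by_cases hw : w ∈ A N
    · simp only [Set.indicator_of_mem hw, Pi.one_apply, one_mul]
    · simp only [Set.indicator_of_notMem hw, zero_mul]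
  have hBt : MeasurableSet {w | stopPath t w ∈ (Subtype.val ⁻¹' B' : Set PathSpace)} :=
    measurable_stopPath t hBm
  -- let the cut-off `N` tend to infinity
  rw [Measure.map_apply hJ hE, hpre, hSmono.measure_iUnion]
  simp only [hN]
  rw [← hAmono.measure_iUnion, hρ, withDensity_apply _ (MeasurableSet.iUnion hA),
    ← lintegral_indicator (MeasurableSet.iUnion hA), ← lintegral_indicator hBt]
  refine lintegral_congr fun w => ?_
  by_cases hw : stopPath t w ∈ (Subtype.val ⁻¹' B' : Set PathSpace)
  · rw [Set.indicator_of_mem (show w ∈ {w | stopPath t w ∈ (Subtype.val ⁻¹' B' : Set PathSpace)} from hw)]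
    by_cases hpos : 0 < pssMp a t w
    · obtain ⟨N, hN⟩ := exists_nat_gt (clockNN α a t w)
      rw [Set.indicator_of_mem (show w ∈ ⋃ N, A N from Set.mem_iUnion.2 ⟨N, hpos, hw, hN⟩)]
    · rw [powerDensity_of_eq_zero (le_antisymm (not_lt.1 hpos) (pssMp_nonneg a t w))]
      refine Set.indicator_of_notMem (fun h => ?_) _
      obtain ⟨N, h⟩ := Set.mem_iUnion.1 h
      exact hpos h.1
  · rw [Set.indicator_of_notMem (show w ∉ {w | stopPath t w ∈ (Subtype.val ⁻¹' B' : Set PathSpace)} from hw)]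
    refine Set.indicator_of_notMem (fun h => ?_) _
    obtain ⟨N, h⟩ := Set.mem_iUnion.1 h
    exact hw h.2.1

end IsUnitStableSubordinator

/-! ### The three laws -/

namespace IsUnitStableSubordinator

variable {α a : ℝ} {P : Measure PathSpace} [IsProbabilityMeasure P]

/-- The ratio `U(a - x) / U(a)` is a power of order `α` of the ratio of the distances to `a`. -/
lemma isConditionedBelow_iff (hP : IsUnitStableSubordinator α P) (hα : 0 < α) (ha : 0 < a)
    {Q : Measure PathSpace} :
    IsConditionedBelow a P Q ↔ IsProbabilityMeasure Q ∧ IsPowerTransform a α P Q := by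
  have hΓ : 0 < Real.Gamma (1 + α) := Real.Gamma_pos_of_pos (by linarith)
  refine isDoobTransform_iff ha (fun x hx => if_neg (not_lt.2 hx)) fun x hx => ?_
  have hx' : 0 < a - x := sub_pos.2 hx
  rw [if_pos hx, if_pos ha, sub_zero, hP.renewal_eq hα hx'.le, hP.renewal_eq hα ha.le,
    ← ENNReal.ofReal_div_of_pos (div_pos (Real.rpow_pos_of_pos ha _) hΓ),
    div_div_div_cancel_right₀ hΓ.ne', Real.div_rpow hx'.le ha.le]

lemma isDoobTransform_renewalDensity_iff (hP : IsUnitStableSubordinator α P) (hα : 0 < α) (ha : 0 < a)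
    {u : ℝ → ℝ≥0} (hu : IsRenewalDensity P u) {Q : Measure PathSpace} :
    IsDoobTransform P (fun x => if x < a then (u (a - x) : ℝ≥0∞) else 0) Q ↔
      IsProbabilityMeasure Q ∧ IsPowerTransform a (α - 1) P Q := by
  have hΓ : 0 < Real.Gamma α := Real.Gamma_pos_of_pos hα
  refine isDoobTransform_iff ha (fun x hx => if_neg (not_lt.2 hx)) fun x hx => ?_
  have hx' : 0 < a - x := sub_pos.2 hx
  have e : ∀ y, (renewalDensity α y : ℝ≥0∞) = ENNReal.ofReal (y ^ (α - 1) / Real.Gamma α) := fun _ => rfl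
  rw [if_pos hx, if_pos ha, sub_zero, hP.renewalDensity_unique hα hu hx',
    hP.renewalDensity_unique hα hu ha, e, e,
    ← ENNReal.ofReal_div_of_pos (div_pos (Real.rpow_pos_of_pos ha _) hΓ),
    div_div_div_cancel_right₀ hΓ.ne', Real.div_rpow hx'.le ha.le]

/-- The ratio `u(a - x) / u(a)` is a power of order `α - 1` of the ratio of the distances to `a`, whatever
the continuous version `u` of the density. -/
lemma isContinuouslyAbsorbed_iff (hP : IsUnitStableSubordinator α P) (hα : 0 < α) (ha : 0 < a)
    {Q : Measure PathSpace} :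
    IsContinuouslyAbsorbed a P Q ↔ IsProbabilityMeasure Q ∧ IsPowerTransform a (α - 1) P Q :=
  ⟨fun ⟨_, hu, h⟩ => (hP.isDoobTransform_renewalDensity_iff hα ha hu).1 h, fun h =>
    ⟨_, hP.isRenewalDensity hα, (hP.isDoobTransform_renewalDensity_iff hα ha (hP.isRenewalDensity hα)).2 h⟩⟩

end IsUnitStableSubordinator

theorem mainTheorem5 (α : ℝ) (hα0 : 0 < α) (hα1 : α < 1) (a : ℝ) (ha : 0 < a)
    (P : Measure PathSpace) [IsProbabilityMeasure P] (hP : IsUnitStableSubordinator α P) :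
    -- the process underlying `Y` under `P`
    ((∀ᵐ w ∂P, LampertiRepresentation α a w) ∧
      IsNegKilledSubordinator (1 / Real.Gamma (1 - α)) (lamperti α a) P ∧
      ∀ lam : ℝ, 0 ≤ lam → HasLaplaceExponentAt (lamperti α a) P lam
        (Real.Gamma (1 + lam) / Real.Gamma (1 + lam - α))) ∧
    -- the conditioned process
    (Supermartingale (fun t w => killedExp α (lamperti α a t w))
        (pastFiltration (lamperti α a)) P ∧
      ¬ Martingale (fun t w => killedExp α (lamperti α a t w))
        (pastFiltration (lamperti α a)) P) ∧
    (∃! Q : Measure PathSpace, IsConditionedBelow a P Q) ∧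
    (∀ Q : Measure PathSpace, IsConditionedBelow a P Q →
      (∀ᵐ w ∂Q, LampertiRepresentation α a w) ∧
      IsEsscherTransform α (lamperti α a) P Q ∧
      IsNegKilledSubordinator (Real.Gamma (1 + α)) (lamperti α a) Q ∧
      ∀ lam : ℝ, 0 ≤ lam → HasLaplaceExponentAt (lamperti α a) Q lam
        (Real.Gamma (1 + lam + α) / Real.Gamma (1 + lam))) ∧
    -- the continuously absorbed process
    Martingale (fun t w => killedExp (α - 1) (lamperti α a t w))
      (pastFiltration (lamperti α a)) P ∧
    (∃! Q : Measure PathSpace, IsContinuouslyAbsorbed a P Q) ∧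
    (∀ Q : Measure PathSpace, IsContinuouslyAbsorbed a P Q →
      (∀ᵐ w ∂Q, LampertiRepresentation α a w) ∧
      IsEsscherTransform (α - 1) (lamperti α a) P Q ∧
      IsNegKilledSubordinator 0 (lamperti α a) Q ∧
      (∀ lam : ℝ, 0 < lam → HasLaplaceExponentAt (lamperti α a) Q lam
        (Real.Gamma (α + lam) / Real.Gamma lam)) ∧
      HasLaplaceExponentAt (lamperti α a) Q 0 0) := by
  have hα1' : α - 1 ≤ 0 := by linarith
  have hαα : α - 1 ≤ α := by linarith
  have hd := hP.ae_isDecreasingPath ha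
  have hrep : ∀ {Q : Measure PathSpace}, (∀ᵐ w ∂Q, IsDecreasingPath a fun t => pssMp a t w) →
      ∀ᵐ w ∂Q, LampertiRepresentation α a w := fun h => by
    filter_upwards [h] with w hw
    exact lampertiRepresentation_of_isDecreasingPath hα0 ha hw
  have e0 : stableExponent α 0 = 1 / Real.Gamma (1 - α) := by
    rw [stableExponent, add_zero, Real.Gamma_one]
  have eα : stableExponent α α = Real.Gamma (1 + α) := by
    rw [stableExponent, add_sub_cancel_right, Real.Gamma_one, div_one]
  have e1 := stableExponent_sub_one α
  have hpos0 : 0 < stableExponent α 0 := stableExponent_pos hα0 (by linarith)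
  have hposα : 0 < stableExponent α α := stableExponent_pos hα0 (by linarith)
  refine ⟨⟨hrep hd, ?_, fun lam hl => ?_⟩, ⟨?_, ?_⟩, ?_, fun Q hQ => ?_, ?_, ?_, fun Q hQ => ?_⟩
  · rw [← e0]
    exact hP.isNegKilledSubordinator_of_isEsscherTransform hα0 ha hα1' hpos0.le hd
      (isEsscherTransform_zero hα0 ha hd)
  · have h := hP.hasLaplaceExponentAt_of_isEsscherTransform hα0 ha hd (isEsscherTransform_zero hα0 ha hd)
      (lam := lam) (by linarith)
    rwa [add_zero] at h
  · exact hP.supermartingale_killedExp hα0 ha hαα hposα.le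
  · exact hP.not_martingale_killedExp hα0 ha hαα hposα.ne'
  · obtain ⟨Q, hQ, hQt⟩ := hP.exists_isPowerTransform_self hα0 ha
    refine ⟨Q, (hP.isConditionedBelow_iff hα0 ha).2 ⟨hQ, hQt⟩, fun Q' hQ' => ?_⟩
    obtain ⟨h1, h2⟩ := (hP.isConditionedBelow_iff hα0 ha).1 hQ'
    exact h2.unique hQt
  · obtain ⟨h1, h2⟩ := (hP.isConditionedBelow_iff hα0 ha).1 hQ
    have hQd := h2.ae_isDecreasingPath ha hd
    have hE := h2.isEsscherTransform hP hα0 ha hαα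
    refine ⟨hrep hQd, hE, ?_, fun lam hl => ?_⟩
    · rw [← eα]
      exact hP.isNegKilledSubordinator_of_isEsscherTransform hα0 ha hαα hposα.le hQd hE
    · have h := hP.hasLaplaceExponentAt_of_isEsscherTransform hα0 ha hQd hE (lam := lam) (by linarith)
      rwa [stableExponent, ← add_assoc, add_sub_cancel_right] at h
  · exact hP.martingale_killedExp hα0 ha le_rfl e1
  · obtain ⟨Q, hQ, hQt⟩ := hP.exists_isPowerTransform_of_stableExponent_eq_zero hα0 hα1 ha le_rfl e1
    refine ⟨Q, (hP.isContinuouslyAbsorbed_iff hα0 ha).2 ⟨hQ, hQt⟩, fun Q' hQ' => ?_⟩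
    obtain ⟨h1, h2⟩ := (hP.isContinuouslyAbsorbed_iff hα0 ha).1 hQ'
    exact h2.unique hQt
  · obtain ⟨h1, h2⟩ := (hP.isContinuouslyAbsorbed_iff hα0 ha).1 hQ
    have hQd := h2.ae_isDecreasingPath ha hd
    have hE := h2.isEsscherTransform hP hα0 ha le_rfl
    refine ⟨hrep hQd, hE, ?_, fun lam hl => ?_, ?_⟩
    · rw [← e1]
      exact hP.isNegKilledSubordinator_of_isEsscherTransform hα0 ha le_rfl e1.ge hQd hE
    · have h := hP.hasLaplaceExponentAt_of_isEsscherTransform hα0 ha hQd hE (lam := lam) (by linarith)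
      have e2 : 1 + (lam + (α - 1)) = α + lam := by ring
      rwa [stableExponent, e2, add_sub_cancel_left] at h
    · have h := hP.hasLaplaceExponentAt_of_isEsscherTransform hα0 ha hQd hE (lam := 0) (by linarith)
      rwa [zero_add, e1] at h
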